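/- Let $M$ be a smooth (Hausdorff, second countable) manifold of dimension $d\ge 3$ with a smooth semi-Riemannian metric $g$ and a smooth function $\Omega$ such that $d\Omega\neq 0$ on $\mathscr J:=\{\Omega=0\}$. Let $\eta$ be a smooth conformal Killing vector field, $\mathcal L_\eta g=2\psi g$ with $\psi$ smooth, such that $\eta(\Omega)=(\psi-1)\Omega$. Assume that $\eta$ has a bifurcate horizon with branches $\mathscr J$ and $\mathcal H$: that is, $\mathscr J$ and $\mathcal H$ are embedded null hypersurfaces which intersect transversally in a non-empty set $\mathcal S=\mathscr J\cap\mathcal H$ (the bifurcation surface) on which the induced metric is nondegenerate, $\eta$ vanishes on $\mathcal S$, and on $\mathscr J\setminus\mathcal S$ and on $\mathcal H\setminus\mathcal S$ the field $\eta$ is nowhere zero and is tangent to the null generators of the respective hypersurface. For a smooth metric $g$, a smooth function $\Omega$ and an open set $V$, say that a function $\omega$ on $V$ puts $(g,\Omega)$ in a geodesic Killing gauge on $V$ if $\omega$ is smooth and nowhere zero on $V$ and, with $g'=\omega^2 g$ and $\Omega'=\omega\Omega$, one has $|\nabla'\Omega'|^2_{g'}=0$ and $\mathcal L_\eta g'=0$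 on $V$. Then: 1. There are an open neighbourhood $U$ of $\mathcal S$ and a function that puts $(g,\Omega)$ in a geodesic Killing gauge on $U$. 2. The remaining gauge freedom is exactly a nowhere vanishing smooth function on $\mathcal S$. Precisely, let $\omega$ put $(g,\Omega)$ in a geodesic Killing gauge on an open neighbourhood $U$ of $\mathcal S$, and write $(g',\Omega')=(\omega^2 g,\omega\Omega)$. (a) For every nowhere vanishing smooth function $\theta$ on $\mathcal S$ there are an open set $V$ with $\mathcal S\subseteq V\subseteq U$ and a function $\chi$ that puts $(g',\Omega')$ in a geodesic Killing gauge on $V$ and satisfies $\chi|_{\mathcal S}=\theta$. (b) If $\chi_1,\chi_2$ put $(g',\Omega')$ in a geodesic Killing gauge on open sets $V_1,V_2$ with $\mathcal S\subseteq V_i\subseteq U$, and $\chi_1=\chi_2$ on $\mathcal S$, then $\chi_1=\chi_2$ on an open neighbourhood of $\mathcal S$ contained in $V_1\cap V_2$. -/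

import Mathlib

open Set Filter Topology
open scoped Manifold ContDiff Bundle

namespace ConformalGauge

noncomputable section

variable {d : ℕ} {M : Type*} [TopologicalSpace M]
  [ChartedSpace (EuclideanSpace ℝ (Fin d)) M] [IsManifold (𝓡 d) ∞ M]

variable (d M) in
/-- A (not necessarily continuous) field of bilinear forms on the tangent spaces of `M`. -/
abbrev FormField : Type _ :=
  ∀ x : M, TangentSpace (𝓡 d) x →L[ℝ] TangentSpace (𝓡 d) x →L[ℝ] ℝ

variable (d M) in
/-- A (not necessarily continuous) vector field on `M`. -/
abbrev VField : Type _ := ∀ x : M, TangentSpace (𝓡 d) x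

/-- Smooth semi-Riemannian metric of arbitrary signature. -/
structure IsSemiRiemannianMetric (g : FormField d M) : Prop where
  smooth : ContMDiff (𝓡 d)
    ((𝓡 d).prod 𝓘(ℝ, EuclideanSpace ℝ (Fin d) →L[ℝ] EuclideanSpace ℝ (Fin d) →L[ℝ] ℝ)) ∞
    (fun x => Bundle.TotalSpace.mk'
      (EuclideanSpace ℝ (Fin d) →L[ℝ] EuclideanSpace ℝ (Fin d) →L[ℝ] ℝ)
      (E := fun x : M => TangentSpace (𝓡 d) x →L[ℝ] TangentSpace (𝓡 d) x →L[ℝ] ℝ) x (g x))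
  symm : ∀ (x : M) (v w : TangentSpace (𝓡 d) x), g x v w = g x w v
  nondegenerate : ∀ (x : M) (v : TangentSpace (𝓡 d) x), (∀ w, g x v w = 0) → v = 0

/-- Smoothness of a vector field at a point. -/
def VField.SmoothAt (X : VField d M) (x : M) : Prop :=
  ContMDiffAt (𝓡 d) (𝓡 d).tangent ∞
    (fun y => (⟨y, X y⟩ : TangentBundle (𝓡 d) M)) x

/-- The gradient of `f` at `x`: `g x` is regarded as the map `v ↦ g(v, ·)` from the tangent to
the cotangent space, and its inverse is applied to the differential of `f`. -/
def gradient (g : FormField d M) (f : M → ℝ) (x : M) : TangentSpace (𝓡 d) x :=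
  (g x).inverse (mvfderiv (𝓡 d) f x)

/-- `|∇f|²_g`. -/
def gradSq (g : FormField d M) (f : M → ℝ) (x : M) : ℝ :=
  g x (gradient g f x) (gradient g f x)

/-- `η(b(X,Y)) - b([η,X],Y) - b(X,[η,Y])`, the value of `L_η b` on `X, Y`. -/
def lieDerivForm (η : VField d M) (b : FormField d M) (X Y : VField d M) (x : M) : ℝ :=
  mvfderiv (𝓡 d) (fun y => b y (X y) (Y y)) x (η x)
    - b x (VectorField.mlieBracket (𝓡 d) η X x) (Y x)
    - b x (X x) (VectorField.mlieBracket (𝓡 d) η Y x)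

/-- `L_η b = c` at the point `x`. -/
def LieDerivEqAt (η : VField d M) (b c : FormField d M) (x : M) : Prop :=
  ∀ X Y : VField d M, X.SmoothAt x → Y.SmoothAt x →
    lieDerivForm η b X Y x = c x (X x) (Y x)

/-- `η` is a conformal Killing field with `L_η g = 2 ψ g`. -/
structure IsConformalKilling (g : FormField d M) (η : VField d M) (ψ : M → ℝ) : Prop where
  smooth_field : ∀ x, η.SmoothAt x
  smooth_factor : ContMDiff (𝓡 d) 𝓘(ℝ, ℝ) ∞ ψ
  lie_eq : ∀ x, LieDerivEqAt η g (fun y => (2 * ψ y) • g y) x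

/-- Smooth embedded hypersurface (without boundary): locally the zero set of a smooth function
with non-vanishing differential. -/
def IsHypersurface (N : Set M) : Prop :=
  ∀ p ∈ N, ∃ f : M → ℝ, ContMDiffAt (𝓡 d) 𝓘(ℝ, ℝ) ∞ f p ∧ mvfderiv (𝓡 d) f p ≠ 0 ∧
    ∀ᶠ x in 𝓝 p, (x ∈ N ↔ f x = 0)

variable (d) in
/-- The tangent space at `p` of an embedded submanifold `N`, as a subspace of the tangent space
of `M`: the vectors that annihilate every smooth function vanishing on `N` near `p`. -/
def tangentSub (N : Set M) (p : M) : Submodule ℝ (TangentSpace (𝓡 d) p) where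
  carrier := {v | ∀ f : M → ℝ, ContMDiffAt (𝓡 d) 𝓘(ℝ, ℝ) ∞ f p →
    (∀ᶠ x in 𝓝[N] p, f x = 0) → mvfderiv (𝓡 d) f p v = 0}
  add_mem' := by
    intro a b ha hb f hf hz
    rw [map_add, ha f hf hz, hb f hf hz, add_zero]
  zero_mem' := by
    intro f _ _
    exact map_zero _
  smul_mem' := by
    intro c a ha f hf hz
    rw [map_smul, ha f hf hz, smul_zero]

/-- `v` is a nonzero vector tangent to `N` at `p` and orthogonal to `N`; on a null hypersurface,
these are the vectors along the null generators. -/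
def IsNullGeneratorAt (g : FormField d M) (N : Set M) (p : M) (v : TangentSpace (𝓡 d) p) : Prop :=
  v ≠ 0 ∧ v ∈ tangentSub d N p ∧ ∀ w ∈ tangentSub d N p, g p v w = 0

/-- Null hypersurface: the induced bilinear form is degenerate at every point. -/
structure IsNullHypersurface (g : FormField d M) (N : Set M) : Prop where
  hypersurface : IsHypersurface (d := d) N
  null : ∀ p ∈ N, ∃ v, IsNullGeneratorAt g N p v

/-- The null hypersurfaces `N₁` and `N₂` are the two branches of a bifurcate horizon of the field
`η`, with bifurcation surface `N₁ ∩ N₂`: they intersect transversally, the metric induced on the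
intersection is nondegenerate (spacelike, in Lorentzian signature), `η` vanishes there, and
elsewhere on each branch `η` is nonzero and along the null generators. -/
structure IsBifurcateHorizon (g : FormField d M) (η : VField d M) (N₁ N₂ : Set M) : Prop where
  null_fst : IsNullHypersurface g N₁
  null_snd : IsNullHypersurface g N₂
  nonempty : (N₁ ∩ N₂).Nonempty
  transverse : ∀ p ∈ N₁ ∩ N₂, tangentSub d N₁ p ⊔ tangentSub d N₂ p = ⊤
  nondegenerate : ∀ p ∈ N₁ ∩ N₂, ∀ v ∈ tangentSub d N₁ p ⊓ tangentSub d N₂ p,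
    (∀ w ∈ tangentSub d N₁ p ⊓ tangentSub d N₂ p, g p v w = 0) → v = 0
  vanish : ∀ p ∈ N₁ ∩ N₂, η p = 0
  generator_fst : ∀ p ∈ N₁ \ N₂, IsNullGeneratorAt g N₁ p (η p)
  generator_snd : ∀ p ∈ N₂ \ N₁, IsNullGeneratorAt g N₂ p (η p)

/-- Conformal infinity. -/
def scri (Ω : M → ℝ) : Set M := {x | Ω x = 0}

/-- `(M, g, Ω)` is a conformal manifold: `Ω` is smooth, with nonzero differential on its zero
set. -/
structure IsConformalManifold (g : FormField d M) (Ω : M → ℝ) : Prop where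
  metric : IsSemiRiemannianMetric g
  smooth : ContMDiff (𝓡 d) 𝓘(ℝ, ℝ) ∞ Ω
  regular : ∀ x ∈ scri Ω, mvfderiv (𝓡 d) Ω x ≠ 0

/-- The conformally rescaled metric `φ² g`. -/
def rescale (φ : M → ℝ) (g : FormField d M) : FormField d M := fun x => (φ x ^ 2) • g x

/-- `φ` is a smooth, nowhere vanishing function on `V`, and on `V` the gauge `(φ² g, φ Ω)` satisfies
`|∇(φΩ)|² = 0` (with respect to `φ² g`) and `L_η (φ² g) = 0`. -/
structure IsGeodesicKillingGauge (g : FormField d M) (Ω : M → ℝ) (η : VField d M)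
    (φ : M → ℝ) (V : Set M) : Prop where
  smooth : ContMDiffOn (𝓡 d) 𝓘(ℝ, ℝ) ∞ φ V
  ne_zero : ∀ x ∈ V, φ x ≠ 0
  geodesic : ∀ x ∈ V, gradSq (rescale φ g) (fun y => φ y * Ω y) x = 0
  killing : ∀ x ∈ V, LieDerivEqAt η (rescale φ g) (fun _ => 0) x

variable (d) in
/-- `θ` is a smooth function on the embedded submanifold `S`: locally, it is the restriction of a
smooth function on `M`. -/
def IsSmoothOn {S : Set M} (θ : S → ℝ) : Prop :=
  ∀ p : S, ∃ f : M → ℝ, ContMDiffAt (𝓡 d) 𝓘(ℝ, ℝ) ∞ f p ∧ ∀ᶠ q : S in 𝓝 p, f q = θ q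

end

end ConformalGauge

/-! Near a point of 𝓢 take coordinates (x, y, s) in which y = Ω and 𝓗 is x = 0, so that 𝓢 is x = y =
0 (`exists_adaptedParam`, `IsParam.flatHorizon`). A gauge has no zeros, hence is locally ε e^σ with
a constant sign ε, and the two conditions become η(σ) = -ψ and |dy + y dσ|² = 0. Both degenerate on
𝓢, and both become regular after division by y.

Killing equation on 𝓗. At 𝓢 the field η and its derivatives along 𝓢 vanish, so on vectors tangent to
𝓢 the conformal Killing equation reads 0 = 2ψg; since the induced metric is nondegenerate and dim 𝓢
= d - 2 > 0, ψ = 0 on 𝓢. By Hadamard's lemma, on x = 0 one has ψ = y k and η = y (ψ - 1, b) in the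
variables (y, s). The quotient is a transport equation transverse to 𝓢, which fixes σ on 𝓗 from its
values on 𝓢 (`FlatHorizon.exists_slice_gauge`).

Eikonal equation. As 𝓙 is null, |dy|² = y m, and division by y leaves m + 2⟨dy, dσ⟩ + y |dσ|² = 0.
Here ⟨dx, dy⟩ ≠ 0 at 𝓢, for otherwise ∇y would be both tangent and orthogonal to 𝓢. So 𝓗 is
noncharacteristic, and the equation is solved for ∂σ/∂x and integrated by characteristics from the
data on 𝓗 (`exists_hamiltonJacobi`, `FlatHorizon.exists_eikonal`).

Propagation. With u = y e^σ and τ = η(σ) + ψ one has η(u) = u (τ - 1). Differentiating |du|² = 0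
along the conformal Killing field gives u ⟨dτ, du⟩ = 0. Thus τ is constant along a field transverse
to 𝓗, and it vanishes on 𝓗 (`FlatHorizon.exists_gauge`).

Uniqueness. The difference of two solutions satisfies homogeneous linear transport equations, along
𝓗 and then off 𝓗, because |α₁|² - |α₂|² = ⟨α₁ - α₂, α₁ + α₂⟩ for the forms αᵢ = dy + y dσᵢ
(`FlatHorizon.gauge_unique`, `transport_unique`).

Globally, local gauges with the same values on 𝓢 have the same germs along 𝓢, and paracompactness
glues them (`exists_glue`). The gauges of (φ²g, φΩ) are those of (g, Ω) divided by φ, which gives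
the statements about the remaining freedom.

The analytic tools (smooth local flows, Hadamard's lemma) come from the smoothness of u ↦ f ∘ u on
spaces of continuous curves, together with the implicit function theorem. -/

namespace ConformalGauge

universe u

set_option linter.unusedSectionVars false

/-! ### Superposition operators on spaces of continuous functions -/

section Superposition

variable {I : Type*} [TopologicalSpace I] [CompactSpace I]
  {E G : Type*} [NormedAddCommGroup E] [NormedSpace ℝ E] [NormedAddCommGroup G] [NormedSpace ℝ G]

/-- The pointwise application of a bilinear map to continuous functions. -/
noncomputable def pointwiseBilin {E₁ : Type*} [NormedAddCommGroup E₁] [NormedSpace ℝ E₁]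
    (b : E₁ →L[ℝ] E →L[ℝ] G) : C(I, E₁) →L[ℝ] C(I, E) →L[ℝ] C(I, G) :=
  LinearMap.mkContinuous₂
    (LinearMap.mk₂ ℝ
      (fun (A : C(I, E₁)) (h : C(I, E)) => (⟨fun τ => b (A τ) (h τ), by fun_prop⟩ : C(I, G)))
      (by intros; ext; simp) (by intros; ext; simp) (by intros; ext; simp)
      (by intros; ext; simp)) ‖b‖
    (by
      intro A h
      refine (ContinuousMap.norm_le _ (by positivity)).2 fun τ => ?_
      refine (b.le_opNorm₂ (A τ) (h τ)).trans ?_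
      gcongr
      · exact A.norm_coe_le_norm τ
      · exact h.norm_coe_le_norm τ)

lemma pointwiseBilin_apply {E₁ : Type*} [NormedAddCommGroup E₁] [NormedSpace ℝ E₁]
    (b : E₁ →L[ℝ] E →L[ℝ] G) (A : C(I, E₁)) (h : C(I, E)) (τ : I) :
    pointwiseBilin b A h τ = b (A τ) (h τ) := rfl

lemma contDiff_pointwiseBilin_comp {E₁ W : Type*} [NormedAddCommGroup E₁] [NormedSpace ℝ E₁]
    [NormedAddCommGroup W] [NormedSpace ℝ W] {n : WithTop ℕ∞}
    (b : E₁ →L[ℝ] E →L[ℝ] G) {A : W → C(I, E₁)} (hA : ContDiff ℝ n A) :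
    ContDiff ℝ n fun u => pointwiseBilin b (A u) :=
  (pointwiseBilin (I := I) b).contDiff.comp hA

/-- Pointwise application of a continuous family of operators to a continuous family of vectors. -/
noncomputable def pointwiseApply (I E G : Type*) [TopologicalSpace I] [CompactSpace I]
    [NormedAddCommGroup E] [NormedSpace ℝ E] [NormedAddCommGroup G] [NormedSpace ℝ G] :
    C(I, E →L[ℝ] G) →L[ℝ] C(I, E) →L[ℝ] C(I, G) :=
  pointwiseBilin (ContinuousLinearMap.id ℝ (E →L[ℝ] G))

@[simp] lemma pointwiseApply_apply (A : C(I, E →L[ℝ] G)) (h : C(I, E)) (τ : I) :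
    pointwiseApply I E G A h τ = A τ (h τ) :=
  pointwiseBilin_apply (ContinuousLinearMap.id ℝ (E →L[ℝ] G)) A h τ

/-- Superposition by a continuous map. -/
def superpose (I : Type*) [TopologicalSpace I] {E G : Type*} [TopologicalSpace E]
    [TopologicalSpace G] (f : E → G) (hf : Continuous f) (u : C(I, E)) : C(I, G) :=
  (⟨f, hf⟩ : C(E, G)).comp u

@[simp] lemma superpose_apply (f : E → G) (hf : Continuous f) (u : C(I, E)) (τ : I) :
    superpose I f hf u τ = f (u τ) := rfl

lemma continuous_superpose (f : E → G) (hf : Continuous f) : Continuous (superpose I f hf) :=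
  ContinuousMap.continuous_postcomp _

/-- Postcomposition with f' is continuous for the sup norm, so f' at u + s(v - u) is within ε of f'
at u, uniformly over the compact space. The mean value inequality on each segment from u(τ) to v(τ)
then bounds the remainder by ε‖v - u‖. -/
lemma hasFDerivAt_superpose (f : E → G) (f' : E → E →L[ℝ] G) (hf : ∀ x, HasFDerivAt f (f' x) x)
    (hf' : Continuous f') (hfc : Continuous f) (u : C(I, E)) :
    HasFDerivAt (superpose I f hfc) (pointwiseApply I E G (superpose I f' hf' u)) u := by
  rw [hasFDerivAt_iff_isLittleO, Asymptotics.isLittleO_iff]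
  intro ε hε
  have hc := (continuous_superpose (I := I) f' hf').continuousAt (x := u)
  obtain ⟨δ, hδ, H⟩ := Metric.continuousAt_iff.1 hc ε hε
  filter_upwards [Metric.ball_mem_nhds u hδ] with v hv
  rw [ContinuousMap.norm_le _ (by positivity)]
  intro τ
  have key : ‖f (v τ) - f (u τ) - f' (u τ) (v τ - u τ)‖ ≤ ε * ‖v τ - u τ‖ := by
    refine (convex_segment (u τ) (v τ)).norm_image_sub_le_of_norm_hasFDerivWithin_le'
      (fun x _ => (hf x).hasFDerivWithinAt) ?_ (left_mem_segment _ _ _) (right_mem_segment _ _ _)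
    intro x hx
    rw [segment_eq_image'] at hx
    obtain ⟨s, hs, rfl⟩ := hx
    have hb : u + s • (v - u) ∈ Metric.ball u δ := by
      rw [mem_ball_iff_norm, add_sub_cancel_left, norm_smul, Real.norm_of_nonneg hs.1]
      rw [mem_ball_iff_norm] at hv
      nlinarith [norm_nonneg (v - u), hs.2]
    have h1 := H hb
    rw [dist_eq_norm] at h1
    have h2 := (ContinuousMap.norm_coe_le_norm
      (superpose I f' hf' (u + s • (v - u)) - superpose I f' hf' u) τ).trans h1.le
    simpa using h2
  refine (le_of_eq_of_le ?_ key).trans ?_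
  · simp
  · gcongr
    exact ContinuousMap.norm_coe_le_norm (v - u) τ

/-- The derivative is again a superposition operator, that of f', followed by a fixed bounded
bilinear map; hence induction on n. The spaces are quantified inside the induction and share a
universe because f' takes values in E →L G. -/
lemma contDiff_superpose_nat (n : ℕ) : ∀ {E G : Type u} [NormedAddCommGroup E] [NormedSpace ℝ E]
    [NormedAddCommGroup G] [NormedSpace ℝ G] (f : E → G) (hfc : Continuous f),
    ContDiff ℝ n f → ContDiff ℝ n (superpose I f hfc) := by
  induction n with
  | zero =>
    intro E G _ _ _ _ f hfc _
    exact contDiff_zero.2 (continuous_superpose f hfc)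
  | succ n ih =>
    intro E G _ _ _ _ f hfc hf
    obtain ⟨f', hf'1, hf'2⟩ := contDiff_succ_iff_hasFDerivAt.1 (by exact_mod_cast hf)
    have := ih f' hf'1.continuous hf'1
    refine (contDiff_succ_iff_hasFDerivAt (n := n)).2 ⟨_, ?_,
      fun u => hasFDerivAt_superpose f f' hf'2 hf'1.continuous hfc u⟩
    exact contDiff_pointwiseBilin_comp _ this

lemma contDiff_superpose {E G : Type u} [NormedAddCommGroup E] [NormedSpace ℝ E]
    [NormedAddCommGroup G] [NormedSpace ℝ G] (f : E → G) (hfc : Continuous f) (hf : ContDiff ℝ ∞ f) :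
    ContDiff ℝ ∞ (superpose I f hfc) :=
  contDiff_infty.2 fun n => contDiff_superpose_nat n f hfc (contDiff_infty.1 hf n)

end Superposition

/-! ### Integration as a bounded operator on curves -/

section Integration

/-- The interval `[-1, 1]`. -/
abbrev SymInterval : Type := Icc (-1 : ℝ) 1

variable {E : Type*} [NormedAddCommGroup E] [NormedSpace ℝ E]

/-- The extension of a continuous function on `[-1, 1]` by constants. -/
noncomputable def extendSym (u : C(SymInterval, E)) (r : ℝ) : E :=
  IccExtend (by norm_num : (-1 : ℝ) ≤ 1) u r

lemma continuous_extendSym (u : C(SymInterval, E)) : Continuous (extendSym u) :=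
  u.continuous.Icc_extend'

lemma extendSym_coe (u : C(SymInterval, E)) (τ : SymInterval) : extendSym u τ = u τ :=
  IccExtend_val _ _ _

lemma norm_extendSym_le (u : C(SymInterval, E)) (r : ℝ) : ‖extendSym u r‖ ≤ ‖u‖ :=
  u.norm_coe_le_norm _

/-- `u ↦ (τ ↦ ∫ r in 0..τ, u r)` on `C([-1, 1], E)`. -/
noncomputable def primitiveCLM (E : Type*) [NormedAddCommGroup E] [NormedSpace ℝ E] :
    C(SymInterval, E) →L[ℝ] C(SymInterval, E) :=
  LinearMap.mkContinuous
    { toFun := fun u => ⟨fun τ => ∫ r in (0 : ℝ)..τ, extendSym u r, by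
        have := intervalIntegral.continuous_primitive
          (fun a b => (continuous_extendSym u).intervalIntegrable (μ := MeasureTheory.volume) a b) 0
        exact this.comp continuous_subtype_val⟩
      map_add' := by
        intro u v
        ext τ
        exact intervalIntegral.integral_add ((continuous_extendSym u).intervalIntegrable _ _)
          ((continuous_extendSym v).intervalIntegrable _ _)
      map_smul' := by
        intro c u
        ext τ
        exact intervalIntegral.integral_smul c _ } 1
    (by
      intro u
      rw [ContinuousMap.norm_le _ (by positivity)]
      intro τ
      have h1 := intervalIntegral.norm_integral_le_of_norm_le_const (a := 0) (b := (τ : ℝ))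
        (f := extendSym u) (C := ‖u‖) (fun r _ => norm_extendSym_le u r)
      have h2 : |(τ : ℝ) - 0| ≤ 1 := by
        rw [sub_zero]; exact abs_le.2 τ.2
      calc _ ≤ ‖u‖ * |(τ : ℝ) - 0| := h1
        _ ≤ ‖u‖ * 1 := by gcongr
        _ = 1 * ‖u‖ := by ring)

lemma primitiveCLM_apply (u : C(SymInterval, E)) (τ : SymInterval) :
    primitiveCLM E u τ = ∫ r in (0 : ℝ)..τ, extendSym u r := rfl

lemma norm_primitiveCLM_le (u : C(SymInterval, E)) : ‖primitiveCLM E u‖ ≤ ‖u‖ := by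
  have := (primitiveCLM E).le_of_opNorm_le (LinearMap.mkContinuous_norm_le _ zero_le_one _) u
  simpa using this

end Integration

end ConformalGauge

namespace ConformalGauge

set_option linter.unusedSectionVars false

/-! ### Implicit functions smooth in a neighbourhood -/

section Implicit

variable {E₁ E₂ G : Type*} [NormedAddCommGroup E₁] [NormedSpace ℝ E₁] [CompleteSpace E₁]
  [NormedAddCommGroup E₂] [NormedSpace ℝ E₂] [CompleteSpace E₂]
  [NormedAddCommGroup G] [NormedSpace ℝ G] [CompleteSpace G]

lemma eventually_isInvertible {W : Type*} [TopologicalSpace W] {A : W → E₂ →L[ℝ] G} {w : W}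
    (hA : ContinuousAt A w) (hw : (A w).IsInvertible) : ∀ᶠ w' in 𝓝 w, (A w').IsInvertible :=
  hA.eventually (ContinuousLinearEquiv.isOpen.mem_nhds hw)

/-- The implicit function theorem, with smoothness in a neighbourhood. -/
lemma exists_smooth_implicit {H : E₁ × E₂ → G} {w : E₁ × E₂}
    (hH : ∀ᶠ v in 𝓝 w, ContDiffAt ℝ ∞ H v) (h0 : H w = 0)
    (hi : (fderiv ℝ H w ∘L .inr ℝ E₁ E₂).IsInvertible) :
    ∃ U : E₁ → E₂, U w.1 = w.2 ∧ (∀ᶠ z in 𝓝 w.1, ContDiffAt ℝ ∞ U z ∧ H (z, U z) = 0) ∧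
      ∀ᶠ v in 𝓝 w, H v = 0 ↔ U v.1 = v.2 := by
  have hinf : (∞ : WithTop ℕ∞) ≠ 0 := by simp
  have hHw := hH.self_of_nhds
  set U := hHw.implicitFunction hinf hi with hU
  have hU0 : U w.1 = w.2 := hHw.implicitFunction_apply_self hinf hi
  have hiff := hHw.eventually_apply_eq_iff_implicitFunction hinf hi
  rw [h0] at hiff
  have hz := hHw.eventually_apply_implicitFunction hinf hi
  rw [h0] at hz
  have hUc : ContinuousAt U w.1 := (hHw.contDiffAt_implicitFunction hinf hi).continuousAt
  have hpair : Tendsto (fun z => (z, U z)) (𝓝 w.1) (𝓝 w) := by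
    have : ContinuousAt (fun z => (z, U z)) w.1 := continuousAt_id.prodMk hUc
    simpa [ContinuousAt, hU0] using this
  have hcont : ContinuousAt (fun v => fderiv ℝ H v ∘L .inr ℝ E₁ E₂) w := by
    have : ContinuousAt (fderiv ℝ H) w := (hHw.fderiv_right (m := 0) (by simp)).continuousAt
    fun_prop
  refine ⟨U, hU0, ?_, hiff⟩
  filter_upwards [hz, hpair.eventually hH, hpair.eventually (eventually_isInvertible hcont hi),
    hpair.eventually hiff.eventually_nhds] with z h1 h2 h3 h4
  refine ⟨?_, h1⟩
  -- `U` is so far smooth at the base point only. The implicit function based at (z, U z) is smooth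
  -- at z, and by `hiff` it coincides with `U` near z.
  have hV := h2.contDiffAt_implicitFunction hinf h3
  refine hV.congr_of_eventuallyEq ?_
  have hV0 := h2.implicitFunction_apply_self hinf h3
  have hVz := h2.eventually_apply_implicitFunction hinf h3
  have hpair' : Tendsto (fun z' => (z', h2.implicitFunction hinf h3 z')) (𝓝 z)
      (𝓝 (z, U z)) := by
    have : ContinuousAt (fun z' => (z', h2.implicitFunction hinf h3 z')) z :=
      continuousAt_id.prodMk hV.continuousAt
    simpa [ContinuousAt, hV0] using this
  filter_upwards [hVz, hpair'.eventually h4] with z' h5 h6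
  exact h6.1 (h5.trans h1)

end Implicit

/-! ### Smooth dependence of local flows on time and initial point -/

section Flow

variable {E : Type*} [NormedAddCommGroup E] [NormedSpace ℝ E] [CompleteSpace E]

/-- The integral equation `u τ = x + t ∫ r in 0..τ, f (u r)` reads `flowEq f hf ((t, x), u) = 0`. -/
noncomputable def flowEq (f : E → E) (hf : Continuous f) (w : (ℝ × E) × C(SymInterval, E)) :
    C(SymInterval, E) :=
  w.2 - ContinuousMap.const _ w.1.2 - w.1.1 • primitiveCLM E (superpose SymInterval f hf w.2)

lemma contDiff_constMap {I : Type*} [TopologicalSpace I] [CompactSpace I] :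
    ContDiff ℝ ∞ (fun x : E => (ContinuousMap.const I x : C(I, E))) := by
  let c : E →ₗ[ℝ] C(I, E) :=
    { toFun := fun x => ContinuousMap.const I x, map_add' := fun _ _ => rfl,
      map_smul' := fun _ _ => rfl }
  exact (c.mkContinuous 1 fun x => by
    simpa using (ContinuousMap.norm_le _ (norm_nonneg x)).2 fun _ => le_rfl).contDiff

lemma contDiff_flowEq (f : E → E) (hf : ContDiff ℝ ∞ f) :
    ContDiff ℝ ∞ (flowEq f hf.continuous) := by
  have h1 := (contDiff_superpose (I := SymInterval) f hf.continuous hf).comp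
    (contDiff_snd (E := ℝ × E) (F := C(SymInterval, E)) (n := ∞) (𝕜 := ℝ))
  have h2 := (contDiff_constMap (E := E) (I := SymInterval)).comp
    ((contDiff_snd (E := ℝ) (F := E) (n := ∞) (𝕜 := ℝ)).comp
      (contDiff_fst (E := ℝ × E) (F := C(SymInterval, E)) (n := ∞) (𝕜 := ℝ)))
  exact (contDiff_snd.sub h2).sub
    ((contDiff_fst.comp contDiff_fst).smul ((primitiveCLM E).contDiff.comp h1))

/-- At t = 0 the integral term drops out and the equation is affine in the curve, so the implicit
function theorem applies there. -/
lemma fderiv_flowEq_inr (f : E → E) (hf : ContDiff ℝ ∞ f) (x : E) (u : C(SymInterval, E)) :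
    fderiv ℝ (flowEq f hf.continuous) ((0, x), u) ∘L .inr ℝ (ℝ × E) C(SymInterval, E) =
      ContinuousLinearMap.id ℝ _ := by
  have h1 : HasFDerivAt (flowEq f hf.continuous)
      (fderiv ℝ (flowEq f hf.continuous) ((0, x), u)) ((0, x), u) :=
    ((contDiff_flowEq f hf).differentiable (by simp) _).hasFDerivAt
  have h2 : HasFDerivAt (fun v : C(SymInterval, E) => (((0 : ℝ), x), v))
      (ContinuousLinearMap.inr ℝ (ℝ × E) C(SymInterval, E)) u :=
    hasFDerivAt_prodMk_right _ _
  have h3 := h1.comp u h2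
  refine h3.unique ?_
  have : (flowEq f hf.continuous ∘ fun v : C(SymInterval, E) => (((0 : ℝ), x), v)) =
      fun v => v - ContinuousMap.const _ x := by
    ext v
    simp [flowEq]
  rw [this]
  exact (hasFDerivAt_id u).sub_const _

/-- For |t| K < 1 the integral operator is a contraction. This identifies curves produced by
rescaling with those given by the implicit function theorem. -/
lemma flowEq_unique {f : E → E} (hf : Continuous f) {K : NNReal} (hK : LipschitzWith K f)
    {t : ℝ} (ht : |t| * K < 1) {x : E} {u v : C(SymInterval, E)}
    (hu : flowEq f hf ((t, x), u) = 0) (hv : flowEq f hf ((t, x), v) = 0) : u = v := by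
  have h1 : u - v = t • primitiveCLM E (superpose SymInterval f hf u - superpose SymInterval f hf v) := by
    simp only [flowEq] at hu hv
    rw [map_sub, smul_sub]
    rw [sub_eq_zero] at hu hv
    rw [← hu, ← hv]
    abel
  have h2 : ‖superpose SymInterval f hf u - superpose SymInterval f hf v‖ ≤ K * ‖u - v‖ := by
    refine (ContinuousMap.norm_le _ (by positivity)).2 fun τ => ?_
    refine (hK.norm_sub_le (u τ) (v τ)).trans ?_
    gcongr
    exact (u - v).norm_coe_le_norm τ
  have h3 : ‖u - v‖ ≤ |t| * K * ‖u - v‖ := by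
    calc ‖u - v‖ = |t| * ‖primitiveCLM E (superpose SymInterval f hf u -
            superpose SymInterval f hf v)‖ := by
          conv_lhs => rw [h1]
          rw [norm_smul, Real.norm_eq_abs]
      _ ≤ |t| * (K * ‖u - v‖) := by
          gcongr
          exact (norm_primitiveCLM_le _).trans h2
      _ = _ := by ring
  have h4 : ‖u - v‖ = 0 := by
    by_contra h
    have : 0 < ‖u - v‖ := lt_of_le_of_ne (norm_nonneg _) (Ne.symm h)
    nlinarith
  exact sub_eq_zero.1 (norm_eq_zero.1 h4)

lemma flowEq_eq_zero_iff {f : E → E} (hf : Continuous f) {t : ℝ} {x : E} {u : C(SymInterval, E)} :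
    flowEq f hf ((t, x), u) = 0 ↔
      ∀ τ ∈ Icc (-1 : ℝ) 1, extendSym u τ = x + t • ∫ r in (0 : ℝ)..τ, f (extendSym u r) := by
  constructor
  · intro h τ hτ
    have h1 := congrArg (fun v : C(SymInterval, E) => v ⟨τ, hτ⟩) h
    simp only [flowEq, ContinuousMap.sub_apply, ContinuousMap.const_apply,
      ContinuousMap.smul_apply, ContinuousMap.zero_apply, primitiveCLM_apply] at h1
    have h2 := extendSym_coe u ⟨τ, hτ⟩
    rw [sub_sub, sub_eq_zero] at h1
    simp only at h2
    rw [h2, h1]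
    rfl
  · intro h
    ext τ
    have h1 := h τ τ.2
    rw [extendSym_coe] at h1
    simp only [flowEq, ContinuousMap.sub_apply, ContinuousMap.const_apply,
      ContinuousMap.smul_apply, ContinuousMap.zero_apply, primitiveCLM_apply]
    rw [sub_sub, sub_eq_zero, h1]
    rfl

/-- The curve solving the equation for T, traversed at speed t/T, solves it for t. A single curve
thus contains all times |t| ≤ T; the symmetric interval covers both signs of t. -/
lemma flowEq_rescale {f : E → E} (hf : Continuous f) {T t : ℝ} (hT : 0 < T) (ht : |t| ≤ T) {x : E}
    {u : C(SymInterval, E)} (hu : flowEq f hf ((T, x), u) = 0) :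
    ∃ v : C(SymInterval, E), flowEq f hf ((t, x), v) = 0 ∧
      ∀ τ ∈ Icc (-1 : ℝ) 1, extendSym v τ = extendSym u (t / T * τ) := by
  have hmem : ∀ τ ∈ Icc (-1 : ℝ) 1, t / T * τ ∈ Icc (-1 : ℝ) 1 := by
    intro τ hτ
    rw [mem_Icc, ← abs_le] at hτ ⊢
    rw [abs_mul, abs_div, abs_of_pos hT]
    have : |t| / T ≤ 1 := (div_le_one hT).2 ht
    calc |t| / T * |τ| ≤ 1 * 1 := by gcongr
      _ = 1 := by ring
  let v : C(SymInterval, E) := ⟨fun τ => extendSym u (t / T * τ),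
    (continuous_extendSym u).comp (by fun_prop)⟩
  have hv : ∀ τ ∈ Icc (-1 : ℝ) 1, extendSym v τ = extendSym u (t / T * τ) :=
    fun τ hτ => extendSym_coe v ⟨τ, hτ⟩
  refine ⟨v, ?_, hv⟩
  rw [flowEq_eq_zero_iff] at hu ⊢
  intro τ hτ
  rw [hv τ hτ, hu _ (hmem τ hτ)]
  congr 1
  have h1 : ∫ r in (0 : ℝ)..τ, f (extendSym v r) =
      ∫ r in (0 : ℝ)..τ, f (extendSym u (t / T * r)) := by
    refine intervalIntegral.integral_congr fun r hr => ?_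
    have : r ∈ Icc (-1 : ℝ) 1 := by
      have h0 : (0 : ℝ) ∈ Icc (-1 : ℝ) 1 := by constructor <;> norm_num
      exact uIcc_subset_Icc h0 hτ hr
    simp only [hv r this]
  rw [h1]
  have h2 := intervalIntegral.smul_integral_comp_mul_left (a := 0) (b := τ)
    (fun r => f (extendSym u r)) (t / T)
  rw [mul_zero] at h2
  rw [← h2, smul_smul, mul_div_cancel₀ _ hT.ne']

/-- A smooth, globally Lipschitz vector field has a smooth local flow. -/
lemma exists_smooth_flow_of_lipschitz {f : E → E} (hf : ContDiff ℝ ∞ f) {K : NNReal}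
    (hK : LipschitzWith K f) (x₀ : E) :
    ∃ Φ : ℝ × E → E, (∀ᶠ w in 𝓝 ((0 : ℝ), x₀), ContDiffAt ℝ ∞ Φ w ∧
      HasDerivAt (fun t => Φ (t, w.2)) (f (Φ w)) w.1) ∧ ∀ᶠ x in 𝓝 x₀, Φ (0, x) = x := by
  obtain ⟨U, hU0, hU, -⟩ := exists_smooth_implicit (H := flowEq f hf.continuous)
    (w := ((0, x₀), ContinuousMap.const _ x₀))
    (Eventually.of_forall fun v => (contDiff_flowEq f hf).contDiffAt)
    (by ext; simp [flowEq])
    (by rw [fderiv_flowEq_inr f hf]; exact ⟨ContinuousLinearEquiv.refl ℝ _, rfl⟩)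
  simp only at hU0 hU
  have h1I : (1 : ℝ) ∈ Icc (-1 : ℝ) 1 := by constructor <;> norm_num
  have hlin : ∀ z, ContDiffAt ℝ ∞ U z → ContDiffAt ℝ ∞ (fun w => U w ⟨1, h1I⟩) z := fun z hz =>
    (ContinuousMap.evalCLM ℝ (M := E) (⟨1, h1I⟩ : SymInterval)).contDiff.contDiffAt.comp z hz
  refine ⟨fun w => U w ⟨1, h1I⟩, ?_, ?_⟩
  · obtain ⟨A, hA, B, hB, hAB⟩ := mem_nhds_prod_iff.1 hU
    obtain ⟨ρ, hρ, hρA⟩ := Metric.mem_nhds_iff.1 hA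
    -- T < ρ keeps the times |t| ≤ T where `U` is smooth and solves the equation; T K < 1 is the
    -- condition for uniqueness.
    obtain ⟨T, hT, hTρ, hTK⟩ : ∃ T : ℝ, 0 < T ∧ T < ρ ∧ T * K < 1 := by
      refine ⟨min (ρ / 2) (1 / (K + 1)), by positivity, ?_, ?_⟩
      · exact (min_le_left _ _).trans_lt (by linarith)
      · calc _ ≤ 1 / ((K : ℝ) + 1) * K := by gcongr; exact min_le_right _ _
          _ < 1 := by rw [one_div, inv_mul_lt_one₀ (by positivity)]; linarith
    have hmem : ∀ t : ℝ, |t| ≤ T → ∀ x ∈ B, ContDiffAt ℝ ∞ U (t, x) ∧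
        flowEq f hf.continuous ((t, x), U (t, x)) = 0 := fun t ht x hx =>
      hAB ⟨hρA (by rw [Metric.mem_ball, Real.dist_eq, sub_zero]; linarith), hx⟩
    -- The flow at time t is the value at parameter t/T of the one curve `U (T, x)`, so its time
    -- derivative follows from the integral equation for T and the fundamental theorem of calculus.
    have hval : ∀ t : ℝ, |t| ≤ T → ∀ x ∈ B,
        U (t, x) ⟨1, h1I⟩ = extendSym (U (T, x)) (t / T) := by
      intro t ht x hx
      obtain ⟨v, hv0, hv⟩ := flowEq_rescale hf.continuous hT ht
        (hmem T (by rw [abs_of_pos hT]) x hx).2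
      have huv : U (t, x) = v := by
        refine flowEq_unique hf.continuous hK (t := t) ?_ (hmem t ht x hx).2 hv0
        exact lt_of_le_of_lt (by gcongr) hTK
      have h2 := hv 1 h1I
      rw [huv]
      rw [mul_one] at h2
      rw [← h2]
      exact (extendSym_coe v ⟨1, h1I⟩).symm
    have hIoo : Ioo (-T) T ∈ 𝓝 (0 : ℝ) := Ioo_mem_nhds (by linarith) hT
    filter_upwards [prod_mem_nhds hIoo hB]
    rintro ⟨t, x⟩ ⟨ht, hx⟩
    simp only at ht hx
    refine ⟨hlin _ (hmem t (abs_le.2 ⟨ht.1.le, ht.2.le⟩) x hx).1, ?_⟩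
    simp only
    rw [hval t (abs_le.2 ⟨ht.1.le, ht.2.le⟩) x hx]
    set u := U (T, x) with hu
    have hueq := (flowEq_eq_zero_iff hf.continuous).1 (hmem T (by rw [abs_of_pos hT]) x hx).2
    have hd : HasDerivAt (fun s : ℝ => x + T • ∫ r in (0 : ℝ)..(s / T), f (extendSym u r))
        (f (extendSym u (t / T))) t := by
      have hc : Continuous fun r => f (extendSym u r) := hf.continuous.comp (continuous_extendSym u)
      have h3 := intervalIntegral.integral_hasDerivAt_right (hc.intervalIntegrable 0 (t / T))
        (hc.stronglyMeasurableAtFilter _ _) hc.continuousAt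
      have h4 := (h3.scomp t ((hasDerivAt_id t).div_const T)).const_smul T
      have h5 := h4.const_add x
      rw [smul_smul, mul_one_div_cancel hT.ne', one_smul] at h5
      exact h5
    refine hd.congr_of_eventuallyEq ?_
    filter_upwards [Ioo_mem_nhds ht.1 ht.2] with s hs
    rw [hval s (abs_le.2 ⟨hs.1.le, hs.2.le⟩) x hx]
    refine hueq _ ?_
    rw [mem_Icc, ← abs_le, abs_div, abs_of_pos hT]
    exact (div_le_one hT).2 (abs_le.2 ⟨hs.1.le, hs.2.le⟩)
  · have hcont : Tendsto (fun x : E => ((0 : ℝ), x)) (𝓝 x₀) (𝓝 (0, x₀)) :=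
      (Continuous.prodMk_right (0 : ℝ)).continuousAt
    filter_upwards [hcont.eventually hU] with x hx
    have := (flowEq_eq_zero_iff hf.continuous).1 hx.2 1 h1I
    rw [zero_smul, add_zero] at this
    exact (extendSym_coe _ ⟨1, h1I⟩).symm.trans this

end Flow

end ConformalGauge

namespace ConformalGauge

universe u

/-! ### Germs of smooth maps, Hadamard's lemma and linear transport -/

section SmoothNear

variable {E G H : Type*} [NormedAddCommGroup E] [NormedSpace ℝ E]
  [NormedAddCommGroup G] [NormedSpace ℝ G] [NormedAddCommGroup H] [NormedSpace ℝ H]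

/-- `f` is smooth in a neighbourhood of `z`. -/
def SmoothNear (f : E → G) (z : E) : Prop := ∀ᶠ w in 𝓝 z, ContDiffAt ℝ ∞ f w

lemma SmoothNear.contDiffAt {f : E → G} {z : E} (hf : SmoothNear f z) : ContDiffAt ℝ ∞ f z :=
  hf.self_of_nhds

lemma SmoothNear.continuousAt {f : E → G} {z : E} (hf : SmoothNear f z) : ContinuousAt f z :=
  hf.contDiffAt.continuousAt

lemma SmoothNear.eventually {f : E → G} {z : E} (hf : SmoothNear f z) :
    ∀ᶠ w in 𝓝 z, SmoothNear f w := eventually_eventually_nhds.2 hf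

lemma differentiableAt_of_contDiffAt {f : E → G} {z : E} (hf : ContDiffAt ℝ ∞ f z) :
    DifferentiableAt ℝ f z := hf.differentiableAt (by simp)

lemma SmoothNear.differentiableAt {f : E → G} {z : E} (hf : SmoothNear f z) :
    DifferentiableAt ℝ f z := differentiableAt_of_contDiffAt hf.contDiffAt

lemma smoothNear_of_contDiff {f : E → G} (hf : ContDiff ℝ ∞ f) (z : E) : SmoothNear f z :=
  Eventually.of_forall fun _ => hf.contDiffAt

lemma SmoothNear.congr {f g : E → G} {z : E} (hf : SmoothNear f z) (h : g =ᶠ[𝓝 z] f) :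
    SmoothNear g z := by
  filter_upwards [hf, h.eventuallyEq_nhds] with w hw hw'
  exact hw.congr_of_eventuallyEq hw'

lemma SmoothNear.comp {f : E → G} {g : G → H} {z : E} (hg : SmoothNear g (f z))
    (hf : SmoothNear f z) : SmoothNear (fun w => g (f w)) z := by
  filter_upwards [hf, hf.continuousAt.eventually hg] with w hw hw'
  exact hw'.comp w hw

lemma SmoothNear.comp_of_eq {f : E → G} {g : G → H} {z : E} {y : G} (hg : SmoothNear g y)
    (hf : SmoothNear f z) (h : f z = y) : SmoothNear (fun w => g (f w)) z := by
  subst h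
  exact hg.comp hf

lemma SmoothNear.fderiv_right {f : E → G} {z : E} (hf : SmoothNear f z) :
    SmoothNear (fderiv ℝ f) z := by
  filter_upwards [hf] with w hw
  exact hw.fderiv_right (by simp)

lemma SmoothNear.prodMk {f : E → G} {g : E → H} {z : E} (hf : SmoothNear f z)
    (hg : SmoothNear g z) : SmoothNear (fun w => (f w, g w)) z := by
  filter_upwards [hf, hg] with w hw hw'
  exact hw.prodMk hw'

lemma SmoothNear.clm_apply {f : E → G →L[ℝ] H} {g : E → G} {z : E} (hf : SmoothNear f z)
    (hg : SmoothNear g z) : SmoothNear (fun w => f w (g w)) z := by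
  filter_upwards [hf, hg] with w hw hw'
  exact hw.clm_apply hw'

lemma SmoothNear.add {f g : E → G} {z : E} (hf : SmoothNear f z)
    (hg : SmoothNear g z) : SmoothNear (fun w => f w + g w) z := by
  filter_upwards [hf, hg] with w hw hw'
  exact hw.add hw'

lemma SmoothNear.sub {f g : E → G} {z : E} (hf : SmoothNear f z)
    (hg : SmoothNear g z) : SmoothNear (fun w => f w - g w) z := by
  filter_upwards [hf, hg] with w hw hw'
  exact hw.sub hw'

lemma SmoothNear.neg {f : E → G} {z : E} (hf : SmoothNear f z) :
    SmoothNear (fun w => - f w) z := by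
  filter_upwards [hf] with w hw
  exact hw.neg

lemma SmoothNear.smul {f : E → ℝ} {g : E → G} {z : E} (hf : SmoothNear f z)
    (hg : SmoothNear g z) : SmoothNear (fun w => f w • g w) z := by
  filter_upwards [hf, hg] with w hw hw'
  exact hw.smul hw'

lemma SmoothNear.mul {f : E → ℝ} {g : E → ℝ} {z : E} (hf : SmoothNear f z)
    (hg : SmoothNear g z) : SmoothNear (fun w => f w * g w) z := hf.smul hg

lemma SmoothNear.inv {f : E → ℝ} {z : E} (hf : SmoothNear f z)
    (h0 : f z ≠ 0) : SmoothNear (fun w => (f w)⁻¹) z := by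
  filter_upwards [hf, hf.continuousAt.eventually_ne h0] with w hw hw'
  exact hw.inv hw'

lemma SmoothNear.div {f g : E → ℝ} {z : E} (hf : SmoothNear f z) (hg : SmoothNear g z)
    (h0 : g z ≠ 0) : SmoothNear (fun w => f w / g w) z := by
  simpa only [div_eq_mul_inv] using hf.mul (hg.inv h0)

lemma smoothNear_const (c : G) (z : E) : SmoothNear (fun _ => c) z :=
  smoothNear_of_contDiff contDiff_const z

lemma smoothNear_clm (L : E →L[ℝ] G) (z : E) : SmoothNear (fun w => L w) z :=
  smoothNear_of_contDiff L.contDiff z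

lemma SmoothNear.clm_comp {F' : Type*} [NormedAddCommGroup F'] [NormedSpace ℝ F']
    {f : E → G →L[ℝ] H} {g : E → F' →L[ℝ] G} {z : E} (hf : SmoothNear f z)
    (hg : SmoothNear g z) : SmoothNear (fun w => (f w).comp (g w)) z := by
  filter_upwards [hf, hg] with w hw hw'
  exact hw.clm_comp hw'

/-- Globalization of a germ of smooth maps by a cut-off function. -/
lemma SmoothNear.exists_global [FiniteDimensional ℝ E] {f : E → G} {z : E} (hf : SmoothNear f z) :
    ∃ g : E → G, ContDiff ℝ ∞ g ∧ HasCompactSupport g ∧ g =ᶠ[𝓝 z] f := by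
  obtain ⟨ρ, hρ, hb⟩ := Metric.eventually_nhds_iff_ball.1 hf
  let b : ContDiffBump z := ⟨ρ / 4, ρ / 2, by positivity, by linarith⟩
  refine ⟨fun w => b w • f w, ?_, ?_, ?_⟩
  · refine contDiff_iff_contDiffAt.2 fun w => ?_
    by_cases hw : w ∈ Metric.ball z ρ
    · exact b.contDiff.contDiffAt.smul (hb w hw)
    · have : w ∉ tsupport b := by
        rw [b.tsupport_eq]
        intro h
        exact hw (Metric.closedBall_subset_ball (by change ρ / 2 < ρ; linarith) h)
      have h0 := notMem_tsupport_iff_eventuallyEq.1 this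
      refine (contDiffAt_const (c := (0 : G))).congr_of_eventuallyEq ?_
      filter_upwards [h0] with y hy
      rw [hy]
      simp
  · exact b.hasCompactSupport.smul_right
  · filter_upwards [b.eventuallyEq_one] with y hy
    rw [hy]
    simp

/-- A smooth vector field has a smooth local flow. -/
lemma SmoothNear.exists_flow [FiniteDimensional ℝ E] {X : E → E} {z : E} (hX : SmoothNear X z) :
    ∃ Φ : ℝ × E → E, SmoothNear Φ (0, z) ∧ Φ (0, z) = z ∧
      (∀ᶠ w in 𝓝 ((0 : ℝ), z), HasDerivAt (fun t => Φ (t, w.2)) (X (Φ w)) w.1) ∧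
      ∀ᶠ x in 𝓝 z, Φ (0, x) = x := by
  have := FiniteDimensional.complete ℝ E
  -- A compactly supported smooth field is globally Lipschitz; for small times and points near z its
  -- flow stays where it equals `X`.
  obtain ⟨f, hf, hfc, hfX⟩ := hX.exists_global
  obtain ⟨K, hK⟩ := hf.lipschitzWith_of_hasCompactSupport hfc (by simp)
  obtain ⟨Φ, h1, h2⟩ := exists_smooth_flow_of_lipschitz hf hK z
  have hz : Φ (0, z) = z := h2.self_of_nhds
  refine ⟨Φ, h1.mono fun _ h => h.1, hz, ?_, h2⟩
  have hc : ContinuousAt Φ (0, z) := h1.self_of_nhds.1.continuousAt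
  have hfX' : ∀ᶠ w in 𝓝 ((0 : ℝ), z), f (Φ w) = X (Φ w) := by
    refine hc.eventually (p := fun y => f y = X y) ?_
    rw [hz]
    exact hfX
  filter_upwards [h1, hfX'] with w hw hw'
  rw [← hw']
  exact hw.2

/-- **Hadamard's lemma**: a smooth function that vanishes on a hyperplane is divisible by the
linear form defining it. -/
lemma SmoothNear.exists_eq_smul {E G : Type u} [NormedAddCommGroup E] [NormedSpace ℝ E]
    [NormedAddCommGroup G] [NormedSpace ℝ G] [FiniteDimensional ℝ E] [CompleteSpace G] {f : E → G} {z : E}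
    (hf : SmoothNear f z) (ℓ : E →L[ℝ] ℝ) (hℓ : ℓ ≠ 0) (hz : ℓ z = 0)
    (h0 : ∀ᶠ w in 𝓝 z, ℓ w = 0 → f w = 0) :
    ∃ h : E → G, SmoothNear h z ∧ ∀ᶠ w in 𝓝 z, f w = ℓ w • h w := by
  obtain ⟨g, hg, -, hgf⟩ := hf.exists_global
  obtain ⟨e, he⟩ : ∃ e, ℓ e = 1 := by
    obtain ⟨v, hv⟩ : ∃ v, ℓ v ≠ 0 := by
      by_contra! h
      exact hℓ (ContinuousLinearMap.ext h)
    exact ⟨(ℓ v)⁻¹ • v, by simp [hv]⟩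
  -- For r from 0 to 1 the path runs in direction e from the projection of w to the hyperplane up to
  -- w, and h(w) is the integral of ∂ₑg along it. As the path depends linearly on w, smoothness of h
  -- follows from that of superposition and integration, without differentiating under the integral
  -- sign.
  let path : E →ₗ[ℝ] C(SymInterval, E) :=
    { toFun := fun w => ⟨fun r => w - ((1 - (r : ℝ)) * ℓ w) • e, by fun_prop⟩
      map_add' := by intro a b; ext r; simp; module
      map_smul' := by intro c a; ext r; simp; module }
  have hpath : ContDiff ℝ ∞ path := (LinearMap.toContinuousLinearMap path).contDiff
  have hge : ContDiff ℝ ∞ fun w => fderiv ℝ g w e :=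
    (hg.fderiv_right (m := ∞) (by simp)).clm_apply contDiff_const
  let h : E → G := fun w => primitiveCLM G (superpose SymInterval _ hge.continuous (path w))
    ⟨1, by norm_num⟩
  refine ⟨h, smoothNear_of_contDiff ?_ z, ?_⟩
  · exact (ContinuousMap.evalCLM ℝ (M := G) (⟨1, by norm_num⟩ : SymInterval)).contDiff.comp
      ((primitiveCLM G).contDiff.comp ((contDiff_superpose _ _ hge).comp hpath))
  · have hproj : Tendsto (fun w => w - ℓ w • e) (𝓝 z) (𝓝 z) := by
      have : ContinuousAt (fun w => w - ℓ w • e) z := by fun_prop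
      simpa [ContinuousAt, hz] using this
    filter_upwards [hgf, hproj.eventually hgf, hproj.eventually h0] with w h1 h2 h3
    have h4 : g (w - ℓ w • e) = 0 := by
      rw [h2]
      exact h3 (by simp [he])
    have hval : h w = ∫ r in (0 : ℝ)..1, fderiv ℝ g (w - ((1 - r) * ℓ w) • e) e := by
      change ∫ r in (0 : ℝ)..(1 : ℝ), extendSym _ r = _
      refine intervalIntegral.integral_congr fun r hr => ?_
      rw [uIcc_of_le zero_le_one] at hr
      exact extendSym_coe (superpose SymInterval _ hge.continuous (path w))
        ⟨r, by linarith [hr.1], hr.2⟩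
    have hderiv : ∀ r : ℝ, HasDerivAt (fun r => g (w - ((1 - r) * ℓ w) • e))
        (ℓ w • fderiv ℝ g (w - ((1 - r) * ℓ w) • e) e) r := by
      intro r
      have hd : HasDerivAt (fun r : ℝ => w - ((1 - r) * ℓ w) • e) (ℓ w • e) r := by
        have h5 := ((((hasDerivAt_id r).const_sub 1).mul_const (ℓ w)).smul_const e).const_sub w
        simpa using h5
      have h6 := (hg.differentiable (by simp) (w - ((1 - r) * ℓ w) • e)).hasFDerivAt.comp_hasDerivAt
        r hd
      simpa [Function.comp_def] using h6
    have hcont : Continuous fun r : ℝ => ℓ w • fderiv ℝ g (w - ((1 - r) * ℓ w) • e) e :=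
      continuous_const.smul (hge.continuous.comp (by fun_prop))
    have hint := intervalIntegral.integral_eq_sub_of_hasDerivAt (a := 0) (b := 1)
      (fun r _ => hderiv r) (hcont.intervalIntegrable _ _)
    rw [intervalIntegral.integral_smul, ← hval] at hint
    rw [hint]
    simp [h4, h1]

/-- A family of functions with vanishing derivative in the first variable is constant in it. -/
lemma eventually_eq_of_hasDerivAt_zero {Y ι : Type*} [TopologicalSpace Y] {h : ι → ℝ × Y → G} {y : Y}
    (hd : ∀ᶠ w in 𝓝 ((0 : ℝ), y), ∀ i, HasDerivAt (fun t => h i (t, w.2)) 0 w.1) :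
    ∀ᶠ w in 𝓝 ((0 : ℝ), y), ∀ i, h i w = h i (0, w.2) := by
  obtain ⟨A, hA, B, hB, hAB⟩ := mem_nhds_prod_iff.1 hd
  obtain ⟨ρ, hρ, hρA⟩ := Metric.mem_nhds_iff.1 hA
  filter_upwards [prod_mem_nhds (Metric.ball_mem_nhds (0 : ℝ) hρ) hB]
  rintro ⟨t, x⟩ ⟨ht, hx⟩ i
  have hder : ∀ s ∈ Metric.ball (0 : ℝ) ρ, HasDerivAt (fun t => h i (t, x)) 0 s :=
    fun s hs => hAB (show ((s, x) : ℝ × Y) ∈ A ×ˢ B from ⟨hρA hs, hx⟩) i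
  exact Metric.isOpen_ball.is_const_of_deriv_eq_zero (convex_ball _ _).isPreconnected
    (fun s hs => (hder s hs).differentiableAt.differentiableWithinAt)
    (fun s hs => (hder s hs).deriv) ht (Metric.mem_ball_self hρ)

/-- Uniqueness for the linear transport equation with data on a transverse hyperplane. -/
lemma transport_unique [FiniteDimensional ℝ E] {X : E → E} {w : E → ℝ} {z : E}
    (hX : SmoothNear X z) (ℓ : E →L[ℝ] ℝ) (hℓ : ℓ (X z) ≠ 0) (hz : ℓ z = 0)
    (hw : ∀ᶠ x in 𝓝 z, DifferentiableAt ℝ w x) (hXw : ∀ᶠ x in 𝓝 z, fderiv ℝ w x (X x) = 0)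
    (h0 : ∀ᶠ x in 𝓝 z, ℓ x = 0 → w x = 0) : ∀ᶠ x in 𝓝 z, w x = 0 := by
  have := FiniteDimensional.complete ℝ E
  obtain ⟨Φ, hΦ, hΦz, hΦd, hΦ0⟩ := hX.exists_flow
  have hc := hΦ.continuousAt
  have hconst := eventually_eq_of_hasDerivAt_zero (ι := Unit) (h := fun _ v => w (Φ v)) (y := z)
    (by
      have hw' : ∀ᶠ v in 𝓝 ((0 : ℝ), z), DifferentiableAt ℝ w (Φ v) ∧
          fderiv ℝ w (Φ v) (X (Φ v)) = 0 := by
        refine hc.eventually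
          (p := fun y => DifferentiableAt ℝ w y ∧ fderiv ℝ w y (X y) = 0) ?_
        rw [hΦz]
        exact hw.and hXw
      filter_upwards [hΦd, hw'] with v h1 h2 _
      rw [← h2.2]
      exact h2.1.hasFDerivAt.comp_hasDerivAt v.1 h1)
  -- The time t = ℓ(x)/ℓ(X z) and the starting point x - t X(z), which lies on the hyperplane. Then
  -- Φ ∘ `pr` has strict derivative the identity at z, so every point near z lies on a flow line
  -- issuing from the hyperplane.
  let pr : E →L[ℝ] ℝ × E := ((ℓ (X z))⁻¹ • ℓ).prod
    (ContinuousLinearMap.id ℝ E - ((ℓ (X z))⁻¹ • ℓ).smulRight (X z))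
  have hprz : pr z = (0, z) := by simp [pr, hz]
  have hprt : Tendsto pr (𝓝 z) (𝓝 (0, z)) := by
    have := pr.continuous.continuousAt (x := z)
    rwa [ContinuousAt, hprz] at this
  have hstrict : HasStrictFDerivAt (fun x => Φ (pr x)) (ContinuousLinearMap.id ℝ E) z := by
    have hS : HasStrictFDerivAt Φ (fderiv ℝ Φ (0, z)) (pr z) := by
      rw [hprz]
      exact hΦ.contDiffAt.hasStrictFDerivAt (by simp)
    have h1 := hS.comp z pr.hasStrictFDerivAt
    convert h1 using 1
    have hFD : HasFDerivAt Φ (fderiv ℝ Φ (0, z)) (0, z) := hΦ.differentiableAt.hasFDerivAt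
    have ht : fderiv ℝ Φ (0, z) (1, 0) = X z := by
      have h2 : HasDerivAt (fun t : ℝ => ((t, z) : ℝ × E)) (1, 0) 0 :=
        (hasDerivAt_id (0 : ℝ)).prodMk (hasDerivAt_const _ _)
      have h3 := hFD.comp_hasDerivAt (0 : ℝ) h2
      have h4 := hΦd.self_of_nhds
      simp only [hΦz] at h4
      exact h3.unique h4
    have hx : ∀ v, fderiv ℝ Φ (0, z) (0, v) = v := by
      intro v
      have h2 : HasFDerivAt (fun x : E => (((0 : ℝ), x) : ℝ × E)) (.inr ℝ ℝ E) z :=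
        hasFDerivAt_prodMk_right _ _
      have h3 := hFD.comp z h2
      have h4 : HasFDerivAt (Φ ∘ fun x : E => (((0 : ℝ), x) : ℝ × E))
          (ContinuousLinearMap.id ℝ E) z :=
        (hasFDerivAt_id z).congr_of_eventuallyEq hΦ0
      have h5 := h3.unique h4
      simpa using congrArg (fun L : E →L[ℝ] E => L v) h5
    ext v
    have hsplit : pr v = ((ℓ (X z))⁻¹ * ℓ v) • ((1 : ℝ), (0 : E)) +
        ((0 : ℝ), v - ((ℓ (X z))⁻¹ * ℓ v) • X z) := by
      simp [pr]
    rw [ContinuousLinearMap.comp_apply, hsplit, map_add, map_smul, ht, hx]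
    simp
  have hmap : map (fun x => Φ (pr x)) (𝓝 z) = 𝓝 z := by
    have := hstrict.map_nhds_eq_of_equiv (f' := ContinuousLinearEquiv.refl ℝ E)
    simpa [hprz, hΦz] using this
  rw [← hmap, eventually_map]
  have hprt2 : Tendsto (fun x => (pr x).2) (𝓝 z) (𝓝 z) :=
    (continuous_snd.tendsto (((0 : ℝ), z) : ℝ × E)).comp hprt
  filter_upwards [hprt.eventually hconst, hprt2.eventually hΦ0, hprt2.eventually h0]
    with x h1 h2 h3
  rw [h1 (), h2]
  refine h3 ?_
  simp [pr]
  field_simp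
  ring

end SmoothNear

end ConformalGauge

namespace ConformalGauge

/-! ### Hamilton-Jacobi equations by characteristics -/

section HamiltonJacobi

variable {Q : Type*} [NormedAddCommGroup Q] [NormedSpace ℝ Q]

/-- The velocity of the characteristics of a Hamiltonian. -/
lemma exists_velocity [FiniteDimensional ℝ Q] {K : ℝ × Q × (Q →L[ℝ] ℝ) → ℝ}
    {a₀ : ℝ × Q × (Q →L[ℝ] ℝ)} (hK : SmoothNear K a₀) :
    ∃ A : ℝ × Q × (Q →L[ℝ] ℝ) → Q, SmoothNear A a₀ ∧
      ∀ a q, q (A a) = fderiv ℝ K a (0, 0, q) := by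
  let b := Module.finBasis ℝ Q
  let c : Fin (Module.finrank ℝ Q) → (Q →L[ℝ] ℝ) := fun i =>
    LinearMap.toContinuousLinearMap (b.coord i)
  -- The derivative of K in the covector variable is a linear form on the dual of Q, hence
  -- evaluation at a vector by finite dimensionality; a basis makes its smooth dependence visible.
  refine ⟨fun a => ∑ i, fderiv ℝ K a (0, 0, c i) • b i, ?_, fun a q => ?_⟩
  · filter_upwards [hK.fderiv_right] with w hw
    exact ContDiffAt.sum fun i _ => (hw.clm_apply contDiffAt_const).smul contDiffAt_const
  have hq : q = ∑ i, q (b i) • c i := by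
    ext v
    have h1 := congrArg q (b.sum_repr v)
    rw [map_sum] at h1
    rw [← h1]
    simp [c, mul_comm]
  have h2 : ((0, 0, q) : ℝ × Q × (Q →L[ℝ] ℝ)) =
      ∑ i, q (b i) • ((0, 0, c i) : ℝ × Q × (Q →L[ℝ] ℝ)) := by
    conv_lhs => rw [hq]
    refine Prod.ext ?_ (Prod.ext ?_ ?_) <;> simp [Prod.fst_sum, Prod.snd_sum]
  rw [h2, map_sum, map_sum]
  refine Finset.sum_congr rfl fun i _ => ?_
  rw [map_smul, map_smul, smul_eq_mul, smul_eq_mul, mul_comm]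

/-- The time derivative of a spatial derivative is the spatial derivative of the time
derivative. -/
lemma hasDerivAt_fderiv_swap {G : Type*} [NormedAddCommGroup G] [NormedSpace ℝ G]
    {f g : ℝ × Q → G} {z : ℝ × Q} (hf : SmoothNear f z)
    (hg : ∀ᶠ w in 𝓝 z, HasDerivAt (fun t => f (t, w.2)) (g w) w.1) (v : Q) :
    HasDerivAt (fun t => fderiv ℝ f (t, z.2) (0, v)) (fderiv ℝ g z (0, v)) z.1 := by
  have hline : ∀ w : ℝ × Q, HasDerivAt (fun t : ℝ => ((t, w.2) : ℝ × Q)) (1, 0) w.1 := fun w =>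
    (hasDerivAt_id w.1).prodMk (hasDerivAt_const _ _)
  have hg' : g =ᶠ[𝓝 z] fun w => fderiv ℝ f w (1, 0) := by
    filter_upwards [hg, hf] with w h1 h2
    exact h1.unique ((differentiableAt_of_contDiffAt h2).hasFDerivAt.comp_hasDerivAt w.1 (hline w))
  have hf' : DifferentiableAt ℝ (fderiv ℝ f) z := hf.fderiv_right.differentiableAt
  have h3 : fderiv ℝ g z (0, v) = fderiv ℝ (fderiv ℝ f) z (0, v) (1, 0) := by
    rw [hg'.fderiv_eq, fderiv_clm_apply hf' (differentiableAt_const _)]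
    simp
  have hsymm : IsSymmSndFDerivAt ℝ f z := hf.contDiffAt.isSymmSndFDerivAt
    (by simpa using (WithTop.coe_le_coe.2 le_top : ((2 : ℕ∞) : WithTop ℕ∞) ≤ ∞))
  rw [h3, hsymm.eq]
  have h4 := hf'.hasFDerivAt.comp_hasDerivAt z.1 (hline z)
  have h5 := h4.clm_apply (hasDerivAt_const z.1 ((0, v) : ℝ × Q))
  simpa [Function.comp_def] using h5

/-- Local existence for a Hamilton-Jacobi equation `∂ₜ v = K (t, s, ∂ₛ v)`. -/
lemma exists_hamiltonJacobi [FiniteDimensional ℝ Q] {K : ℝ × Q × (Q →L[ℝ] ℝ) → ℝ} {v₀ : Q → ℝ}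
    {s₀ : Q} (hv₀ : SmoothNear v₀ s₀) (hK : SmoothNear K (0, s₀, fderiv ℝ v₀ s₀)) :
    ∃ v : ℝ × Q → ℝ, SmoothNear v (0, s₀) ∧ (∀ᶠ s in 𝓝 s₀, v (0, s) = v₀ s) ∧
      ∀ᶠ z in 𝓝 ((0 : ℝ), s₀),
        fderiv ℝ v z (1, 0) = K (z.1, z.2, (fderiv ℝ v z).comp (.inr ℝ ℝ Q)) := by
  have := FiniteDimensional.complete ℝ Q
  set q₀ := fderiv ℝ v₀ s₀ with hq₀
  let D := Q →L[ℝ] ℝ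
  let Ks : ℝ × Q × D → D := fun a =>
    (fderiv ℝ K a).comp ((ContinuousLinearMap.inr ℝ ℝ (Q × D)).comp (.inl ℝ Q D))
  have hKs : SmoothNear Ks (0, s₀, q₀) := hK.fderiv_right.clm_comp (smoothNear_const _ _)
  obtain ⟨A, hA, hR⟩ := exists_velocity hK
  let base : (ℝ × Q × D) × ℝ := ((0, s₀, q₀), v₀ s₀)
  -- The characteristic system in (t, s, p, v): t' = 1, s' = -∂K/∂p, p' = ∂K/∂s, v' = K - p(∂K/∂p).
  let X : (ℝ × Q × D) × ℝ → (ℝ × Q × D) × ℝ := fun e =>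
    ((1, -A e.1, Ks e.1), K e.1 - e.1.2.2 (A e.1))
  have hfst : SmoothNear (fun e : (ℝ × Q × D) × ℝ => e.1) base :=
    smoothNear_of_contDiff contDiff_fst _
  have hpp : SmoothNear (fun e : (ℝ × Q × D) × ℝ => e.1.2.2) base :=
    smoothNear_of_contDiff (contDiff_snd.comp (contDiff_snd.comp contDiff_fst)) _
  have hAe : SmoothNear (fun e : (ℝ × Q × D) × ℝ => A e.1) base := hA.comp_of_eq hfst rfl
  have hX : SmoothNear X base :=
    ((smoothNear_const _ _).prodMk (hAe.neg.prodMk (hKs.comp_of_eq hfst rfl))).prodMk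
      ((hK.comp_of_eq hfst rfl).sub (hpp.clm_apply hAe))
  obtain ⟨Φ, hΦ, hΦz, hΦd, hΦ0⟩ := hX.exists_flow
  let ini : Q → (ℝ × Q × D) × ℝ := fun y => ((0, y, fderiv ℝ v₀ y), v₀ y)
  have hini : SmoothNear ini s₀ :=
    ((smoothNear_const _ _).prodMk ((smoothNear_of_contDiff contDiff_id _).prodMk
      hv₀.fderiv_right)).prodMk hv₀
  let Z : ℝ × Q → (ℝ × Q × D) × ℝ := fun w => Φ (w.1, ini w.2)
  have hlift : SmoothNear (fun w : ℝ × Q => (w.1, ini w.2)) (0, s₀) :=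
    (smoothNear_of_contDiff contDiff_fst _).prodMk
      (hini.comp_of_eq (smoothNear_of_contDiff contDiff_snd _) rfl)
  have hZ : SmoothNear Z (0, s₀) := hΦ.comp_of_eq hlift rfl
  have hZd : ∀ᶠ w in 𝓝 ((0 : ℝ), s₀), HasDerivAt (fun t => Z (t, w.2)) (X (Z w)) w.1 :=
    hlift.continuousAt.eventually hΦd
  have hZ0 : ∀ᶠ y in 𝓝 s₀, Z (0, y) = ini y := hini.continuousAt.eventually hΦ0
  -- components of the characteristics
  let S : ℝ × Q → Q := fun w => (Z w).1.2.1
  let P : ℝ × Q → D := fun w => (Z w).1.2.2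
  let V : ℝ × Q → ℝ := fun w => (Z w).2
  have hS : SmoothNear S (0, s₀) :=
    (smoothNear_of_contDiff (contDiff_fst.comp (contDiff_snd.comp contDiff_fst)) _).comp hZ
  have hP : SmoothNear P (0, s₀) :=
    (smoothNear_of_contDiff (contDiff_snd.comp (contDiff_snd.comp contDiff_fst)) _).comp hZ
  have hV : SmoothNear V (0, s₀) := (smoothNear_of_contDiff contDiff_snd _).comp hZ
  have hT : ∀ᶠ w in 𝓝 ((0 : ℝ), s₀), (Z w).1.1 = w.1 := by
    have h1 := eventually_eq_of_hasDerivAt_zero (ι := Unit) (h := fun _ w => (Z w).1.1 - w.1)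
      (y := s₀) (by
        filter_upwards [hZd] with w hw _
        have h3 : HasDerivAt (fun t => (Z (t, w.2)).1.1) 1 w.1 := hw.fst.fst
        have h2 : HasDerivAt (fun t => (Z (t, w.2)).1.1 - t) (1 - 1) w.1 :=
          h3.sub (hasDerivAt_id w.1)
        exact h2.congr_deriv (by simp))
    have h0 : ∀ᶠ w : ℝ × Q in 𝓝 ((0 : ℝ), s₀), Z (0, w.2) = ini w.2 :=
      (continuous_snd.tendsto ((0 : ℝ), s₀)).eventually hZ0
    filter_upwards [h1, h0] with w h3 h4
    have h5 := h3 ()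
    simp only [h4, ini] at h5
    linarith
  let a : ℝ × Q → ℝ × Q × D := fun w => (w.1, S w, P w)
  have ha : SmoothNear a (0, s₀) := (smoothNear_of_contDiff contDiff_fst _).prodMk (hS.prodMk hP)
  have haZ : ∀ᶠ w in 𝓝 ((0 : ℝ), s₀), (Z w).1 = a w := by
    filter_upwards [hT] with w hw
    exact Prod.ext hw rfl
  have hZ00 : Z (0, s₀) = base := hΦz
  have ha0 : a (0, s₀) = (0, s₀, q₀) := by
    simp only [a, S, P, hZ00, base]
  have hAa : SmoothNear (fun w => A (a w)) (0, s₀) := hA.comp_of_eq ha ha0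
  have hKa : SmoothNear (fun w => K (a w)) (0, s₀) := hK.comp_of_eq ha ha0
  have hSd : ∀ᶠ w in 𝓝 ((0 : ℝ), s₀), HasDerivAt (fun t => S (t, w.2)) (-A (a w)) w.1 := by
    filter_upwards [hZd, haZ] with w h1 h2
    rw [← h2]
    exact h1.fst.snd.fst
  have hPd : ∀ᶠ w in 𝓝 ((0 : ℝ), s₀), HasDerivAt (fun t => P (t, w.2)) (Ks (a w)) w.1 := by
    filter_upwards [hZd, haZ] with w h1 h2
    rw [← h2]
    exact h1.fst.snd.snd
  have hVd : ∀ᶠ w in 𝓝 ((0 : ℝ), s₀),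
      HasDerivAt (fun t => V (t, w.2)) (K (a w) - P w (A (a w))) w.1 := by
    filter_upwards [hZd, haZ] with w h1 h2
    rw [← h2]
    exact h1.snd
  have hini' : ∀ᶠ y in 𝓝 s₀, S (0, y) = y ∧ P (0, y) = fderiv ℝ v₀ y ∧ V (0, y) = v₀ y := by
    filter_upwards [hZ0] with y hy
    simp [S, P, V, hy, ini]
  -- the contact form vanishes along the characteristics
  have hcontact : ∀ᶠ w in 𝓝 ((0 : ℝ), s₀), ∀ e : Q,
      fderiv ℝ V w (0, e) = P w (fderiv ℝ S w (0, e)) := by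
    have hdK : ∀ᶠ w in 𝓝 ((0 : ℝ), s₀), DifferentiableAt ℝ K (a w) := by
      refine ha.continuousAt.eventually (p := fun b => DifferentiableAt ℝ K b) ?_
      rw [ha0]
      exact hK.mono fun _ h => differentiableAt_of_contDiffAt h
    have h1 := eventually_eq_of_hasDerivAt_zero (ι := Q)
      (h := fun e w => fderiv ℝ V w (0, e) - P w (fderiv ℝ S w (0, e))) (y := s₀) (by
        filter_upwards [hV.eventually, hS.eventually, hP.eventually, hVd.eventually_nhds,
          hSd.eventually_nhds, hPd, hAa.eventually, ha.eventually, hdK]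
          with w hVw hSw hPw hVdw hSdw hPdw hAw haw hKw e
        -- Writing a subscript e for the derivative in direction e of the initial point, the time
        -- derivative of V_e - P(S_e) is dK(a_e) - P_e(A) - Ks(S_e). The terms P(A_e) cancel, and
        -- what is left is ∂K/∂p(P_e) - P_e(A) = 0.
        have d1 := hasDerivAt_fderiv_swap hVw hVdw e
        have d2 := hasDerivAt_fderiv_swap hSw hSdw e
        have d3 := d1.sub (hPdw.clm_apply d2)
        refine d3.congr_deriv ?_
        have hPw' := hPw.differentiableAt
        have hAw' := hAw.differentiableAt
        have haw' := haw.differentiableAt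
        have e1 : fderiv ℝ (fun w => K (a w) - P w (A (a w))) w (0, e) =
            fderiv ℝ K (a w) (fderiv ℝ a w (0, e)) - (fderiv ℝ P w (0, e) (A (a w)) +
              P w (fderiv ℝ (fun w => A (a w)) w (0, e))) := by
          have h2 := (hKw.hasFDerivAt.comp w haw'.hasFDerivAt).sub
            (hPw'.hasFDerivAt.clm_apply hAw'.hasFDerivAt)
          have h3 := h2.fderiv
          simp only [Function.comp_def] at h3
          erw [h3]
          simp
          ring
        have e2 : fderiv ℝ (fun w => -A (a w)) w (0, e) =
            - fderiv ℝ (fun w => A (a w)) w (0, e) := by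
          rw [fderiv_fun_neg]; rfl
        have e3 : fderiv ℝ a w (0, e) = (0, fderiv ℝ S w (0, e), fderiv ℝ P w (0, e)) := by
          have h2 := (hasFDerivAt_fst (𝕜 := ℝ) (p := w)).prodMk
            (hSw.differentiableAt.hasFDerivAt.prodMk hPw'.hasFDerivAt)
          have h3 := h2.fderiv
          change fderiv ℝ a w = _ at h3
          rw [h3]
          simp
        have e4 : fderiv ℝ K (a w) (0, fderiv ℝ S w (0, e), fderiv ℝ P w (0, e)) =
            Ks (a w) (fderiv ℝ S w (0, e)) + fderiv ℝ K (a w) (0, 0, fderiv ℝ P w (0, e)) := by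
          have h2 : ((0, fderiv ℝ S w (0, e), fderiv ℝ P w (0, e)) : ℝ × Q × D) =
              (0, fderiv ℝ S w (0, e), 0) + (0, 0, fderiv ℝ P w (0, e)) := by simp
          rw [h2, map_add]
          rfl
        have e5 : fderiv ℝ P w (0, e) (A (a w)) = fderiv ℝ K (a w) (0, 0, fderiv ℝ P w (0, e)) := hR _ _
        rw [e1, e2, e3, e4, e5, map_neg]
        ring)
    have h0 : ∀ᶠ w : ℝ × Q in 𝓝 ((0 : ℝ), s₀), ∀ e : Q,
        fderiv ℝ V (0, w.2) (0, e) = P (0, w.2) (fderiv ℝ S (0, w.2) (0, e)) := by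
      have hin : Tendsto (fun y : Q => ((0 : ℝ), y)) (𝓝 s₀) (𝓝 (0, s₀)) :=
        (Continuous.prodMk_right (0 : ℝ)).continuousAt
      have : ∀ᶠ y : Q in 𝓝 s₀, ∀ e : Q,
          fderiv ℝ V (0, y) (0, e) = P (0, y) (fderiv ℝ S (0, y) (0, e)) := by
        filter_upwards [hini'.eventually_nhds, hin.eventually hV, hin.eventually hS, hv₀]
          with y hy hVy hSy hvy e
        have hl : HasFDerivAt (fun x : Q => (((0 : ℝ), x) : ℝ × Q)) (.inr ℝ ℝ Q) y :=
          hasFDerivAt_prodMk_right _ _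
        have g1 := (differentiableAt_of_contDiffAt hVy).hasFDerivAt.comp y hl
        have g2 := (differentiableAt_of_contDiffAt hSy).hasFDerivAt.comp y hl
        have g3 : HasFDerivAt (V ∘ fun x : Q => (((0 : ℝ), x) : ℝ × Q)) (fderiv ℝ v₀ y) y :=
          (differentiableAt_of_contDiffAt hvy).hasFDerivAt.congr_of_eventuallyEq
            (hy.mono fun x hx => hx.2.2)
        have g4 : HasFDerivAt (S ∘ fun x : Q => (((0 : ℝ), x) : ℝ × Q))
            (ContinuousLinearMap.id ℝ Q) y :=
          (hasFDerivAt_id y).congr_of_eventuallyEq (hy.mono fun x hx => hx.1)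
        have g5 := congrArg (fun L : Q →L[ℝ] ℝ => L e) (g1.unique g3)
        have g6 := congrArg (fun L : Q →L[ℝ] Q => L e) (g2.unique g4)
        simp only [ContinuousLinearMap.comp_apply, ContinuousLinearMap.inr_apply] at g5 g6
        rw [g5, g6, hy.self_of_nhds.2.1]
        rfl
      exact (continuous_snd.tendsto ((0 : ℝ), s₀)).eventually this
    filter_upwards [h1, h0] with w h2 h3 e
    have h4 := h2 e
    rw [h3 e] at h4
    linarith
  -- the inverse of `(t, y) ↦ (t, S (t, y))`
  let H : (ℝ × Q) × Q → Q := fun u => S (u.1.1, u.2) - u.1.2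
  have hpr : SmoothNear (fun u : (ℝ × Q) × Q => (u.1.1, u.2)) ((0, s₀), s₀) :=
    smoothNear_of_contDiff ((contDiff_fst.comp contDiff_fst).prodMk contDiff_snd) _
  have hH : SmoothNear H ((0, s₀), s₀) :=
    (hS.comp_of_eq hpr rfl).sub (smoothNear_of_contDiff (contDiff_snd.comp contDiff_fst) _)
  have hS00 : S (0, s₀) = s₀ := hini'.self_of_nhds.1
  obtain ⟨Y, hY0, hY, hYiff⟩ := exists_smooth_implicit hH (by simp [H, hS00]) (by
    have h1 : HasFDerivAt (fun y : Q => (((0 : ℝ), s₀), y)) (.inr ℝ (ℝ × Q) Q) s₀ :=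
      hasFDerivAt_prodMk_right _ _
    have h2 := hH.differentiableAt.hasFDerivAt.comp s₀ h1
    have h3 : HasFDerivAt (H ∘ fun y : Q => (((0 : ℝ), s₀), y)) (ContinuousLinearMap.id ℝ Q) s₀ := by
      refine ((hasFDerivAt_id s₀).sub_const s₀).congr_of_eventuallyEq ?_
      filter_upwards [hini'] with y hy
      simp [H, hy.1]
    rw [h2.unique h3]
    exact ⟨ContinuousLinearEquiv.refl ℝ _, rfl⟩)
  simp only at hY0 hY
  have hYs : SmoothNear Y (0, s₀) := hY.mono fun _ h => h.1
  let β : ℝ × Q → ℝ × Q := fun z => (z.1, Y z)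
  have hβ : SmoothNear β (0, s₀) := (smoothNear_of_contDiff contDiff_fst _).prodMk hYs
  have hβ0 : β (0, s₀) = (0, s₀) := by simp [β, hY0]
  have hβt : Tendsto β (𝓝 (0, s₀)) (𝓝 (0, s₀)) := by
    have := hβ.continuousAt
    rwa [ContinuousAt, hβ0] at this
  refine ⟨fun z => V (β z), hV.comp_of_eq hβ hβ0, ?_, ?_⟩
  · have hin : Tendsto (fun y : Q => ((((0 : ℝ), y), y) : (ℝ × Q) × Q)) (𝓝 s₀)
        (𝓝 ((0, s₀), s₀)) := by
      have : Continuous fun y : Q => ((((0 : ℝ), y), y) : (ℝ × Q) × Q) := by fun_prop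
      exact this.continuousAt
    filter_upwards [hin.eventually hYiff, hini'] with y h1 h2
    have h3 : Y (0, y) = y := h1.1 (by simp [H, h2.1])
    simp only [β, h3, h2.2.2]
  · filter_upwards [hY.eventually_nhds, hβt.eventually hcontact, hβt.eventually hV.eventually,
      hβt.eventually hS.eventually, hβ, hβt.eventually hVd, hβt.eventually hSd, hYs]
      with z hYz hc hVz hSz hβz hVdz hSdz hYsz
    have hline : HasDerivAt (fun t : ℝ => ((t, (β z).2) : ℝ × Q)) (1, 0) (β z).1 :=
      (hasDerivAt_id (β z).1).prodMk (hasDerivAt_const _ _)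
    have v1 : fderiv ℝ V (β z) (1, 0) = K (a (β z)) - P (β z) (A (a (β z))) :=
      (HasFDerivAt.comp_hasDerivAt (l := V) (β z).1 hVz.differentiableAt.hasFDerivAt hline :
        HasDerivAt (fun t => V (t, (β z).2)) _ _).unique hVdz
    have s1 : fderiv ℝ S (β z) (1, 0) = - A (a (β z)) :=
      (HasFDerivAt.comp_hasDerivAt (l := S) (β z).1 hSz.differentiableAt.hasFDerivAt hline :
        HasDerivAt (fun t => S (t, (β z).2)) _ _).unique hSdz
    have hβd := (differentiableAt_of_contDiffAt hβz).hasFDerivAt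
    have hβe : ∀ σ, fderiv ℝ β z σ = (σ.1, fderiv ℝ Y z σ) := by
      intro σ
      have h2 := (hasFDerivAt_fst (𝕜 := ℝ) (p := z)).prodMk
        (differentiableAt_of_contDiffAt hYsz).hasFDerivAt
      rw [hβd.unique h2]
      rfl
    have hsplit : ∀ σ : ℝ × Q, (σ.1, fderiv ℝ Y z σ) =
        σ.1 • ((1 : ℝ), (0 : Q)) + (0, fderiv ℝ Y z σ) := by
      intro σ; simp
    have hSβ : ∀ σ : ℝ × Q, fderiv ℝ S (β z) (fderiv ℝ β z σ) = σ.2 := by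
      intro σ
      have h1 := hSz.differentiableAt.hasFDerivAt.comp z hβd
      have h2 : HasFDerivAt (S ∘ β) (ContinuousLinearMap.snd ℝ ℝ Q) z := by
        refine hasFDerivAt_snd.congr_of_eventuallyEq ?_
        filter_upwards [hYz] with z' hz'
        exact sub_eq_zero.1 hz'.2
      simpa using congrArg (fun L : ℝ × Q →L[ℝ] Q => L σ) (h1.unique h2)
    have hSz' : S (β z) = z.2 := sub_eq_zero.1 hYz.self_of_nhds.2
    have haβ : a (β z) = (z.1, z.2, P (β z)) := by simp only [a, hSz']; rfl
    -- Since S ∘ β is the second projection, the contact condition converts dV into the differential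
    -- of v: its spatial part is P and its time part is K.
    have hdv : ∀ σ : ℝ × Q, fderiv ℝ (fun z => V (β z)) z σ =
        σ.1 * K (a (β z)) + P (β z) σ.2 := by
      intro σ
      have h1 := hVz.differentiableAt.hasFDerivAt.comp z hβd
      have h2 : fderiv ℝ (fun z => V (β z)) z σ = fderiv ℝ V (β z) (fderiv ℝ β z σ) := by
        have := h1.fderiv
        simp only [Function.comp_def] at this
        rw [this]
        rfl
      have h3 := hSβ σ
      rw [h2]
      rw [hβe, hsplit, map_add, map_smul] at h3 ⊢
      rw [s1] at h3
      rw [v1, hc]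
      rw [← h3, map_add, map_smul, map_neg]
      simp only [smul_eq_mul]
      ring
    have hcomp : (fderiv ℝ (fun z => V (β z)) z).comp (.inr ℝ ℝ Q) = P (β z) := by
      ext e
      simp [hdv]
    rw [hcomp, hdv, ← haβ]
    simp

end HamiltonJacobi

end ConformalGauge

namespace ConformalGauge

set_option linter.unusedSectionVars false

/-! ### Semi-Riemannian metrics and conformal Killing fields on a vector space -/

section FlatModel

lemma SmoothNear.sqrt {E : Type*} [NormedAddCommGroup E] [NormedSpace ℝ E] {f : E → ℝ} {z : E}
    (hf : SmoothNear f z) (h0 : f z ≠ 0) : SmoothNear (fun w => √(f w)) z := by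
  filter_upwards [hf, hf.continuousAt.eventually_ne h0] with w hw hw'
  exact hw.sqrt hw'

lemma SmoothNear.clm_inverse {E G : Type*} [NormedAddCommGroup E] [NormedSpace ℝ E]
    {W : Type*} [NormedAddCommGroup W] [NormedSpace ℝ W] [CompleteSpace W]
    [NormedAddCommGroup G] [NormedSpace ℝ G] [CompleteSpace G]
    {f : E → W →L[ℝ] G} {z : E} (hf : SmoothNear f z) (h0 : (f z).IsInvertible) :
    SmoothNear (fun w => (f w).inverse) z := by
  filter_upwards [hf, eventually_isInvertible hf.continuousAt h0] with w hw hw'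
  obtain ⟨e, he⟩ := hw'
  have := contDiffAt_map_inverse (𝕜 := ℝ) (n := ∞) e
  rw [he] at this
  exact this.comp w hw

/-- A continuous function that vanishes off a hyperplane vanishes. -/
lemma eventually_zero_of_ne {E G : Type*} [NormedAddCommGroup E] [NormedSpace ℝ E]
    [TopologicalSpace G] [T2Space G] [Zero G] {f : E → G} {z : E}
    (hf : ∀ᶠ w in 𝓝 z, ContinuousAt f w) (ℓ : E →L[ℝ] ℝ) (hℓ : ℓ ≠ 0)
    (h0 : ∀ᶠ w in 𝓝 z, ℓ w ≠ 0 → f w = 0) : ∀ᶠ w in 𝓝 z, f w = 0 := by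
  obtain ⟨e, he⟩ : ∃ v, ℓ v ≠ 0 := by
    by_contra! h
    exact hℓ (ContinuousLinearMap.ext h)
  filter_upwards [hf, h0.eventually_nhds, h0] with w h1 h2 h3
  by_cases hw : ℓ w = 0
  · have hpath : Tendsto (fun t : ℝ => w + t • e) (𝓝[≠] 0) (𝓝 w) := by
      have : ContinuousAt (fun t : ℝ => w + t • e) 0 := by fun_prop
      have h4 := this.tendsto.mono_left (nhdsWithin_le_nhds (s := {(0 : ℝ)}ᶜ))
      simpa using h4
    have h5 : Tendsto (fun t : ℝ => f (w + t • e)) (𝓝[≠] 0) (𝓝 (f w)) := h1.tendsto.comp hpath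
    have h6 : (fun t : ℝ => f (w + t • e)) =ᶠ[𝓝[≠] 0] fun _ => 0 := by
      filter_upwards [hpath.eventually h2, self_mem_nhdsWithin] with t ht ht0
      exact ht (by simp [hw, he]; exact ht0)
    exact tendsto_nhds_unique (h5.congr' h6) tendsto_const_nhds |>.symm ▸ rfl
  · exact h3 hw

variable {B : Type} [NormedAddCommGroup B] [NormedSpace ℝ B] [FiniteDimensional ℝ B]

/-- `g` is a smooth semi-Riemannian metric near `z`. -/
structure FlatMetric (g : B → B →L[ℝ] B →L[ℝ] ℝ) (z : B) : Prop where
  smooth : SmoothNear g z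
  symm : ∀ᶠ w in 𝓝 z, ∀ v v', g w v v' = g w v' v
  invertible : (g z).IsInvertible

namespace FlatMetric

variable {g : B → B →L[ℝ] B →L[ℝ] ℝ} {z : B}

lemma smooth_inverse (hg : FlatMetric g z) : SmoothNear (fun w => (g w).inverse) z := by
  have := FiniteDimensional.complete ℝ B
  exact hg.smooth.clm_inverse hg.invertible

lemma eventually_invertible (hg : FlatMetric g z) : ∀ᶠ w in 𝓝 z, (g w).IsInvertible := by
  have := FiniteDimensional.complete ℝ B
  exact eventually_isInvertible hg.smooth.continuousAt hg.invertible

end FlatMetric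

lemma inverse_symm {b : B →L[ℝ] B →L[ℝ] ℝ} (hb : b.IsInvertible) (hs : ∀ v w, b v w = b w v)
    (α β : B →L[ℝ] ℝ) : α (b.inverse β) = β (b.inverse α) := by
  have h1 : ∀ γ, b (b.inverse γ) = γ := fun γ => hb.self_apply_inverse γ
  calc α (b.inverse β) = b (b.inverse α) (b.inverse β) := by rw [h1]
    _ = b (b.inverse β) (b.inverse α) := hs _ _
    _ = _ := by rw [h1]

/-- The derivative of `|∇u|²` along a conformal Killing field. -/
lemma fderiv_gradSq_conformalKilling {g : B → B →L[ℝ] B →L[ℝ] ℝ} {η : B → B} {ψ : ℝ} {u : B → ℝ}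
    {z : B} (hg : FlatMetric g z) (hη : DifferentiableAt ℝ η z) (hu : SmoothNear u z)
    (hlie : ∀ v w, fderiv ℝ g z (η z) v w + g z (fderiv ℝ η z v) w + g z v (fderiv ℝ η z w) =
      2 * ψ * g z v w) :
    fderiv ℝ (fun w => fderiv ℝ u w ((g w).inverse (fderiv ℝ u w))) z (η z) =
      2 * fderiv ℝ (fun w => fderiv ℝ u w (η w)) z ((g z).inverse (fderiv ℝ u z)) -
        2 * ψ * fderiv ℝ u z ((g z).inverse (fderiv ℝ u z)) := by
  set W : B → B := fun w => (g w).inverse (fderiv ℝ u w) with hW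
  have hWs : DifferentiableAt ℝ W z := (hg.smooth_inverse.clm_apply hu.fderiv_right).differentiableAt
  have hdu : DifferentiableAt ℝ (fderiv ℝ u) z := hu.fderiv_right.differentiableAt
  have hgd : DifferentiableAt ℝ g z := hg.smooth.differentiableAt
  have hgW : (fun w => g w (W w)) =ᶠ[𝓝 z] fderiv ℝ u := by
    filter_upwards [hg.eventually_invertible] with w hw
    exact hw.self_apply_inverse _
  have hsymm : IsSymmSndFDerivAt ℝ u z := hu.contDiffAt.isSymmSndFDerivAt
    (by simpa using (WithTop.coe_le_coe.2 le_top : ((2 : ℕ∞) : WithTop ℕ∞) ≤ ∞))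
  have hgWz : ∀ v, g z (W z) v = fderiv ℝ u z v := fun v => by rw [← hgW.self_of_nhds]
  -- With W = ∇u, differentiate g(W, ·) = du along η and evaluate on W. The Killing equation on (W,
  -- W) replaces (∂_η g)(W, W) by terms in du(∂_W η), and the symmetry of the second derivative of u
  -- assembles the rest into d(η u)(W).
  have e1 : fderiv ℝ g z (η z) (W z) (W z) + g z (fderiv ℝ W z (η z)) (W z) =
      fderiv ℝ (fderiv ℝ u) z (η z) (W z) := by
    have h1 : fderiv ℝ (fun w => g w (W w)) z = _ := fderiv_clm_apply hgd hWs
    rw [hgW.fderiv_eq] at h1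
    rw [h1]
    simp
    ring
  have e2 : fderiv ℝ (fun w => fderiv ℝ u w (W w)) z (η z) =
      fderiv ℝ (fderiv ℝ u) z (η z) (W z) + fderiv ℝ u z (fderiv ℝ W z (η z)) := by
    rw [fderiv_clm_apply hdu hWs]
    simp
    ring
  have e3 : fderiv ℝ (fun w => fderiv ℝ u w (η w)) z (W z) =
      fderiv ℝ (fderiv ℝ u) z (W z) (η z) + fderiv ℝ u z (fderiv ℝ η z (W z)) := by
    rw [fderiv_clm_apply hdu hη]
    simp
    ring
  have hs := hg.symm.self_of_nhds
  have e4 := hlie (W z) (W z)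
  rw [hs (fderiv ℝ η z (W z)) (W z), hgWz, hgWz] at e4
  rw [hs (fderiv ℝ W z (η z)) (W z), hgWz] at e1
  have e5 := hsymm.eq (W z) (η z)
  change fderiv ℝ (fun w => fderiv ℝ u w (W w)) z (η z) =
      2 * fderiv ℝ (fun w => fderiv ℝ u w (η w)) z (W z) - 2 * ψ * fderiv ℝ u z (W z)
  rw [e2, e3]
  linarith

/-! ### The gauge equations in coordinates adapted to a bifurcate horizon -/

variable {F : Type} [NormedAddCommGroup F] [NormedSpace ℝ F] [FiniteDimensional ℝ F]

/-- The differential of the first coordinate. -/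
noncomputable abbrev dX (F : Type) [NormedAddCommGroup F] [NormedSpace ℝ F] : ℝ × ℝ × F →L[ℝ] ℝ :=
  .fst ℝ ℝ (ℝ × F)

/-- The differential of the second coordinate. -/
noncomputable abbrev dY (F : Type) [NormedAddCommGroup F] [NormedSpace ℝ F] : ℝ × ℝ × F →L[ℝ] ℝ :=
  (ContinuousLinearMap.fst ℝ ℝ F).comp (.snd ℝ ℝ (ℝ × F))

lemma dY_ne_zero : dY F ≠ 0 := fun h => by
  simpa using congrArg (fun L : ℝ × ℝ × F →L[ℝ] ℝ => L (0, 1, 0)) h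

/-- A conformal Killing field with a bifurcate horizon, in coordinates `(x, y, s)` near the origin in
which the branches are `y = 0` and `x = 0`, and the conformal factor is `y`. -/
structure FlatHorizon (g : ℝ × ℝ × F → ℝ × ℝ × F →L[ℝ] ℝ × ℝ × F →L[ℝ] ℝ)
    (η : ℝ × ℝ × F → ℝ × ℝ × F) (ψ : ℝ × ℝ × F → ℝ) : Prop where
  metric : FlatMetric g 0
  smooth_field : SmoothNear η 0
  smooth_factor : SmoothNear ψ 0
  lie_eq : ∀ᶠ z in 𝓝 0, ∀ v w, fderiv ℝ g z (η z) v w + g z (fderiv ℝ η z v) w +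
    g z v (fderiv ℝ η z w) = 2 * ψ z * g z v w
  snd_eq : ∀ᶠ z in 𝓝 0, (η z).2.1 = (ψ z - 1) * z.2.1
  fst_eq : ∀ᶠ z in 𝓝 0, z.1 = 0 → (η z).1 = 0
  vanish : ∀ᶠ z in 𝓝 0, z.1 = 0 → z.2.1 = 0 → η z = 0 ∧ ψ z = 0
  null : ∀ᶠ z in 𝓝 0, z.2.1 = 0 → dY F ((g z).inverse (dY F)) = 0
  transverse : dX F ((g 0).inverse (dY F)) ≠ 0

/-- The differential of `log |y e^σ|`, multiplied by `y`. -/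
noncomputable def gaugeForm (σ : ℝ × ℝ × F → ℝ) (z : ℝ × ℝ × F) : ℝ × ℝ × F →L[ℝ] ℝ :=
  dY F + z.2.1 • fderiv ℝ σ z

/-- The equations for the logarithm of a geodesic Killing gauge. -/
def FlatGauge (g : ℝ × ℝ × F → ℝ × ℝ × F →L[ℝ] ℝ × ℝ × F →L[ℝ] ℝ)
    (η : ℝ × ℝ × F → ℝ × ℝ × F) (ψ σ : ℝ × ℝ × F → ℝ) (z : ℝ × ℝ × F) : Prop :=
  fderiv ℝ σ z (η z) = - ψ z ∧ gaugeForm σ z ((g z).inverse (gaugeForm σ z)) = 0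

namespace FlatHorizon

variable {g : ℝ × ℝ × F → ℝ × ℝ × F →L[ℝ] ℝ × ℝ × F →L[ℝ] ℝ}
  {η : ℝ × ℝ × F → ℝ × ℝ × F} {ψ : ℝ × ℝ × F → ℝ}

lemma smoothNear_gaugeForm {σ : ℝ × ℝ × F → ℝ} {z : ℝ × ℝ × F} (hσ : SmoothNear σ z) :
    SmoothNear (gaugeForm σ) z :=
  (smoothNear_const _ _).add ((smoothNear_clm (dY F) _).smul hσ.fderiv_right)

lemma smoothNear_slice {G : Type*} [NormedAddCommGroup G] [NormedSpace ℝ G] {f : ℝ × ℝ × F → G}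
    (hf : SmoothNear f 0) : SmoothNear (fun r : ℝ × F => f (0, r)) 0 :=
  hf.comp_of_eq (smoothNear_clm (.inr ℝ ℝ (ℝ × F)) 0) (by simp)

lemma tendsto_slice : Tendsto (fun r : ℝ × F => ((0 : ℝ), r)) (𝓝 0) (𝓝 0) := by
  have : Continuous fun r : ℝ × F => ((0 : ℝ), r) := by fun_prop
  exact this.tendsto 0

lemma fst_ne_zero : ContinuousLinearMap.fst ℝ ℝ F ≠ 0 := fun h => by
  simpa using congrArg (fun L : ℝ × F →L[ℝ] ℝ => L (1, 0)) h

/-- On the branch `x = 0`, the field `η` is `y` times a field transverse to `y = 0`. -/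
lemma exists_slice (h : FlatHorizon g η ψ) : ∃ (b : ℝ × F → F) (k : ℝ × F → ℝ),
    SmoothNear b 0 ∧ SmoothNear k 0 ∧
    (∀ᶠ r in 𝓝 (0 : ℝ × F), η (0, r) = (0, r.1 • (ψ (0, r) - 1, b r))) ∧
    ∀ᶠ r in 𝓝 (0 : ℝ × F), ψ (0, r) = r.1 * k r := by
  have := FiniteDimensional.complete ℝ F
  have hηs : SmoothNear (fun r : ℝ × F => (η (0, r)).2.2) 0 :=
    (smoothNear_of_contDiff (contDiff_snd.comp contDiff_snd) _).comp
      (smoothNear_slice h.smooth_field)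
  obtain ⟨b, hb, hbe⟩ := hηs.exists_eq_smul (.fst ℝ ℝ F) fst_ne_zero rfl (by
    filter_upwards [tendsto_slice.eventually h.vanish] with r hr h0
    rw [(hr rfl h0).1]; rfl)
  obtain ⟨k, hk, hke⟩ := (smoothNear_slice h.smooth_factor).exists_eq_smul (.fst ℝ ℝ F)
    fst_ne_zero rfl (by
      filter_upwards [tendsto_slice.eventually h.vanish] with r hr h0
      exact (hr rfl h0).2)
  refine ⟨b, k, hb, hk, ?_, hke⟩
  filter_upwards [hbe, tendsto_slice.eventually h.fst_eq, tendsto_slice.eventually h.snd_eq]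
    with r h1 h2 h3
  refine Prod.ext (h2 rfl) (Prod.ext ?_ h1)
  rw [h3]
  simp [mul_comm]

lemma psi_zero (h : FlatHorizon g η ψ) : ψ 0 = 0 := (h.vanish.self_of_nhds rfl rfl).2

lemma smoothNear_sharp (h : FlatHorizon g η ψ) {E : Type*} [NormedAddCommGroup E] [NormedSpace ℝ E]
    {c : E → ℝ × ℝ × F} {α : E → ℝ × ℝ × F →L[ℝ] ℝ} {e : E} (hc : SmoothNear c e) (h0 : c e = 0)
    (hα : SmoothNear α e) : SmoothNear (fun w => (g (c w)).inverse (α w)) e :=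
  (h.metric.smooth_inverse.comp_of_eq hc h0).clm_apply hα

/-- Two solutions that agree on the bifurcation surface agree. -/
lemma gauge_unique (h : FlatHorizon g η ψ) {σ₁ σ₂ : ℝ × ℝ × F → ℝ} (h₁ : SmoothNear σ₁ 0)
    (h₂ : SmoothNear σ₂ 0) (hg₁ : ∀ᶠ z in 𝓝 0, FlatGauge g η ψ σ₁ z)
    (hg₂ : ∀ᶠ z in 𝓝 0, FlatGauge g η ψ σ₂ z)
    (h0 : ∀ᶠ s in 𝓝 (0 : F), σ₁ (0, 0, s) = σ₂ (0, 0, s)) : ∀ᶠ z in 𝓝 0, σ₁ z = σ₂ z := by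
  obtain ⟨b, k, hb, hk, hbe, hke⟩ := h.exists_slice
  set w : ℝ × ℝ × F → ℝ := fun z => σ₁ z - σ₂ z with hw
  have hws : SmoothNear w 0 := h₁.sub h₂
  have hdw : ∀ᶠ z in 𝓝 0, fderiv ℝ w z = fderiv ℝ σ₁ z - fderiv ℝ σ₂ z := by
    filter_upwards [h₁, h₂] with z h3 h4
    exact fderiv_fun_sub (differentiableAt_of_contDiffAt h3) (differentiableAt_of_contDiffAt h4)
  -- the branch `x = 0`
  have hslice : ∀ᶠ r in 𝓝 (0 : ℝ × F), w (0, r) = 0 := by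
    have hws' := smoothNear_slice hws
    have hX : SmoothNear (fun r : ℝ × F => (ψ (0, r) - 1, b r)) 0 :=
      ((smoothNear_slice h.smooth_factor).sub (smoothNear_const _ _)).prodMk hb
    refine transport_unique hX (.fst ℝ ℝ F) ?_ rfl
      (hws'.mono fun _ => differentiableAt_of_contDiffAt) ?_ ?_
    · have : ψ (0, 0) = 0 := h.psi_zero
      simp [this]
    -- On x = 0 the field η is y times the transport field, so η(w) = 0 gives the transport equation
    -- where y ≠ 0; continuity extends it to y = 0.
    · refine eventually_zero_of_ne ?_ (.fst ℝ ℝ F) fst_ne_zero ?_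
      · exact (hws'.fderiv_right.clm_apply hX).mono fun _ h => h.continuousAt
      · filter_upwards [hbe, tendsto_slice.eventually hg₁, tendsto_slice.eventually hg₂,
          tendsto_slice.eventually hdw, tendsto_slice.eventually hws] with r h3 h4 h5 h6 h7 h8
        have h9 : fderiv ℝ w (0, r) (η (0, r)) = 0 := by
          rw [h6, sub_apply, h4.1, h5.1, sub_self]
        have h10 : fderiv ℝ (fun r : ℝ × F => w (0, r)) r =
            (fderiv ℝ w (0, r)).comp (.inr ℝ ℝ (ℝ × F)) :=
          ((differentiableAt_of_contDiffAt h7).hasFDerivAt.comp r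
            (hasFDerivAt_prodMk_right (0 : ℝ) r)).fderiv
        have h11 : η (0, r) = r.1 • ((0 : ℝ), ((ψ (0, r) - 1, b r) : ℝ × F)) := by
          rw [h3]; simp
        rw [h11, map_smul, smul_eq_mul] at h9
        rw [h10]
        exact (mul_eq_zero.1 h9).resolve_left h8
    · have : Tendsto (fun r : ℝ × F => r.2) (𝓝 0) (𝓝 0) := continuous_snd.tendsto (0 : ℝ × F)
      filter_upwards [this.eventually h0] with r h3 h4
      obtain ⟨y, s⟩ := r
      simp only [ContinuousLinearMap.coe_fst'] at h4
      subst h4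
      exact sub_eq_zero.2 h3
  -- off the branch
  have hα := (smoothNear_gaugeForm h₁).add (smoothNear_gaugeForm h₂)
  have hX := h.smoothNear_sharp (smoothNear_of_contDiff contDiff_id 0) rfl hα
  have hmain : ∀ᶠ z in 𝓝 0, w z = 0 := by
    refine transport_unique hX (dX F) ?_ rfl
      (hws.mono fun _ => differentiableAt_of_contDiffAt) ?_ ?_
    · have : gaugeForm σ₁ 0 + gaugeForm σ₂ 0 = (2 : ℝ) • dY F := by
        simp [gaugeForm, two_smul]
      simp only [id]
      rw [this, map_smul, map_smul, smul_eq_mul]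
      exact mul_ne_zero two_ne_zero h.transverse
    · refine eventually_zero_of_ne ?_ (dY F) dY_ne_zero ?_
      · exact (hws.fderiv_right.clm_apply hX).mono fun _ h => h.continuousAt
      · filter_upwards [hg₁, hg₂, hdw, h.metric.eventually_invertible, h.metric.symm]
          with z h3 h4 h5 h6 h7 h8
        -- For the gauge forms α₁ and α₂, y dw = α₁ - α₂, and ⟨α₁ - α₂, α₁ + α₂⟩ = |α₁|² - |α₂|² =
        -- 0. The sum is 2 dy at the origin, so its dual vector is transverse to x = 0.
        have h9 : z.2.1 • fderiv ℝ w z = gaugeForm σ₁ z - gaugeForm σ₂ z := by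
          rw [h5]
          simp only [gaugeForm, smul_sub]
          abel
        have h10 : z.2.1 * fderiv ℝ w z ((g z).inverse (gaugeForm σ₁ z + gaugeForm σ₂ z)) = 0 := by
          have h11 : z.2.1 * fderiv ℝ w z ((g z).inverse (gaugeForm σ₁ z + gaugeForm σ₂ z)) =
              (z.2.1 • fderiv ℝ w z) ((g z).inverse (gaugeForm σ₁ z + gaugeForm σ₂ z)) := rfl
          rw [h11, h9, map_add]
          simp only [sub_apply, map_add]
          rw [inverse_symm h6 h7 (gaugeForm σ₁ z) (gaugeForm σ₂ z), h3.2, h4.2]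
          ring
        exact (mul_eq_zero.1 h10).resolve_left h8
    · have : Tendsto (fun z : ℝ × ℝ × F => z.2) (𝓝 0) (𝓝 0) :=
        continuous_snd.tendsto (0 : ℝ × ℝ × F)
      filter_upwards [this.eventually hslice] with z h3 h4
      obtain ⟨x, r⟩ := z
      simp only [ContinuousLinearMap.coe_fst'] at h4
      subst h4
      exact h3
  filter_upwards [hmain] with z hz
  exact sub_eq_zero.1 hz

/-- The solution of the Killing equation on the branch `x = 0`. -/
lemma exists_slice_gauge (h : FlatHorizon g η ψ) {v₀ : F → ℝ} (hv₀ : SmoothNear v₀ 0) :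
    ∃ v : ℝ × F → ℝ, SmoothNear v 0 ∧ (∀ᶠ s in 𝓝 (0 : F), v (0, s) = v₀ s) ∧
      ∀ᶠ r in 𝓝 (0 : ℝ × F), fderiv ℝ v r (η (0, r)).2 = - ψ (0, r) := by
  obtain ⟨b, k, hb, hk, hbe, hke⟩ := h.exists_slice
  have hr : SmoothNear (fun a : ℝ × F × (F →L[ℝ] ℝ) => (a.1, a.2.1)) (0, 0, fderiv ℝ v₀ 0) :=
    smoothNear_of_contDiff (contDiff_fst.prodMk (contDiff_fst.comp contDiff_snd)) _
  have hψ := (smoothNear_slice h.smooth_factor).comp_of_eq hr rfl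
  -- Divided by y, the Killing equation on x = 0 is (ψ - 1) ∂v/∂y + ∂v/∂s(b) = -k. Solved for ∂v/∂y
  -- it is a Hamilton-Jacobi equation, linear in ∂v/∂s, with y as time; the denominator is 1 at the
  -- origin because ψ(0) = 0.
  obtain ⟨v, hv, hv0, hve⟩ := exists_hamiltonJacobi
    (K := fun a : ℝ × F × (F →L[ℝ] ℝ) =>
      (k (a.1, a.2.1) + a.2.2 (b (a.1, a.2.1))) / (1 - ψ (0, a.1, a.2.1))) hv₀ (by
    refine ((hk.comp_of_eq hr rfl).add ((smoothNear_of_contDiff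
      (contDiff_snd.comp contDiff_snd) _).clm_apply (hb.comp_of_eq hr rfl))).div
      ((smoothNear_const _ _).sub hψ) ?_
    have : ψ (0, 0, 0) = 0 := h.psi_zero
    simp [this])
  refine ⟨v, hv, hv0, ?_⟩
  have hψne : ∀ᶠ r in 𝓝 (0 : ℝ × F), 1 - ψ (0, r) ≠ 0 := by
    have hc : ContinuousAt (fun r : ℝ × F => 1 - ψ (0, r)) 0 :=
      ((smoothNear_const (1 : ℝ) _).sub (smoothNear_slice h.smooth_factor)).continuousAt
    refine hc.eventually_ne ?_
    have : ψ (0, 0) = 0 := h.psi_zero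
    simp [this]
  filter_upwards [hve, hbe, hke, hψne] with r h1 h2 h3 h4
  have h5 : (η (0, r)).2 = (r.1 * (ψ (0, r) - 1)) • ((1 : ℝ), (0 : F)) + r.1 • ((0 : ℝ), b r) := by
    rw [h2]; simp
  have h6 : fderiv ℝ v r (0, b r) = (fderiv ℝ v r).comp (.inr ℝ ℝ F) (b r) := rfl
  rw [h5, map_add, map_smul, map_smul, h1, h6]
  simp only [Prod.mk.eta, smul_eq_mul]
  rw [h3]
  rw [h3] at h4
  field_simp
  ring

/-- The solution of the eikonal equation with given values on the branch `x = 0`. -/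
lemma exists_eikonal (h : FlatHorizon g η ψ) {v₁ : ℝ × F → ℝ} (hv₁ : SmoothNear v₁ 0) :
    ∃ σ : ℝ × ℝ × F → ℝ, SmoothNear σ 0 ∧ (∀ᶠ r in 𝓝 (0 : ℝ × F), σ (0, r) = v₁ r) ∧
      ∀ᶠ z in 𝓝 0, gaugeForm σ z ((g z).inverse (gaugeForm σ z)) = 0 := by
  have hYY : SmoothNear (fun z => dY F ((g z).inverse (dY F))) 0 :=
    (smoothNear_const _ _).clm_apply (h.metric.smooth_inverse.clm_apply (smoothNear_const _ _))
  -- |dy|² = y m since the branch y = 0 is null; this allows the whole eikonal equation to be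
  -- divided by y.
  obtain ⟨m, hm, hme⟩ := hYY.exists_eq_smul (dY F) dY_ne_zero rfl h.null
  let D := ℝ × F →L[ℝ] ℝ
  let a₀ : ℝ × (ℝ × F) × D := (0, 0, fderiv ℝ v₁ 0)
  let pos : ℝ × (ℝ × F) × D → ℝ × ℝ × F := fun a => (a.1, a.2.1)
  let cov : ℝ × (ℝ × F) × D → (ℝ × ℝ × F →L[ℝ] ℝ) := fun a => a.2.2.comp (.snd ℝ ℝ (ℝ × F))
  have hpos : SmoothNear pos a₀ :=
    smoothNear_of_contDiff (contDiff_fst.prodMk (contDiff_fst.comp contDiff_snd)) _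
  have hpos0 : pos a₀ = 0 := rfl
  have hcov : SmoothNear cov a₀ :=
    (smoothNear_of_contDiff (contDiff_snd.comp contDiff_snd) a₀).clm_comp (smoothNear_const _ _)
  have hy : SmoothNear (fun a => (pos a).2.1) a₀ := (smoothNear_clm (dY F) _).comp hpos
  have hXX := fun α β : ℝ × ℝ × F →L[ℝ] ℝ =>
    (smoothNear_const α a₀).clm_apply (h.smoothNear_sharp hpos hpos0 (smoothNear_const β _))
  have hcX := fun α : ℝ × ℝ × F →L[ℝ] ℝ =>
    (smoothNear_const α a₀).clm_apply (h.smoothNear_sharp hpos hpos0 hcov)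
  have hcc := hcov.clm_apply (h.smoothNear_sharp hpos hpos0 hcov)
  -- With dσ = K dx + `cov`, the eikonal equation divided by y is the quadratic A K² + 2 C₁ K + C₀ =
  -- 0 in K = ∂σ/∂x.
  let A : ℝ × (ℝ × F) × D → ℝ := fun a => (pos a).2.1 * dX F ((g (pos a)).inverse (dX F))
  let C₁ : ℝ × (ℝ × F) × D → ℝ := fun a => dX F ((g (pos a)).inverse (dY F)) +
    (pos a).2.1 * dX F ((g (pos a)).inverse (cov a))
  let C₀ : ℝ × (ℝ × F) × D → ℝ := fun a => m (pos a) +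
    2 * dY F ((g (pos a)).inverse (cov a)) + (pos a).2.1 * cov a ((g (pos a)).inverse (cov a))
  have hA : SmoothNear A a₀ := hy.mul (hXX _ _)
  have hC₁ : SmoothNear C₁ a₀ := (hXX _ _).add (hy.mul (hcX _))
  have hC₀ : SmoothNear C₀ a₀ :=
    ((hm.comp_of_eq hpos hpos0).add ((smoothNear_const 2 _).mul (hcX _))).add (hy.mul hcc)
  have hC₁0 : C₁ a₀ ≠ 0 := by
    have h1 : C₁ a₀ = dX F ((g 0).inverse (dY F)) + 0 * _ := rfl
    rw [h1, zero_mul, add_zero]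
    exact h.transverse
  have hA0 : A a₀ = 0 := zero_mul _
  let rt : ℝ × (ℝ × F) × D → ℝ := fun a => 1 - A a * C₀ a / C₁ a ^ 2
  have hrt : SmoothNear rt a₀ := (smoothNear_const 1 _).sub ((hA.mul hC₀).div
    ((hC₁.mul hC₁).congr (Eventually.of_forall fun a => sq (C₁ a))) (pow_ne_zero 2 hC₁0))
  have hrt0 : rt a₀ = 1 := by simp [rt, hA0]
  have hsq : SmoothNear (fun a => √(rt a)) a₀ := hrt.sqrt (by rw [hrt0]; exact one_ne_zero)
  -- A vanishes at the base point, so the root is taken in the rationalized form, without A in the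
  -- denominator. It is the branch that tends to -C₀/(2C₁), and it is smooth because C₁ is ⟨dx, dy⟩
  -- ≠ 0 there.
  let K : ℝ × (ℝ × F) × D → ℝ := fun a => -C₀ a / (C₁ a * (1 + √(rt a)))
  have hKs : SmoothNear K a₀ := by
    refine hC₀.neg.div (hC₁.mul ((smoothNear_const 1 _).add hsq)) (mul_ne_zero hC₁0 ?_)
    positivity
  have hKroot : ∀ᶠ a in 𝓝 a₀, A a * K a ^ 2 + 2 * C₁ a * K a + C₀ a = 0 := by
    filter_upwards [hC₁.continuousAt.eventually_ne hC₁0,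
      hrt.continuousAt.eventually (lt_mem_nhds (by rw [hrt0]; exact zero_lt_one))] with a h1 h2
    have h3 : √(rt a) ^ 2 * C₁ a ^ 2 = C₁ a ^ 2 - A a * C₀ a := by
      rw [Real.sq_sqrt h2.le]
      simp only [rt]
      field_simp
    have h4 : 1 + √(rt a) ≠ 0 := by positivity
    simp only [K]
    generalize √(rt a) = ρ at h3 h4
    have h5 : A a * C₀ a = C₁ a ^ 2 * (1 - ρ) * (1 + ρ) := by linear_combination h3
    have h6 : A a * (-C₀ a / (C₁ a * (1 + ρ))) ^ 2 = C₀ a * (1 - ρ) / (1 + ρ) := by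
      have : A a * (-C₀ a / (C₁ a * (1 + ρ))) ^ 2 =
          (A a * C₀ a) * C₀ a / (C₁ a * (1 + ρ)) ^ 2 := by
        field_simp
      rw [this, h5]
      field_simp
    rw [h6]
    field_simp
    ring
  obtain ⟨σ, hσ, hσ0, hσe⟩ := exists_hamiltonJacobi (Q := ℝ × F) (s₀ := 0) hv₁ hKs
  refine ⟨σ, hσ, hσ0, ?_⟩
  -- `hKroot` holds only near a₀; the position and the (y, s)-differential of σ tend to a₀ because σ
  -- restricts to v₁ on x = 0.
  have hlift : Tendsto (fun z : ℝ × ℝ × F => ((z.1, z.2, (fderiv ℝ σ z).comp (.inr ℝ ℝ (ℝ × F))) :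
      ℝ × (ℝ × F) × D)) (𝓝 0) (𝓝 a₀) := by
    have hc : ContinuousAt (fun z : ℝ × ℝ × F => ((z.1, z.2, (fderiv ℝ σ z).comp
        (.inr ℝ ℝ (ℝ × F))) : ℝ × (ℝ × F) × D)) 0 :=
      continuousAt_fst.prodMk (continuousAt_snd.prodMk
        (hσ.fderiv_right.clm_comp (smoothNear_const _ _)).continuousAt)
    have h1 : (fderiv ℝ σ 0).comp (.inr ℝ ℝ (ℝ × F)) = fderiv ℝ v₁ 0 := by
      have h2 := hσ.differentiableAt.hasFDerivAt.comp (0 : ℝ × F)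
        (hasFDerivAt_prodMk_right (0 : ℝ) (0 : ℝ × F))
      exact h2.unique (hv₁.differentiableAt.hasFDerivAt.congr_of_eventuallyEq hσ0)
    have h2 := hc.tendsto
    simp only [h1] at h2
    exact h2
  filter_upwards [hσe, hlift.eventually hKroot, hme, h.metric.eventually_invertible,
    h.metric.symm] with z h1 h2 h3 h4 h5
  set a : ℝ × (ℝ × F) × D := (z.1, z.2, (fderiv ℝ σ z).comp (.inr ℝ ℝ (ℝ × F))) with ha
  have h6 : fderiv ℝ σ z = K a • dX F + cov a := by
    ext v
    · have h7 : ((0 : ℝ), (0 : ℝ × F)) = 0 := rfl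
      simp only [ContinuousLinearMap.comp_apply, ContinuousLinearMap.inl_apply, add_apply,
        smul_apply, cov, ContinuousLinearMap.coe_fst', ContinuousLinearMap.coe_snd', smul_eq_mul,
        mul_one, map_zero, add_zero]
      exact h1
    · simp [cov, ha]
    · simp [cov, ha]
  have hposa : pos a = z := rfl
  have hXY := inverse_symm h4 h5 (dY F) (dX F)
  have hXc := inverse_symm h4 h5 (cov a) (dX F)
  have hYc := inverse_symm h4 h5 (cov a) (dY F)
  simp only [A, C₁, C₀, hposa] at h2
  have h7 : gaugeForm σ z ((g z).inverse (gaugeForm σ z)) = dY F ((g z).inverse (dY F)) +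
      2 * z.2.1 * (K a * dX F ((g z).inverse (dY F)) + dY F ((g z).inverse (cov a))) +
      z.2.1 ^ 2 * (K a ^ 2 * dX F ((g z).inverse (dX F)) +
        2 * K a * dX F ((g z).inverse (cov a)) + cov a ((g z).inverse (cov a))) := by
    simp only [gaugeForm, h6]
    generalize dX F = α at hXY hXc ⊢
    generalize dY F = β at hXY hYc ⊢
    simp only [map_add, map_smul, add_apply, smul_apply,
      smul_eq_mul, smul_add, hXY, hXc, hYc]
    ring
  have h8 : dY F ((g z).inverse (dY F)) = z.2.1 * m z := h3
  rw [h7, h8]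
  linear_combination z.2.1 * h2

/-- Existence of a solution with given values on the bifurcation surface. -/
lemma exists_gauge (h : FlatHorizon g η ψ) {v₀ : F → ℝ} (hv₀ : SmoothNear v₀ 0) :
    ∃ σ : ℝ × ℝ × F → ℝ, SmoothNear σ 0 ∧ (∀ᶠ s in 𝓝 (0 : F), σ (0, 0, s) = v₀ s) ∧
      ∀ᶠ z in 𝓝 0, FlatGauge g η ψ σ z := by
  obtain ⟨v₁, hv₁, hv₁0, hv₁e⟩ := h.exists_slice_gauge hv₀
  obtain ⟨σ, hσ, hσ0, hσe⟩ := h.exists_eikonal hv₁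
  refine ⟨σ, hσ, ?_, ?_⟩
  · have : Tendsto (fun s : F => ((0 : ℝ), s)) (𝓝 0) (𝓝 0) := by
      have : Continuous fun s : F => ((0 : ℝ), s) := by fun_prop
      exact this.tendsto 0
    filter_upwards [this.eventually hσ0, hv₁0] with s h1 h2
    rw [h1, h2]
  -- The defect in the Killing equation. On x = 0 it vanishes by the choice of v₁, as η is tangent
  -- to that branch; the null gradient of u = y e^σ carries this off the branch.
  let τ : ℝ × ℝ × F → ℝ := fun z => fderiv ℝ σ z (η z) + ψ z
  have hτ : SmoothNear τ 0 := (hσ.fderiv_right.clm_apply h.smooth_field).add h.smooth_factor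
  let u : ℝ × ℝ × F → ℝ := fun z => z.2.1 * Real.exp (σ z)
  have hu : SmoothNear u 0 := by
    filter_upwards [hσ] with z hz
    exact (dY F).contDiff.contDiffAt.mul hz.exp
  have hdu : ∀ᶠ z in 𝓝 0, fderiv ℝ u z = Real.exp (σ z) • gaugeForm σ z := by
    filter_upwards [hσ] with z hz
    have h1 := (dY F).hasFDerivAt.mul (x := z) (differentiableAt_of_contDiffAt hz).hasFDerivAt.exp
    have h2 : fderiv ℝ u z = _ := h1.fderiv
    rw [h2]
    ext <;> simp [gaugeForm] <;> ring
  have hX := h.smoothNear_sharp (smoothNear_of_contDiff contDiff_id 0) rfl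
    (smoothNear_gaugeForm hσ)
  have hduη : ∀ᶠ z in 𝓝 0, fderiv ℝ u z (η z) = u z * (τ z - 1) := by
    filter_upwards [hdu, h.snd_eq] with z h1 h2
    rw [h1]
    simp only [gaugeForm, smul_apply, add_apply,
      smul_eq_mul, u, τ]
    have h3 : dY F (η z) = (η z).2.1 := rfl
    rw [h3, h2]
    ring
  have hn : ∀ᶠ z in 𝓝 0, fderiv ℝ u z ((g z).inverse (fderiv ℝ u z)) = 0 := by
    filter_upwards [hdu, hσe] with z h1 h2
    rw [h1, map_smul]
    simp [h2]
  have hτ0 : ∀ᶠ z in 𝓝 0, τ z = 0 := by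
    refine transport_unique hX (dX F) ?_ rfl (hτ.mono fun _ => differentiableAt_of_contDiffAt) ?_ ?_
    · have : gaugeForm σ 0 = dY F := by simp [gaugeForm]
      simp only [id, this]
      exact h.transverse
    -- The identity derived below carries a factor u, so it gives information for y ≠ 0 only;
    -- continuity covers y = 0.
    · refine eventually_zero_of_ne ?_ (dY F) dY_ne_zero ?_
      · exact (hτ.fderiv_right.clm_apply hX).mono fun _ h => h.continuousAt
      · have hsm : ∀ᶠ z in 𝓝 0, SmoothNear g z := h.metric.smooth.eventually
        filter_upwards [hsm, h.metric.symm.eventually_nhds, h.metric.eventually_invertible,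
          h.smooth_field, h.lie_eq, hu.eventually, hduη.eventually_nhds, hn.eventually_nhds,
          hdu, hτ] with z h1 h2 h3 h4 h5 h6 h7 h8 h9 h10 h11
        -- Inserting |du|² = 0 and η(u) = u(τ - 1), every term drops out except 2u⟨dτ, du⟩.
        have key := fderiv_gradSq_conformalKilling ⟨h1, h2, h3⟩ (differentiableAt_of_contDiffAt h4)
          h6 h5
        have e1 : fderiv ℝ (fun w => fderiv ℝ u w ((g w).inverse (fderiv ℝ u w))) z = 0 := by
          have : (fun w => fderiv ℝ u w ((g w).inverse (fderiv ℝ u w))) =ᶠ[𝓝 z] fun _ => 0 := h8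
          rw [this.fderiv_eq]
          simp
        have e2 : fderiv ℝ (fun w => fderiv ℝ u w (η w)) z =
            u z • fderiv ℝ τ z + (τ z - 1) • fderiv ℝ u z := by
          have : (fun w => fderiv ℝ u w (η w)) =ᶠ[𝓝 z] fun w => u w * (τ w - 1) := h7
          rw [this.fderiv_eq]
          have h12 := h6.differentiableAt.hasFDerivAt.mul
            ((differentiableAt_of_contDiffAt h10).hasFDerivAt.sub_const 1)
          exact h12.fderiv
        have e3 := h8.self_of_nhds
        rw [e1, e2, add_apply, smul_apply,
          smul_apply, e3, h9, map_smul, map_smul] at key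
        simp only [zero_apply, smul_eq_mul, u, mul_zero, add_zero,
          sub_zero, zero_eq_mul, mul_eq_zero, OfNat.ofNat_ne_zero, Real.exp_ne_zero, or_false,
          false_or] at key
        exact key.resolve_left h11
    · have ht : Tendsto (fun z : ℝ × ℝ × F => z.2) (𝓝 0) (𝓝 0) :=
        continuous_snd.tendsto (0 : ℝ × ℝ × F)
      filter_upwards [ht.eventually hv₁e, ht.eventually hσ0.eventually_nhds,
        ht.eventually (tendsto_slice.eventually h.fst_eq), hσ, ht.eventually hv₁]
        with z h1 h2 h3 h4 h5 h6
      obtain ⟨x, r⟩ := z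
      simp only [ContinuousLinearMap.coe_fst'] at h6
      subst h6
      have e1 : (fderiv ℝ σ (0, r)).comp (.inr ℝ ℝ (ℝ × F)) = fderiv ℝ v₁ r := by
        have h7 := (differentiableAt_of_contDiffAt h4).hasFDerivAt.comp r
          (hasFDerivAt_prodMk_right (0 : ℝ) r)
        exact h7.unique
          ((differentiableAt_of_contDiffAt h5).hasFDerivAt.congr_of_eventuallyEq h2)
      have e2 : η (0, r) = (0, (η (0, r)).2) := Prod.ext (h3 rfl) rfl
      have e3 : fderiv ℝ σ (0, r) (η (0, r)) = fderiv ℝ v₁ r (η (0, r)).2 := by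
        rw [← e1, e2]
        rfl
      simp only [τ]
      rw [e3, h1]
      ring
  filter_upwards [hτ0, hσe] with z h1 h2
  exact ⟨eq_neg_of_add_eq_zero_left h1, h2⟩

end FlatHorizon

end FlatModel

end ConformalGauge

/-! ### Gluing germs along a subset -/

namespace ConformalGauge

/-- Functions on open sets that cover `S`, with the same germs along `S`, can be glued near `S`. -/
lemma exists_glue {X : Type*} [TopologicalSpace X] [TopologicalSpace.MetrizableSpace X] {S : Set X}
    (V : S → Set X) (f : S → X → ℝ) (hV : ∀ p, IsOpen (V p)) (hp : ∀ p : S, (p : X) ∈ V p)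
    (hagree : ∀ p q, ∀ s ∈ S, s ∈ V p → s ∈ V q → f p =ᶠ[𝓝 s] f q) :
    ∃ (W : Set X) (φ : X → ℝ), IsOpen W ∧ S ⊆ W ∧ ∀ x ∈ W, ∃ p, x ∈ V p ∧ φ =ᶠ[𝓝 x] f p := by
  classical
  let _ := TopologicalSpace.metrizableSpaceMetric X
  set O : Set X := ⋃ p, V p with hO
  have hOo : IsOpen O := isOpen_iUnion hV
  obtain ⟨v, hvo, hvc, hvlf, hvV⟩ := precise_refinement (fun p : S => (Subtype.val ⁻¹' V p : Set O))
    (fun p => (hV p).preimage continuous_subtype_val) (by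
      refine eq_univ_of_forall fun x => ?_
      obtain ⟨p, hp⟩ := mem_iUnion.1 x.2
      exact mem_iUnion.2 ⟨p, hp⟩)
  -- Shrinking leaves a cover whose closures stay inside the sets `v p`: near a given point only the
  -- finitely many indices whose closure contains it then matter.
  obtain ⟨w, hwc, hwo, hwv⟩ := exists_iUnion_eq_closure_subset hvo hvlf.point_finite hvc
  have hchoose : ∀ x : O, ∃ p, x ∈ w p := fun x => by
    have : x ∈ ⋃ p, w p := hwc ▸ mem_univ x
    exact mem_iUnion.1 this
  choose c hc using hchoose
  let φ : X → ℝ := fun x => if h : x ∈ O then f (c ⟨x, h⟩) x else 0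
  -- The points at which all the relevant functions have the same germ. On the interior of `A` the
  -- arbitrary choice `c` of an index is immaterial, and local finiteness makes `A` a neighbourhood
  -- of each point of `S`.
  let A : Set O := {x | ∀ p q, x ∈ closure (w p) → x ∈ closure (w q) → f p =ᶠ[𝓝 (x : X)] f q}
  have hmap : ∀ x : O, map Subtype.val (𝓝 x) = 𝓝 (x : X) := fun x =>
    hOo.isOpenEmbedding_subtypeVal.map_nhds_eq x
  refine ⟨Subtype.val '' interior A, φ, hOo.isOpenEmbedding_subtypeVal.isOpenMap _ isOpen_interior,
    ?_, ?_⟩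
  · intro s hs
    let s' : O := ⟨s, mem_iUnion.2 ⟨⟨s, hs⟩, hp ⟨s, hs⟩⟩⟩
    refine ⟨s', ?_, rfl⟩
    rw [mem_interior_iff_mem_nhds]
    obtain ⟨t, ht, hfin⟩ := hvlf s'
    have hpair : ∀ p q : S, ∀ᶠ x : O in 𝓝 s', x ∈ closure (w p) → x ∈ closure (w q) →
        f p =ᶠ[𝓝 (x : X)] f q := by
      intro p q
      by_cases h1 : s' ∈ closure (w p)
      · by_cases h2 : s' ∈ closure (w q)
        · have h3 : f p =ᶠ[𝓝 s] f q := hagree p q s hs (hvV p (hwv p h1)) (hvV q (hwv q h2))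
          have h4 : ∀ᶠ x : O in 𝓝 s', f p =ᶠ[𝓝 (x : X)] f q :=
            continuous_subtype_val.continuousAt.eventually
            (p := fun y : X => f p =ᶠ[𝓝 y] f q) h3.eventuallyEq_nhds
          exact h4.mono fun x hx _ _ => hx
        · filter_upwards [isClosed_closure.isOpen_compl.mem_nhds h2] with x hx _ h
          exact absurd h hx
      · filter_upwards [isClosed_closure.isOpen_compl.mem_nhds h1] with x hx h
        exact absurd h hx
    have hall := (eventually_all_finite hfin).2 fun p _ =>
      (eventually_all_finite hfin).2 fun q _ => hpair p q
    filter_upwards [hall, ht] with x hx hxt p q h1 h2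
    exact hx p ⟨x, hwv p h1, hxt⟩ q ⟨x, hwv q h2, hxt⟩ h1 h2
  · rintro - ⟨x, hx, rfl⟩
    refine ⟨c x, hvV _ (hwv _ (subset_closure (hc x))), ?_⟩
    rw [EventuallyEq, ← hmap x, eventually_map]
    filter_upwards [isOpen_interior.mem_nhds hx, (hwo (c x)).mem_nhds (hc x)] with y hy hyw
    have h1 : φ y = f (c y) y := by
      simp only [φ, dif_pos y.2]
    rw [h1]
    exact (interior_subset hy (c y) (c x) (subset_closure (hc y)) (subset_closure hyw)).self_of_nhds

end ConformalGauge

namespace ConformalGauge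

variable {d : ℕ} {M : Type*} [TopologicalSpace M]
  [ChartedSpace (EuclideanSpace ℝ (Fin d)) M] [IsManifold (𝓡 d) ∞ M]

/-! ### Local parametrizations of a manifold -/

section Param

variable {W W' : Type*} [NormedAddCommGroup W] [NormedSpace ℝ W]
  [NormedAddCommGroup W'] [NormedSpace ℝ W']

/-- `c` is a smooth local parametrization of `M` that maps `w₀` to `p`, with local inverse `a`. -/
structure IsParam (c : W → M) (a : M → W) (w₀ : W) (p : M) : Prop where
  map_eq : c w₀ = p
  smooth : ∀ᶠ w in 𝓝 w₀, ContMDiffAt 𝓘(ℝ, W) (𝓡 d) ∞ c w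
  smooth_inv : ∀ᶠ x in 𝓝 p, ContMDiffAt (𝓡 d) 𝓘(ℝ, W) ∞ a x
  left_inv : ∀ᶠ w in 𝓝 w₀, a (c w) = w
  right_inv : ∀ᶠ x in 𝓝 p, c (a x) = x

lemma isParam_extChartAt (p : M) :
    IsParam (d := d) (extChartAt (𝓡 d) p).symm (extChartAt (𝓡 d) p) (extChartAt (𝓡 d) p p) p where
  map_eq := extChartAt_to_inv p
  smooth := by
    filter_upwards [eventually_mem_nhds_iff.2 (extChartAt_target_mem_nhds (I := 𝓡 d) p)] with w hw
    exact (contMDiffOn_extChartAt_symm p).contMDiffAt hw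
  smooth_inv := by
    filter_upwards [(chartAt (EuclideanSpace ℝ (Fin d)) p).open_source.mem_nhds
      (mem_chart_source _ p)] with x hx
    exact contMDiffAt_extChartAt' hx
  left_inv := by
    filter_upwards [extChartAt_target_mem_nhds (I := 𝓡 d) p] with w hw
    exact (extChartAt (𝓡 d) p).right_inv hw
  right_inv := by
    filter_upwards [extChartAt_source_mem_nhds (I := 𝓡 d) p] with x hx
    exact (extChartAt (𝓡 d) p).left_inv hx

namespace IsParam

variable {c : W → M} {a : M → W} {w₀ : W} {p : M}

omit [IsManifold (𝓡 d) ∞ M] in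
lemma tendsto (h : IsParam (d := d) c a w₀ p) : Tendsto c (𝓝 w₀) (𝓝 p) := by
  have := h.smooth.self_of_nhds.continuousAt
  rwa [ContinuousAt, h.map_eq] at this

omit [IsManifold (𝓡 d) ∞ M] in
lemma inv_eq (h : IsParam (d := d) c a w₀ p) : a p = w₀ := by
  rw [← h.map_eq]
  exact h.left_inv.self_of_nhds

omit [IsManifold (𝓡 d) ∞ M] in
lemma tendsto_inv (h : IsParam (d := d) c a w₀ p) : Tendsto a (𝓝 p) (𝓝 w₀) := by
  have := h.smooth_inv.self_of_nhds.continuousAt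
  rwa [ContinuousAt, h.inv_eq] at this

omit [IsManifold (𝓡 d) ∞ M] in
-- All clauses are open conditions. Facts proved at the base point of a parametrization therefore
-- hold near it, which turns pointwise statements into statements about germs.
lemma eventually (h : IsParam (d := d) c a w₀ p) :
    ∀ᶠ w in 𝓝 w₀, IsParam (d := d) c a w (c w) := by
  filter_upwards [h.smooth.eventually_nhds, h.left_inv.eventually_nhds,
    h.tendsto.eventually h.smooth_inv.eventually_nhds,
    h.tendsto.eventually h.right_inv.eventually_nhds] with w h1 h2 h3 h4
  exact ⟨rfl, h1, h3, h2, h4⟩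

omit [IsManifold (𝓡 d) ∞ M] in
/-- Change of parameters by a local diffeomorphism. -/
lemma comp (h : IsParam (d := d) c a w₀ p) {c' : W' → W} {a' : W → W'} {w₀' : W'}
    (hc : SmoothNear c' w₀') (ha : SmoothNear a' w₀) (h0 : c' w₀' = w₀)
    (hl : ∀ᶠ w in 𝓝 w₀', a' (c' w) = w) (hr : ∀ᶠ w in 𝓝 w₀, c' (a' w) = w) :
    IsParam (d := d) (fun w => c (c' w)) (fun x => a' (a x)) w₀' p := by
  have hct : Tendsto c' (𝓝 w₀') (𝓝 w₀) := by
    have := hc.continuousAt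
    rwa [ContinuousAt, h0] at this
  refine ⟨by rw [h0, h.map_eq], ?_, ?_, ?_, ?_⟩
  · filter_upwards [hc, hct.eventually h.smooth] with w h1 h2
    exact ContMDiffAt.comp w h2 h1.contMDiffAt
  · filter_upwards [h.smooth_inv, h.tendsto_inv.eventually ha] with x h1 h2
    exact ContMDiffAt.comp x h2.contMDiffAt h1
  · filter_upwards [hct.eventually h.left_inv, hl] with w h1 h2
    rw [h1, h2]
  · filter_upwards [h.tendsto_inv.eventually hr, h.right_inv] with x h1 h2
    rw [h1, h2]

omit [IsManifold (𝓡 d) ∞ M] in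
/-- Change of parameters by the local inverse of a map with invertible derivative. -/
lemma exists_comp_symm [CompleteSpace W] [CompleteSpace W'] (h : IsParam (d := d) c a w₀ p)
    {Ψ : W → W'} (hΨ : SmoothNear Ψ w₀) (hi : (fderiv ℝ Ψ w₀).IsInvertible) :
    ∃ U : W' → W, SmoothNear U (Ψ w₀) ∧ U (Ψ w₀) = w₀ ∧ (∀ᶠ w in 𝓝 (Ψ w₀), Ψ (U w) = w) ∧
      (∀ᶠ w in 𝓝 w₀, U (Ψ w) = w) ∧
      IsParam (d := d) (fun w => c (U w)) (fun x => Ψ (a x)) (Ψ w₀) p := by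
  let H : W' × W → W' := fun v => Ψ v.2 - v.1
  have hH : SmoothNear H (Ψ w₀, w₀) :=
    (hΨ.comp_of_eq (smoothNear_of_contDiff contDiff_snd _) rfl).sub
      (smoothNear_of_contDiff contDiff_fst _)
  obtain ⟨U, hU0, hU, hUi⟩ := exists_smooth_implicit hH (by simp [H]) (by
    have h1 := hH.differentiableAt.hasFDerivAt.comp w₀
      (hasFDerivAt_prodMk_right (𝕜 := ℝ) (Ψ w₀) w₀)
    have h2 : HasFDerivAt (H ∘ fun w => (Ψ w₀, w)) (_root_.fderiv ℝ Ψ w₀) w₀ :=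
      hΨ.differentiableAt.hasFDerivAt.sub_const (Ψ w₀)
    rw [h1.unique h2]
    exact hi)
  simp only at hU0 hU
  have hUs : SmoothNear U (Ψ w₀) := hU.mono fun _ h => h.1
  have hr : ∀ᶠ w in 𝓝 (Ψ w₀), Ψ (U w) = w := hU.mono fun _ h => sub_eq_zero.1 h.2
  have hl : ∀ᶠ w in 𝓝 w₀, U (Ψ w) = w := by
    have : Tendsto (fun w => (Ψ w, w)) (𝓝 w₀) (𝓝 (Ψ w₀, w₀)) :=
      (hΨ.continuousAt.prodMk continuousAt_id).tendsto
    filter_upwards [this.eventually hUi] with w hw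
    exact hw.1 (sub_self _)
  exact ⟨U, hUs, hU0, hr, hl, h.comp hUs hΨ hU0 hr hl⟩

end IsParam

end Param

end ConformalGauge

namespace ConformalGauge

variable {d : ℕ} {M : Type*} [TopologicalSpace M]
  [ChartedSpace (EuclideanSpace ℝ (Fin d)) M]

/-! ### Differentials in a parametrization -/

section Frames

variable {W : Type*} [NormedAddCommGroup W] [NormedSpace ℝ W]

/-- The derivative of a parametrization. -/
noncomputable def frame (c : W → M) (w : W) : W →L[ℝ] EuclideanSpace ℝ (Fin d) :=
  mfderiv 𝓘(ℝ, W) (𝓡 d) c w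

/-- The derivative of a coordinate map. -/
noncomputable def coframe (a : M → W) (x : M) : EuclideanSpace ℝ (Fin d) →L[ℝ] W :=
  mfderiv (𝓡 d) 𝓘(ℝ, W) a x

/-- The differential of a function, as a linear form on the model space. -/
noncomputable def diffl (f : M → ℝ) (x : M) : EuclideanSpace ℝ (Fin d) →L[ℝ] ℝ :=
  mvfderiv (𝓡 d) f x

lemma diffl_eq_mfderiv (f : M → ℝ) (x : M) :
    diffl (d := d) f x = (mfderiv (𝓡 d) 𝓘(ℝ, ℝ) f x : EuclideanSpace ℝ (Fin d) →L[ℝ] ℝ) := by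
  ext v
  rfl

namespace IsParam

variable {c : W → M} {a : M → W} {w₀ : W} {p : M}

lemma mdifferentiableAt (h : IsParam (d := d) c a w₀ p) :
    MDifferentiableAt 𝓘(ℝ, W) (𝓡 d) c w₀ :=
  h.smooth.self_of_nhds.mdifferentiableAt (by simp)

lemma mdifferentiableAt_inv (h : IsParam (d := d) c a w₀ p) :
    MDifferentiableAt (𝓡 d) 𝓘(ℝ, W) a p :=
  h.smooth_inv.self_of_nhds.mdifferentiableAt (by simp)

lemma fderiv_comp (h : IsParam (d := d) c a w₀ p) {f : M → ℝ}
    (hf : MDifferentiableAt (𝓡 d) 𝓘(ℝ, ℝ) f p) :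
    fderiv ℝ (fun w => f (c w)) w₀ = (diffl (d := d) f p).comp (frame (d := d) c w₀) := by
  have hp := h.map_eq
  subst hp
  have h1 := mfderiv_comp w₀ hf h.mdifferentiableAt
  rw [mfderiv_eq_fderiv] at h1
  rw [diffl_eq_mfderiv]
  exact h1

lemma diffl_comp_inv (h : IsParam (d := d) c a w₀ p) {f : W → ℝ} (hf : DifferentiableAt ℝ f w₀) :
    diffl (d := d) (fun x => f (a x)) p = (fderiv ℝ f w₀).comp (coframe (d := d) a p) := by
  have hp := h.inv_eq
  subst hp
  have h1 := mfderiv_comp p hf.mdifferentiableAt h.mdifferentiableAt_inv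
  rw [mfderiv_eq_fderiv] at h1
  rw [diffl_eq_mfderiv]
  exact h1

lemma coframe_frame (h : IsParam (d := d) c a w₀ p) (v : W) : coframe (d := d) a p (frame (d := d) c w₀ v) = v := by
  have hp := h.map_eq
  subst hp
  have h1 := mfderiv_comp w₀ h.mdifferentiableAt_inv h.mdifferentiableAt
  have h2 : a ∘ c =ᶠ[𝓝 w₀] id := h.left_inv
  rw [h2.mfderiv_eq, mfderiv_id] at h1
  exact (congrArg (fun L : W →L[ℝ] W => L v) h1).symm

lemma frame_coframe (h : IsParam (d := d) c a w₀ p) (v : EuclideanSpace ℝ (Fin d)) :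
    frame (d := d) c w₀ (coframe (d := d) a p v) = v := by
  have hp := h.inv_eq
  subst hp
  have h1 := mfderiv_comp p h.mdifferentiableAt h.mdifferentiableAt_inv
  have h2 : c ∘ a =ᶠ[𝓝 p] id := h.right_inv
  rw [h2.mfderiv_eq, mfderiv_id] at h1
  exact (congrArg (fun L : EuclideanSpace ℝ (Fin d) →L[ℝ] EuclideanSpace ℝ (Fin d) => L v) h1).symm

/-- The derivative of a parametrization is an isomorphism. -/
noncomputable def frameEquiv (h : IsParam (d := d) c a w₀ p) :
    W ≃L[ℝ] EuclideanSpace ℝ (Fin d) :=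
  ContinuousLinearEquiv.equivOfInverse (frame (d := d) c w₀) (coframe (d := d) a p) h.coframe_frame h.frame_coframe

lemma contDiffAt_comp (h : IsParam (d := d) c a w₀ p) {f : M → ℝ}
    (hf : ContMDiffAt (𝓡 d) 𝓘(ℝ, ℝ) ∞ f p) : ContDiffAt ℝ ∞ (fun w => f (c w)) w₀ := by
  have hp := h.map_eq
  subst hp
  exact (ContMDiffAt.comp w₀ hf h.smooth.self_of_nhds).contDiffAt

lemma contMDiffAt_comp_inv (h : IsParam (d := d) c a w₀ p) {f : W → ℝ}
    (hf : ContDiffAt ℝ ∞ f w₀) : ContMDiffAt (𝓡 d) 𝓘(ℝ, ℝ) ∞ (fun x => f (a x)) p := by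
  have hp := h.inv_eq
  subst hp
  exact ContMDiffAt.comp p hf.contMDiffAt h.smooth_inv.self_of_nhds

lemma smoothNear_comp (h : IsParam (d := d) c a w₀ p) {f : M → ℝ}
    (hf : ContMDiff (𝓡 d) 𝓘(ℝ, ℝ) ∞ f) : SmoothNear (fun w => f (c w)) w₀ := by
  filter_upwards [h.eventually] with w hw
  exact hw.contDiffAt_comp hf.contMDiffAt

end IsParam

end Frames

/-! ### Coordinates adapted to the two branches -/

section AdaptedParam

variable {F : Type*} [NormedAddCommGroup F] [NormedSpace ℝ F]

/-- A hypersurface transverse to the first coordinate is the graph of a smooth function. -/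
lemma exists_graph [CompleteSpace F] {c : ℝ × F → M} {a : M → ℝ × F} {p : M} {N : Set M}
    (h : IsParam (d := d) c a 0 p) (hN : IsHypersurface (d := d) N) {f : M → ℝ}
    (hf : ContMDiffAt (𝓡 d) 𝓘(ℝ, ℝ) ∞ f p) (hfN : ∀ᶠ x in 𝓝 p, x ∈ N ↔ f x = 0) (hp : p ∈ N)
    (hd : fderiv ℝ (fun w => f (c w)) 0 (1, 0) ≠ 0) :
    ∃ γ : F → ℝ, SmoothNear γ 0 ∧ γ 0 = 0 ∧ ∀ᶠ z in 𝓝 0, c z ∈ N ↔ γ z.2 = z.1 := by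
  -- the graph near a point of the hypersurface
  have graph : ∀ (z : ℝ × F) (q : M) (f : M → ℝ), IsParam (d := d) c a z q → q ∈ N →
      ContMDiffAt (𝓡 d) 𝓘(ℝ, ℝ) ∞ f q → (∀ᶠ x in 𝓝 q, x ∈ N ↔ f x = 0) →
      fderiv ℝ (fun w => f (c w)) z (1, 0) ≠ 0 →
      ∃ γ : F → ℝ, ContDiffAt ℝ ∞ γ z.2 ∧ γ z.2 = z.1 ∧ ∀ᶠ w in 𝓝 z, c w ∈ N ↔ γ w.2 = w.1 := by
    intro z q f h hq hf hfN hd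
    let sw : F × ℝ →L[ℝ] ℝ × F := (ContinuousLinearMap.snd ℝ F ℝ).prod (.fst ℝ F ℝ)
    let H : F × ℝ → ℝ := fun v => f (c (sw v))
    have hcf := h.contDiffAt_comp hf
    have hH : ContDiffAt ℝ ∞ H (z.2, z.1) :=
      ContDiffAt.comp (g := fun w => f (c w)) (f := sw) (z.2, z.1) hcf sw.contDiff.contDiffAt
    have hHd : ∀ t : ℝ, fderiv ℝ H (z.2, z.1) (0, t) =
        t * fderiv ℝ (fun w => f (c w)) z (1, 0) := by
      intro t
      have h1 : HasFDerivAt H _ (z.2, z.1) :=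
        (show HasFDerivAt (fun w => f (c w)) _ (sw (z.2, z.1)) from
          (differentiableAt_of_contDiffAt hcf).hasFDerivAt).comp (z.2, z.1) sw.hasFDerivAt
      rw [h1.fderiv]
      have h2 : sw (0, t) = t • ((1 : ℝ), (0 : F)) := by simp [sw]
      rw [ContinuousLinearMap.comp_apply, h2, map_smul, smul_eq_mul]
    have hinv : (fderiv ℝ H (z.2, z.1) ∘L .inr ℝ F ℝ).IsInvertible := by
      refine ⟨ContinuousLinearEquiv.unitsEquivAut ℝ (Units.mk0 _ hd), ?_⟩
      ext
      simp [hHd]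
    have hinf : (∞ : WithTop ℕ∞) ≠ 0 := by simp
    have hiff := hH.eventually_apply_eq_iff_implicitFunction hinf hinv
    have h0 : H (z.2, z.1) = 0 := by
      have h3 := hfN.self_of_nhds.1 hq
      change f (c z) = 0
      rwa [h.map_eq]
    rw [h0] at hiff
    refine ⟨hH.implicitFunction hinf hinv, hH.contDiffAt_implicitFunction hinf hinv,
      hH.implicitFunction_apply_self hinf hinv, ?_⟩
    have hswap : Tendsto (fun w : ℝ × F => (w.2, w.1)) (𝓝 z) (𝓝 (z.2, z.1)) :=
      continuous_swap.tendsto z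
    filter_upwards [hswap.eventually hiff, h.tendsto.eventually hfN] with w h1 h2
    rw [h2]
    exact h1
  obtain ⟨γ, hγ, hγ0, hγN⟩ := graph 0 p f h hp hf hfN hd
  simp only [Prod.snd_zero, Prod.fst_zero] at hγ hγ0
  have hlift : Tendsto (fun r : F => (γ r, r)) (𝓝 0) (𝓝 0) := by
    have := (hγ.continuousAt.prodMk continuousAt_id).tendsto
    simp only [hγ0, id_eq] at this
    exact this
  have hγd : ∀ᶠ r in 𝓝 (0 : F), DifferentiableAt ℝ γ r := by
    filter_upwards [(hγ.of_le (m := 1) (by simp)).eventually (by simp)] with r hr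
    exact hr.differentiableAt (by simp)
  refine ⟨γ, ?_, hγ0, hγN⟩
  filter_upwards [hlift.eventually h.eventually, hlift.eventually hγN.eventually_nhds,
    hγd] with r h1 h2 h3
  have hrN : c (γ r, r) ∈ N := h2.self_of_nhds.2 rfl
  -- The defining function `f` is known to be smooth only at p. At another point of the graph a
  -- defining function for that point is used: its derivative across the graph is nonzero, since its
  -- differential would otherwise vanish, and its own graph function agrees with γ nearby.
  obtain ⟨f', hf', hdf', hfN'⟩ := hN _ hrN
  have hcf := differentiableAt_of_contDiffAt (h1.contDiffAt_comp hf')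
  have hdne : fderiv ℝ (fun w => f' (c w)) (γ r, r) (1, 0) ≠ 0 := by
    intro h10
    have hcurve : HasFDerivAt (fun r' : F => (γ r', r'))
        ((fderiv ℝ γ r).prod (.id ℝ F)) r := h3.hasFDerivAt.prodMk (hasFDerivAt_id r)
    have hcomp := HasFDerivAt.comp (g := fun w => f' (c w)) (f := fun r' : F => (γ r', r'))
      r hcf.hasFDerivAt hcurve
    have hlr : Tendsto (fun r' : F => (γ r', r')) (𝓝 r) (𝓝 (γ r, r)) :=
      (h3.continuousAt.prodMk continuousAt_id).tendsto
    have hzero : (fun w => f' (c w)) ∘ (fun r' : F => (γ r', r')) =ᶠ[𝓝 r] fun _ => 0 := by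
      filter_upwards [hlr.eventually h2, hlr.eventually (h1.tendsto.eventually hfN')] with r' h4 h5
      exact h5.1 (h4.2 rfl)
    have h6 := hcomp.unique ((hasFDerivAt_const (0 : ℝ) r).congr_of_eventuallyEq hzero)
    apply hdf'
    have h7 : fderiv ℝ (fun w => f' (c w)) (γ r, r) = 0 := by
      have h8 : ∀ t : ℝ, fderiv ℝ (fun w => f' (c w)) (γ r, r) (t, 0) = 0 := by
        intro t
        have : ((t, 0) : ℝ × F) = t • (1, 0) := by simp
        rw [this, map_smul, h10, smul_zero]
      ext v
      · simpa using h8 1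
      · have h9 := congrArg (fun L : F →L[ℝ] ℝ => L v) h6
        have h11 : (((fderiv ℝ γ r).prod (.id ℝ F)) v : ℝ × F) = (fderiv ℝ γ r v, 0) + (0, v) := by
          simp
        rw [ContinuousLinearMap.comp_apply, h11, map_add, h8, zero_add] at h9
        exact h9
    have h12 := h1.fderiv_comp (hf'.mdifferentiableAt (by simp))
    rw [h7] at h12
    have h13 : diffl (d := d) f' (c (γ r, r)) = 0 := by
      ext v
      rw [← h1.frame_coframe v]
      exact (congrArg (fun L : ℝ × F →L[ℝ] ℝ => L (coframe (d := d) a (c (γ r, r)) v)) h12).symm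
    exact h13
  obtain ⟨γ', hγ', hγ'0, hγ'N⟩ := graph _ _ f' h1 hrN hf' hfN' hdne
  refine hγ'.congr_of_eventuallyEq ?_
  simp only at hγ' hγ'0 hγ'N
  have hl' : Tendsto (fun r' : F => (γ' r', r')) (𝓝 r) (𝓝 (γ r, r)) := by
    have := (hγ'.continuousAt.prodMk continuousAt_id).tendsto
    simp only [hγ'0, id_eq] at this
    exact this
  filter_upwards [hl'.eventually h2, hl'.eventually hγ'N] with r' h4 h5
  exact h4.1 (h5.2 rfl)

variable [IsManifold (𝓡 d) ∞ M]

/-- Coordinates adapted to a pair of transverse hypersurfaces, one of them given as a level set. -/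
lemma exists_adaptedParam {Ω : M → ℝ} (hΩ : ContMDiff (𝓡 d) 𝓘(ℝ, ℝ) ∞ Ω) {N : Set M}
    (hN : IsHypersurface (d := d) N) {p : M} (hp : p ∈ scri Ω ∩ N)
    (hreg : mvfderiv (𝓡 d) Ω p ≠ 0) (htr : tangentSub d (scri Ω) p ⊔ tangentSub d N p = ⊤) :
    ∃ (F : Submodule ℝ (EuclideanSpace ℝ (Fin d))) (c : ℝ × ℝ × F → M) (a : M → ℝ × ℝ × F),
      IsParam (d := d) c a 0 p ∧ (∀ᶠ z in 𝓝 0, Ω (c z) = z.2.1) ∧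
        ∀ᶠ z in 𝓝 0, c z ∈ N ↔ z.1 = 0 := by
  obtain ⟨f, hf, hdf, hfN⟩ := hN p hp.2
  set e := extChartAt (𝓡 d) p with he
  have h₀ : IsParam (d := d) e.symm e (e p) p := isParam_extChartAt p
  set lam : EuclideanSpace ℝ (Fin d) →L[ℝ] ℝ := (diffl (d := d) f p).comp (frame (d := d) e.symm (e p)) with hlam
  set mu : EuclideanSpace ℝ (Fin d) →L[ℝ] ℝ := (diffl (d := d) Ω p).comp (frame (d := d) e.symm (e p)) with hmu
  have hΩp : MDifferentiableAt (𝓡 d) 𝓘(ℝ, ℝ) Ω p := hΩ.contMDiffAt.mdifferentiableAt (by simp)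
  have hlam' : fderiv ℝ (fun w => f (e.symm w)) (e p) = lam :=
    h₀.fderiv_comp (hf.mdifferentiableAt (by simp))
  have hmu' : fderiv ℝ (fun w => Ω (e.symm w)) (e p) = mu := h₀.fderiv_comp hΩp
  have hNker : ∀ v ∈ tangentSub d N p, diffl (d := d) f p v = 0 := fun v hv =>
    hv f hf (by
      filter_upwards [self_mem_nhdsWithin, nhdsWithin_le_nhds hfN] with x h1 h2
      exact h2.1 h1)
  have hJker : ∀ v ∈ tangentSub d (scri Ω) p, diffl (d := d) Ω p v = 0 := fun v hv =>
    hv Ω hΩ.contMDiffAt (by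
      filter_upwards [self_mem_nhdsWithin] with x h1
      exact h1)
  have hsplit : ∀ v : EuclideanSpace ℝ (Fin d), ∃ v₁ v₂ : EuclideanSpace ℝ (Fin d),
      v₁ + v₂ = v ∧ diffl (d := d) Ω p v₁ = 0 ∧ diffl (d := d) f p v₂ = 0 := by
    intro v
    have hv : (v : TangentSpace (𝓡 d) p) ∈ tangentSub d (scri Ω) p ⊔ tangentSub d N p := by
      rw [htr]; trivial
    obtain ⟨v₁, h1, v₂, h2, h3⟩ := (Submodule.mem_sup (M := TangentSpace (𝓡 d) p)).1 hv
    exact ⟨v₁, v₂, h3, hJker _ h1, hNker _ h2⟩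
  have hex : ∀ L : EuclideanSpace ℝ (Fin d) →L[ℝ] ℝ, L ≠ 0 → ∃ v, L v = 1 := by
    intro L hL
    obtain ⟨v, hv⟩ : ∃ v, L v ≠ 0 := by
      by_contra! h
      exact hL (ContinuousLinearMap.ext h)
    exact ⟨(L v)⁻¹ • v, by simp [hv]⟩
  -- Transversality splits any vector into parts killed by dΩ and by df; this yields vectors dual to
  -- the pair (df, dΩ).
  obtain ⟨e₁, he₁l, he₁m⟩ : ∃ v, lam v = 1 ∧ mu v = 0 := by
    obtain ⟨v, hv⟩ := hex (diffl (d := d) f p) hdf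
    obtain ⟨v₁, v₂, h1, h2, h3⟩ := hsplit v
    refine ⟨coframe (d := d) e p v₁, ?_, ?_⟩
    · rw [hlam, ContinuousLinearMap.comp_apply, h₀.frame_coframe, ← hv, ← h1, map_add, h3, add_zero]
    · rw [hmu, ContinuousLinearMap.comp_apply, h₀.frame_coframe, h2]
  obtain ⟨e₂, he₂l, he₂m⟩ : ∃ v, lam v = 0 ∧ mu v = 1 := by
    obtain ⟨v, hv⟩ := hex (diffl (d := d) Ω p) hreg
    obtain ⟨v₁, v₂, h1, h2, h3⟩ := hsplit v
    refine ⟨coframe (d := d) e p v₂, ?_, ?_⟩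
    · rw [hlam, ContinuousLinearMap.comp_apply, h₀.frame_coframe, h3]
    · rw [hmu, ContinuousLinearMap.comp_apply, h₀.frame_coframe, ← hv, ← h1, map_add, h2, zero_add]
  let F : Submodule ℝ (EuclideanSpace ℝ (Fin d)) := LinearMap.ker lam.toLinearMap ⊓ LinearMap.ker mu.toLinearMap
  let pr₀ : EuclideanSpace ℝ (Fin d) →L[ℝ] EuclideanSpace ℝ (Fin d) :=
    .id ℝ _ - lam.smulRight e₁ - mu.smulRight e₂
  have hpr₀ : ∀ v, pr₀ v = v - lam v • e₁ - mu v • e₂ := fun v => rfl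
  let pr : EuclideanSpace ℝ (Fin d) →L[ℝ] F := pr₀.codRestrict F (fun v => by
    refine ⟨?_, ?_⟩ <;> simp [hpr₀, he₁l, he₁m, he₂l, he₂m])
  have hpr : ∀ v, (pr v : EuclideanSpace ℝ (Fin d)) = v - lam v • e₁ - mu v • e₂ := fun v => rfl
  -- Ω itself is a coordinate, but `f` enters only through its differential at p, since it need not
  -- be smooth on a neighbourhood. The second hypersurface is straightened afterwards.
  let Ψ : EuclideanSpace ℝ (Fin d) → ℝ × ℝ × F := fun v =>
    (lam (v - e p), Ω (e.symm v), pr (v - e p))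
  have hsub : SmoothNear (fun v : EuclideanSpace ℝ (Fin d) => v - e p) (e p) :=
    smoothNear_of_contDiff (contDiff_id.sub contDiff_const) _
  have hΩe : SmoothNear (fun v => Ω (e.symm v)) (e p) := h₀.smoothNear_comp hΩ
  have hΨ : SmoothNear Ψ (e p) :=
    ((smoothNear_clm lam _).comp hsub).prodMk (hΩe.prodMk ((smoothNear_clm pr _).comp hsub))
  have hΨ0 : Ψ (e p) = 0 := by
    have h1 : Ω (e.symm (e p)) = 0 := by
      rw [he, extChartAt_to_inv]; exact hp.1
    simp only [Ψ, sub_self, map_zero, h1]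
    rfl
  have hΨd : HasFDerivAt Ψ (lam.prod (mu.prod pr)) (e p) := by
    have h1 : HasFDerivAt (fun v : EuclideanSpace ℝ (Fin d) => v - e p) (.id ℝ _) (e p) :=
      (hasFDerivAt_id _).sub_const _
    have h2 : HasFDerivAt (fun v => Ω (e.symm v)) mu (e p) := by
      rw [← hmu']
      exact hΩe.differentiableAt.hasFDerivAt
    exact (lam.hasFDerivAt.comp (e p) h1).prodMk (h2.prodMk (pr.hasFDerivAt.comp (e p) h1))
  have hFker : ∀ s : F, lam s = 0 ∧ mu s = 0 := fun s => ⟨s.2.1, s.2.2⟩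
  have hi : (fderiv ℝ Ψ (e p)).IsInvertible := by
    rw [hΨd.fderiv]
    let inv : ℝ × ℝ × F →L[ℝ] EuclideanSpace ℝ (Fin d) :=
      (ContinuousLinearMap.fst ℝ ℝ (ℝ × F)).smulRight e₁ +
        ((ContinuousLinearMap.fst ℝ ℝ F).comp (.snd ℝ ℝ (ℝ × F))).smulRight e₂ +
        F.subtypeL.comp ((ContinuousLinearMap.snd ℝ ℝ F).comp (.snd ℝ ℝ (ℝ × F)))
    have hinv : ∀ z, inv z = z.1 • e₁ + z.2.1 • e₂ + (z.2.2 : EuclideanSpace ℝ (Fin d)) :=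
      fun z => rfl
    refine ⟨ContinuousLinearEquiv.equivOfInverse (lam.prod (mu.prod pr)) inv ?_ ?_, rfl⟩
    · intro v
      rw [hinv]
      simp only [ContinuousLinearMap.prod_apply, hpr]
      abel
    · intro z
      have h1 : lam (inv z) = z.1 := by
        simp [hinv, he₁l, he₂l, (hFker z.2.2).1]
      have h2 : mu (inv z) = z.2.1 := by
        simp [hinv, he₁m, he₂m, (hFker z.2.2).2]
      refine Prod.ext h1 (Prod.ext h2 (Subtype.ext ?_))
      simp only [ContinuousLinearMap.prod_apply, hpr, h1, h2]
      rw [hinv]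
      abel
  obtain ⟨U, hU, hU0, hUr, hUl, h₁⟩ := h₀.exists_comp_symm hΨ hi
  rw [hΨ0] at hU hU0 hUr h₁
  have hdU : fderiv ℝ (fun w => f (e.symm (U w))) 0 (1, 0) ≠ 0 := by
    have hUd := hU.differentiableAt.hasFDerivAt
    have hce : DifferentiableAt ℝ (fun w => f (e.symm w)) (e p) :=
      differentiableAt_of_contDiffAt (h₀.contDiffAt_comp hf)
    have h2 : HasFDerivAt (fun w => f (e.symm (U w))) (lam.comp (fderiv ℝ U 0)) 0 := by
      have h3 : HasFDerivAt (fun w => f (e.symm w)) lam (U 0) := by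
        rw [hU0, ← hlam']
        exact hce.hasFDerivAt
      exact h3.comp 0 hUd
    have h4 : (lam.prod (mu.prod pr)).comp (fderiv ℝ U 0) = .id ℝ _ := by
      have h5 : HasFDerivAt Ψ (lam.prod (mu.prod pr)) (U 0) := by rw [hU0]; exact hΨd
      have h6 := h5.comp 0 hUd
      exact h6.unique ((hasFDerivAt_id _).congr_of_eventuallyEq hUr)
    have h7 := congrArg (fun L : ℝ × ℝ × F →L[ℝ] ℝ × ℝ × F => (L (1, 0)).1) h4
    rw [h2.fderiv]
    have h8 : lam (fderiv ℝ U 0 (1, 0)) = 1 := h7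
    rw [ContinuousLinearMap.comp_apply, h8]
    exact one_ne_zero
  obtain ⟨γ, hγ, hγ0, hγN⟩ := exists_graph (F := ℝ × F) h₁ hN hf hfN hp.2 hdU
  have hγ2 : SmoothNear (fun z : ℝ × ℝ × F => γ z.2) 0 :=
    hγ.comp_of_eq (smoothNear_of_contDiff contDiff_snd _) rfl
  have hfst : SmoothNear (fun z : ℝ × ℝ × F => z.1) 0 := smoothNear_of_contDiff contDiff_fst _
  have hsnd : SmoothNear (fun z : ℝ × ℝ × F => z.2) 0 := smoothNear_of_contDiff contDiff_snd _
  -- A shear in x moves the graph x = γ(y, s) to x = 0 and leaves y = Ω unchanged.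
  let sh : ℝ × ℝ × F → ℝ × ℝ × F := fun z => (z.1 + γ z.2, z.2)
  have hsh : SmoothNear sh 0 := (hfst.add hγ2).prodMk hsnd
  have hsh0 : sh 0 = 0 := by simp [sh, hγ0]
  have hsht : Tendsto sh (𝓝 0) (𝓝 0) := by
    have := hsh.continuousAt
    rwa [ContinuousAt, hsh0] at this
  have h₂ := h₁.comp (c' := sh) (a' := fun z => (z.1 - γ z.2, z.2)) (w₀' := 0) hsh
    ((hfst.sub hγ2).prodMk hsnd) hsh0
    (Eventually.of_forall fun z => by simp [sh]) (Eventually.of_forall fun z => by simp [sh])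
  refine ⟨F, _, _, h₂, ?_, ?_⟩
  · filter_upwards [hsht.eventually hUr] with z hz
    have h3 : Ω (e.symm (U (sh z))) = (sh z).2.1 := congrArg (fun z => z.2.1) hz
    exact h3
  · filter_upwards [hsht.eventually hγN] with z hz
    rw [hz]
    simp only [sh]
    constructor <;> intro h <;> linarith

end AdaptedParam

end ConformalGauge

namespace ConformalGauge

variable {d : ℕ} {M : Type*} [TopologicalSpace M]
  [ChartedSpace (EuclideanSpace ℝ (Fin d)) M] [IsManifold (𝓡 d) ∞ M]

/-! ### Vector fields, metrics and Lie derivatives in coordinates -/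

section Fields

variable {W : Type*} [NormedAddCommGroup W] [NormedSpace ℝ W]

lemma contDiffAt_clm_of_apply {D E G : Type*} [NormedAddCommGroup D] [NormedSpace ℝ D]
    [NormedAddCommGroup E] [NormedSpace ℝ E] [FiniteDimensional ℝ E] [NormedAddCommGroup G]
    [NormedSpace ℝ G] {f : D → E →L[ℝ] G} {z : D} (h : ∀ v, ContDiffAt ℝ ∞ (fun w => f w v) z) :
    ContDiffAt ℝ ∞ f z := by
  have hd : Module.finrank ℝ E = Module.finrank ℝ (Fin (Module.finrank ℝ E) → ℝ) :=
    (Module.finrank_fin_fun ℝ).symm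
  let e₁ := ContinuousLinearEquiv.ofFinrankEq hd
  let e₂ := (e₁.arrowCongr (1 : G ≃L[ℝ] G)).trans
    (ContinuousLinearEquiv.piRing (Fin (Module.finrank ℝ E)))
  rw [← Function.id_comp f, ← e₂.symm_comp_self]
  exact e₂.symm.contDiff.contDiffAt.comp z (contDiffAt_pi.mpr fun i => h _)

lemma mlieBracket_vectorSpace (V X : ∀ w : W, TangentSpace 𝓘(ℝ, W) w) (w : W) :
    VectorField.mlieBracket 𝓘(ℝ, W) V X w = VectorField.lieBracket ℝ (V : W → W) (X : W → W) w := by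
  rw [← VectorField.mlieBracketWithin_univ, VectorField.mlieBracketWithin_eq_lieBracketWithin]
  exact congrFun VectorField.lieBracketWithin_univ w

/-- The field of vectors with constant components `v` in the given coordinates. -/
noncomputable def constField (a : M → W) (v : W) : VField d M :=
  VectorField.mpullback (𝓡 d) 𝓘(ℝ, W) a (fun _ => v)

/-- The components of a vector field in the given parametrization. -/
noncomputable def pullField (c : W → M) (η : VField d M) (w : W) : W :=
  VectorField.mpullback 𝓘(ℝ, W) (𝓡 d) c η w

/-- The components of a metric in the given parametrization. -/
noncomputable def pullForm (c : W → M) (g : FormField d M) (w : W) : W →L[ℝ] W →L[ℝ] ℝ :=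
  ContinuousLinearMap.bilinearComp
    (g (c w) : EuclideanSpace ℝ (Fin d) →L[ℝ] EuclideanSpace ℝ (Fin d) →L[ℝ] ℝ)
    (frame (d := d) c w) (frame (d := d) c w)

/-- The value of a smooth metric on two smooth vector fields. -/
lemma IsSemiRiemannianMetric.contMDiffAt_apply {g : FormField d M} (hg : IsSemiRiemannianMetric g)
    {X Y : VField d M} {x : M} (hX : X.SmoothAt x) (hY : Y.SmoothAt x) :
    ContMDiffAt (𝓡 d) 𝓘(ℝ, ℝ) ∞ (fun y => g y (X y) (Y y)) x := by
  have h1 := ContMDiffAt.clm_bundle_apply₂ (F₁ := EuclideanSpace ℝ (Fin d))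
    (F₂ := EuclideanSpace ℝ (Fin d)) (F₃ := ℝ) (E₃ := Bundle.Trivial M ℝ)
    (b := fun m : M => m) (hg.smooth x) hX hY
  rw [Bundle.contMDiffAt_totalSpace] at h1
  exact h1.2

namespace IsParam

variable {c : W → M} {a : M → W} {w₀ : W} {p : M}

omit [IsManifold (𝓡 d) ∞ M] in
lemma isInvertible_mfderiv_inv (h : IsParam (d := d) c a w₀ p) :
    (mfderiv (𝓡 d) 𝓘(ℝ, W) a p).IsInvertible := ⟨h.frameEquiv.symm, rfl⟩

omit [IsManifold (𝓡 d) ∞ M] in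
lemma isInvertible_mfderiv (h : IsParam (d := d) c a w₀ p) :
    (mfderiv 𝓘(ℝ, W) (𝓡 d) c w₀).IsInvertible := ⟨h.frameEquiv, rfl⟩

omit [IsManifold (𝓡 d) ∞ M] in
lemma constField_apply (h : IsParam (d := d) c a w₀ p) (v : W) :
    constField (d := d) a v p = frame (d := d) c w₀ v := by
  have h1 : (mfderiv (𝓡 d) 𝓘(ℝ, W) a p).inverse =
      (h.frameEquiv : W →L[ℝ] EuclideanSpace ℝ (Fin d)) :=
    ContinuousLinearMap.inverse_equiv h.frameEquiv.symm
  exact congrArg (fun L : W →L[ℝ] EuclideanSpace ℝ (Fin d) => L v) h1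

omit [IsManifold (𝓡 d) ∞ M] in
lemma pullField_apply (h : IsParam (d := d) c a w₀ p) (η : VField d M) :
    pullField c η w₀ = coframe (d := d) a p (η p) := by
  have h1 : (mfderiv 𝓘(ℝ, W) (𝓡 d) c w₀).inverse =
      (h.frameEquiv.symm : EuclideanSpace ℝ (Fin d) →L[ℝ] W) :=
    ContinuousLinearMap.inverse_equiv h.frameEquiv
  have hp := h.map_eq
  subst hp
  exact congrArg (fun L : EuclideanSpace ℝ (Fin d) →L[ℝ] W => L (η (c w₀))) h1

omit [IsManifold (𝓡 d) ∞ M] in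
lemma frame_pullField (h : IsParam (d := d) c a w₀ p) (η : VField d M) :
    frame (d := d) c w₀ (pullField c η w₀) = η p := by
  rw [h.pullField_apply]
  exact h.frame_coframe (η p)

variable [CompleteSpace W]

omit [CompleteSpace W] in
lemma smoothAt_constField (h : IsParam (d := d) c a w₀ p) (v : W) :
    (constField (d := d) a v).SmoothAt p := by
  have hp := h.inv_eq
  subst hp
  exact ContMDiffAt.mpullback_vectorField_preimage (n := ∞) (m := ∞)
    (contMDiffAt_vectorSpace_iff_contDiffAt.2 contDiffAt_const) h.smooth_inv.self_of_nhds
    h.isInvertible_mfderiv_inv le_rfl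

lemma contDiffAt_pullField (h : IsParam (d := d) c a w₀ p) {η : VField d M}
    (hη : η.SmoothAt p) : ContDiffAt ℝ ∞ (pullField c η) w₀ := by
  have hp := h.map_eq
  subst hp
  exact contMDiffAt_vectorSpace_iff_contDiffAt.1
    (ContMDiffAt.mpullback_vectorField_preimage (n := ∞) (m := ∞) hη h.smooth.self_of_nhds
      h.isInvertible_mfderiv le_rfl)

omit [CompleteSpace W] [IsManifold (𝓡 d) ∞ M] in
lemma pullForm_eventuallyEq (h : IsParam (d := d) c a w₀ p) (g : FormField d M) (v v' : W) :
    (fun w => pullForm c g w v v') =ᶠ[𝓝 w₀]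
      fun w => g (c w) (constField (d := d) a v (c w)) (constField (d := d) a v' (c w)) := by
  filter_upwards [h.eventually] with w hw
  rw [hw.constField_apply, hw.constField_apply]
  rfl

omit [CompleteSpace W] in
lemma contDiffAt_pullForm [FiniteDimensional ℝ W] (h : IsParam (d := d) c a w₀ p)
    {g : FormField d M} (hg : IsSemiRiemannianMetric g) : ContDiffAt ℝ ∞ (pullForm c g) w₀ := by
  refine contDiffAt_clm_of_apply fun v => contDiffAt_clm_of_apply fun v' => ?_
  exact (h.contDiffAt_comp (hg.contMDiffAt_apply (h.smoothAt_constField v)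
    (h.smoothAt_constField v'))).congr_of_eventuallyEq (h.pullForm_eventuallyEq g v v')

/-- By naturality of the bracket under pullback this is the flat formula [η, v] = -∂ᵥη for constant
v. Testing the Lie derivative on such fields gives its coordinate expression. -/
lemma mlieBracket_constField (h : IsParam (d := d) c a w₀ p) {η : VField d M}
    (hη : η.SmoothAt p) (v : W) :
    (VectorField.mlieBracket (𝓡 d) η (constField (d := d) a v) p : EuclideanSpace ℝ (Fin d)) =
      -frame (d := d) c w₀ (_root_.fderiv ℝ (pullField c η) w₀ v) := by
  have hp := h.map_eq
  subst hp
  have : IsManifold (𝓡 d) (minSmoothness ℝ 3) M :=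
    IsManifold.of_le (n := ∞) (by
      rw [minSmoothness_of_isRCLikeNormedField]; exact ENat.LEInfty.out)
  have h1 := VectorField.mpullback_mlieBracket (I := 𝓘(ℝ, W)) (I' := 𝓡 d) (n := ∞) (f := c)
    (x₀ := w₀) (hη.mdifferentiableAt (by simp))
    ((h.smoothAt_constField v).mdifferentiableAt (by simp)) h.smooth.self_of_nhds
    (by rw [minSmoothness_of_isRCLikeNormedField]; exact ENat.LEInfty.out)
  have h2 : VectorField.mpullback 𝓘(ℝ, W) (𝓡 d) c (constField (d := d) a v) =ᶠ[𝓝 w₀]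
      fun _ => v := by
    filter_upwards [h.eventually] with w hw
    have h3 := hw.pullField_apply (constField (d := d) a v)
    rw [hw.constField_apply, hw.coframe_frame] at h3
    exact h3
  have h5 : VectorField.mlieBracket 𝓘(ℝ, W) (VectorField.mpullback 𝓘(ℝ, W) (𝓡 d) c η)
      (fun _ => v) w₀ = VectorField.lieBracket ℝ (pullField c η) (fun _ => v) w₀ :=
    mlieBracket_vectorSpace _ _ _
  rw [EventuallyEq.rfl.mlieBracket_vectorField_eq h2] at h1
  replace h1 := h1.trans h5
  have h4 := h.frame_pullField (VectorField.mlieBracket (𝓡 d) η (constField (d := d) a v))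
  rw [← h4, ← map_neg]
  congr 1
  refine h1.trans ?_
  simp only [VectorField.lieBracket, fderiv_fun_const, Pi.zero_apply, zero_apply,
    zero_sub]
  rfl

/-- The conformal Killing equation in coordinates. -/
lemma lie_eq_pullForm [FiniteDimensional ℝ W] (h : IsParam (d := d) c a w₀ p) {g : FormField d M}
    (hg : IsSemiRiemannianMetric g) {η : VField d M} {ψ : M → ℝ} (hη : IsConformalKilling g η ψ)
    (v v' : W) :
    _root_.fderiv ℝ (pullForm c g) w₀ (pullField c η w₀) v v' +
      pullForm c g w₀ (_root_.fderiv ℝ (pullField c η) w₀ v) v' +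
      pullForm c g w₀ v (_root_.fderiv ℝ (pullField c η) w₀ v') =
      2 * ψ p * pullForm c g w₀ v v' := by
  have h1 := hη.lie_eq p _ _ (h.smoothAt_constField v) (h.smoothAt_constField v')
  have hp := h.map_eq
  subst hp
  have hs := differentiableAt_of_contDiffAt (h.contDiffAt_pullForm hg)
  have h2 : _root_.fderiv ℝ (fun w => pullForm c g w v v') w₀ (pullField c η w₀) =
      _root_.fderiv ℝ (pullForm c g) w₀ (pullField c η w₀) v v' := by
    have h3 : HasFDerivAt (fun w => pullForm c g w v v') _ w₀ :=
      (hs.hasFDerivAt.clm_apply (hasFDerivAt_const v w₀)).clm_apply (hasFDerivAt_const v' w₀)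
    rw [h3.fderiv]
    simp
  have h4 := h.fderiv_comp ((hg.contMDiffAt_apply (h.smoothAt_constField v)
    (h.smoothAt_constField v')).mdifferentiableAt (by simp))
  have h5 := congrArg (fun L : W →L[ℝ] ℝ => L (pullField c η w₀)) h4
  simp only [ContinuousLinearMap.comp_apply, h.frame_pullField] at h5
  rw [← (h.pullForm_eventuallyEq g v v').fderiv_eq, h2] at h5
  have e1 := h.mlieBracket_constField (hη.smooth_field _) v
  have e2 := h.mlieBracket_constField (hη.smooth_field _) v'
  have e3 := h.constField_apply v
  have e4 := h.constField_apply v'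
  rw [lieDerivForm, e1, e2, e3, e4] at h1
  have key : ∀ (G : EuclideanSpace ℝ (Fin d) →L[ℝ] EuclideanSpace ℝ (Fin d) →L[ℝ] ℝ)
      (u u' A B : EuclideanSpace ℝ (Fin d)) (r t : ℝ),
      r - G (-A) u' - G u (-B) = (t • G) u u' → r + G A u' + G u B = t * G u u' := by
    intro G u u' A B r t h
    simp only [map_neg, neg_apply, smul_apply,
      smul_eq_mul] at h
    linarith
  rw [h5]
  exact key _ _ _ _ _ _ _ h1

end IsParam

end Fields

end ConformalGauge

namespace ConformalGauge

variable {d : ℕ} {M : Type*} [TopologicalSpace M]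
  [ChartedSpace (EuclideanSpace ℝ (Fin d)) M]

/-! ### From the bifurcate horizon to its coordinate model -/

section Horizon

namespace IsParam

variable {W : Type*} [NormedAddCommGroup W] [NormedSpace ℝ W]
  {c : W → M} {a : M → W} {w₀ : W} {p : M}

/-- The tangent space of a hypersurface that is a hyperplane in coordinates. -/
lemma frame_mem_tangentSub (h : IsParam (d := d) c a w₀ p) {N : Set M} (ℓ : W →L[ℝ] ℝ)
    (hN : ∀ᶠ w in 𝓝 w₀, c w ∈ N ↔ ℓ w = 0) (h0 : ℓ w₀ = 0) (v : W) :
    (frame (d := d) c w₀ v : TangentSpace (𝓡 d) p) ∈ tangentSub d N p ↔ ℓ v = 0 := by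
  constructor
  · intro hv
    have h1 : diffl (d := d) (fun x => ℓ (a x)) p (frame (d := d) c w₀ v) = 0 := hv _ (h.contMDiffAt_comp_inv ℓ.contDiff.contDiffAt) (by
      filter_upwards [self_mem_nhdsWithin, nhdsWithin_le_nhds (h.tendsto_inv.eventually hN),
        nhdsWithin_le_nhds h.right_inv] with x h1 h2 h3
      rw [h3] at h2
      exact h2.1 h1)
    rw [h.diffl_comp_inv ℓ.differentiableAt, ContinuousLinearMap.comp_apply, h.coframe_frame,
      ContinuousLinearMap.fderiv] at h1
    exact h1
  · intro hv f hf hfN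
    have h1 := h.fderiv_comp (hf.mdifferentiableAt (by simp))
    have hline : HasDerivAt (fun t : ℝ => w₀ + t • v) v 0 := by
      simpa using ((hasDerivAt_id (0 : ℝ)).smul_const v).const_add w₀
    have hlt : Tendsto (fun t : ℝ => w₀ + t • v) (𝓝 0) (𝓝 w₀) := by
      simpa using hline.continuousAt.tendsto
    have h2 : HasFDerivAt (fun w => f (c w)) (_root_.fderiv ℝ (fun w => f (c w)) w₀)
        (w₀ + (0 : ℝ) • v) := by
      simpa using (differentiableAt_of_contDiffAt (h.contDiffAt_comp hf)).hasFDerivAt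
    have h3 := h2.comp_hasDerivAt (0 : ℝ) hline
    have h4 : (fun w => f (c w)) ∘ (fun t : ℝ => w₀ + t • v) =ᶠ[𝓝 0] fun _ => 0 := by
      filter_upwards [hlt.eventually hN, hlt.eventually (h.tendsto.eventually
        (eventually_nhdsWithin_iff.1 hfN))] with t h5 h6
      exact h6 (h5.2 (by simp [h0, hv]))
    have h5 := h3.unique ((hasDerivAt_const (0 : ℝ) (0 : ℝ)).congr_of_eventuallyEq h4)
    rw [h1] at h5
    exact h5

/-- Every tangent vector is given by its components. -/
lemma exists_frame_eq (h : IsParam (d := d) c a w₀ p) (v : TangentSpace (𝓡 d) p) :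
    ∃ u, frame (d := d) c w₀ u = v := ⟨coframe (d := d) a p v, h.frame_coframe v⟩

lemma frame_eq_zero (h : IsParam (d := d) c a w₀ p) {u : W} (hu : frame (d := d) c w₀ u = 0) :
    u = 0 := by
  rw [← h.coframe_frame u, hu, map_zero]

end IsParam

/-- The form of the conformal Killing equation at a zero of η, on vectors along which the derivative
of η vanishes; used to show that ψ vanishes on 𝓢. -/
lemma eq_zero_of_mul_eq_apply_zero {V : Type*} [NormedAddCommGroup V] [NormedSpace ℝ V]
    {D : V →L[ℝ] V →L[ℝ] V →L[ℝ] ℝ} {b : V →L[ℝ] V →L[ℝ] ℝ} {v w : V} {t : ℝ} (ht : t ≠ 0)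
    (h : D 0 v w + b 0 w + b v 0 = t * b v w) : b v w = 0 := by
  have h1 : D 0 v w = 0 := by rw [D.map_zero]; rfl
  have h2 : b 0 w = 0 := by rw [b.map_zero]; rfl
  rw [h1, h2, (b v).map_zero, add_zero, add_zero] at h
  exact (mul_eq_zero.1 h.symm).resolve_left ht

variable [IsManifold (𝓡 d) ∞ M]

variable {F : Type} [NormedAddCommGroup F] [NormedSpace ℝ F] [FiniteDimensional ℝ F]
  {c : ℝ × ℝ × F → M} {a : M → ℝ × ℝ × F} {p : M}

lemma IsParam.flatMetric {W : Type} [NormedAddCommGroup W] [NormedSpace ℝ W]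
    [FiniteDimensional ℝ W] {c : W → M} {a : M → W} {w₀ : W} (h : IsParam (d := d) c a w₀ p)
    {g : FormField d M} (hg : IsSemiRiemannianMetric g) : FlatMetric (pullForm c g) w₀ where
  smooth := by
    filter_upwards [h.eventually] with w hw
    exact hw.contDiffAt_pullForm hg
  symm := Eventually.of_forall fun w v v' => hg.symm _ _ _
  invertible := by
    have hinj : Function.Injective (pullForm c g w₀) := by
      refine (injective_iff_map_eq_zero _).2 fun v hv => h.frame_eq_zero ?_
      refine hg.nondegenerate (c w₀) _ fun u => ?_
      have hp := h.map_eq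
      subst hp
      obtain ⟨u, rfl⟩ := h.exists_frame_eq u
      exact congrArg (fun L : W →L[ℝ] ℝ => L u) hv
    have hdim : Module.finrank ℝ W = Module.finrank ℝ (W →L[ℝ] ℝ) := by
      rw [← (LinearMap.toContinuousLinearMap (𝕜 := ℝ) (E := W) (F' := ℝ)).finrank_eq]
      exact (Subspace.dual_finrank_eq).symm
    let e := LinearEquiv.ofInjectiveOfFinrankEq (pullForm c g w₀).toLinearMap hinj hdim
    exact ⟨e.toContinuousLinearEquiv, by ext; rfl⟩

/-- The data of a bifurcate horizon in adapted coordinates. -/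
lemma IsParam.flatHorizon (h : IsParam (d := d) c a 0 p) (hd : 3 ≤ d) {g : FormField d M}
    {Ω : M → ℝ} (hM : IsConformalManifold g Ω) {η : VField d M} {ψ : M → ℝ}
    (hη : IsConformalKilling g η ψ) {N : Set M} (hN : IsBifurcateHorizon g η (scri Ω) N)
    (hΩ : ∀ x, mvfderiv (𝓡 d) Ω x (η x) = (ψ x - 1) * Ω x)
    (hcΩ : ∀ᶠ z in 𝓝 0, Ω (c z) = z.2.1) (hcN : ∀ᶠ z in 𝓝 0, c z ∈ N ↔ z.1 = 0) :
    FlatHorizon (pullForm c g) (pullField c η) (fun z => ψ (c z)) := by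
  have hcJ : ∀ᶠ z in 𝓝 0, c z ∈ scri Ω ↔ z.2.1 = 0 := by
    filter_upwards [hcΩ] with z hz
    rw [← hz]; rfl
  have hmet := h.flatMetric hM.metric
  have hinv := hmet.eventually_invertible
  have hfield : SmoothNear (pullField c η) 0 := by
    filter_upwards [h.eventually] with z hz
    exact hz.contDiffAt_pullField (hη.smooth_field _)
  have hlie : ∀ᶠ z in 𝓝 0, ∀ v w, fderiv ℝ (pullForm c g) z (pullField c η z) v w +
      pullForm c g z (fderiv ℝ (pullField c η) z v) w +
      pullForm c g z v (fderiv ℝ (pullField c η) z w) = 2 * ψ (c z) * pullForm c g z v w := by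
    filter_upwards [h.eventually] with z hz v w
    exact hz.lie_eq_pullForm hM.metric hη v w
  have hsurf : ∀ᶠ z in 𝓝 0, z.1 = 0 → z.2.1 = 0 → pullField c η z = 0 := by
    filter_upwards [h.eventually, hcJ, hcN] with z hz h1 h2 hx hy
    rw [hz.pullField_apply, hN.vanish _ ⟨h1.2 hy, h2.2 hx⟩]
    exact map_zero (coframe (d := d) a (c z))
  have hnondeg : ∀ᶠ z in 𝓝 0, z.1 = 0 → z.2.1 = 0 → ∀ u, dX F u = 0 → dY F u = 0 →
      (∀ w, dX F w = 0 → dY F w = 0 → pullForm c g z u w = 0) → u = 0 := by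
    filter_upwards [h.eventually, hcJ.eventually_nhds, hcN.eventually_nhds]
      with z hz h1 h2 hx hy u hu1 hu2 hu
    have hJ := hz.frame_mem_tangentSub (dY F) h1 hy
    have hN' := hz.frame_mem_tangentSub (dX F) h2 hx
    refine hz.frame_eq_zero (hN.nondegenerate (c z)
      ⟨h1.self_of_nhds.2 hy, h2.self_of_nhds.2 hx⟩ _ ⟨(hJ u).2 hu2, (hN' u).2 hu1⟩ ?_)
    rintro w ⟨hw1, hw2⟩
    obtain ⟨w, rfl⟩ := hz.exists_frame_eq w
    exact hu w ((hN' w).1 hw2) ((hJ w).1 hw1)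
  have hnull : ∀ᶠ z in 𝓝 0, z.2.1 = 0 → dY F ((pullForm c g z).inverse (dY F)) = 0 := by
    filter_upwards [h.eventually, hcJ.eventually_nhds, hinv] with z hz h1 hi hy
    have hJ := hz.frame_mem_tangentSub (dY F) h1 hy
    obtain ⟨u, hu0, hut, hu⟩ := hN.null_fst.null _ (h1.self_of_nhds.2 hy)
    obtain ⟨u, rfl⟩ := hz.exists_frame_eq u
    have hu0' : u ≠ 0 := by
      rintro rfl
      exact hu0 (map_zero _)
    -- The null generator u is orthogonal to the hyperplane dy = 0, so g(u, ·) is a multiple of dy.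
    -- Hence ∇y is a multiple of u, which is tangent to y = 0.
    have h2 : pullForm c g z u = pullForm c g z u (0, 1, 0) • dY F := by
      refine ContinuousLinearMap.ext fun w => ?_
      have h3 : dY F (w - dY F w • ((0 : ℝ), (1 : ℝ), (0 : F))) = 0 := by simp
      have h4 : pullForm c g z u (w - dY F w • ((0 : ℝ), (1 : ℝ), (0 : F))) = 0 :=
        hu _ ((hJ _).2 h3)
      rw [map_sub, map_smul, sub_eq_zero] at h4
      rw [h4, smul_eq_mul, mul_comm]
      rfl
    have h5 : pullForm c g z u (0, 1, 0) ≠ 0 := by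
      intro h5
      rw [h5, zero_smul] at h2
      exact hu0' (by rw [← hi.inverse_apply_eq.2 h2.symm, map_zero])
    have h6 : (pullForm c g z).inverse (dY F) = (pullForm c g z u (0, 1, 0))⁻¹ • u := by
      rw [hi.inverse_apply_eq, map_smul, h2]
      simp [smul_smul, h5]
    rw [h6, map_smul, (hJ u).1 hut, smul_zero]
  refine ⟨hmet, hfield, h.smoothNear_comp hη.smooth_factor, hlie, ?_, ?_, ?_, hnull, ?_⟩
  · filter_upwards [h.eventually, hcΩ.eventually_nhds] with z hz h1
    have h2 := hz.fderiv_comp (hM.smooth.contMDiffAt.mdifferentiableAt (by simp))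
    have h3 : (fun w => Ω (c w)) =ᶠ[𝓝 z] dY F := h1
    rw [h3.fderiv_eq, ContinuousLinearMap.fderiv] at h2
    have h4 := congrArg (fun L : ℝ × ℝ × F →L[ℝ] ℝ => L (pullField c η z)) h2
    simp only [ContinuousLinearMap.comp_apply, hz.frame_pullField] at h4
    rw [← h1.self_of_nhds]
    exact h4.trans (hΩ (c z))
  · filter_upwards [h.eventually, hcN.eventually_nhds, hcJ] with z hz h2 h1 hx
    have hN' := hz.frame_mem_tangentSub (dX F) h2 hx
    refine (hN' (pullField c η z)).1 ?_
    rw [hz.frame_pullField]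
    by_cases hJ : c z ∈ scri Ω
    · rw [hN.vanish _ ⟨hJ, h2.self_of_nhds.2 hx⟩]
      exact zero_mem _
    · exact (hN.generator_snd _ ⟨h2.self_of_nhds.2 hx, hJ⟩).2.1
  -- Here d ≥ 3 enters: 𝓢 has positive dimension, so nondegeneracy of its metric can contradict ψ ≠
  -- 0.
  · have hF : ∃ s : F, s ≠ 0 := by
      have h1 := h.frameEquiv.toLinearEquiv.finrank_eq
      simp only [Module.finrank_prod, Module.finrank_self, finrank_euclideanSpace,
        Fintype.card_fin] at h1
      have : Nontrivial F := Module.nontrivial_of_finrank_pos (R := ℝ) (by omega)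
      exact exists_ne 0
    obtain ⟨s, hs⟩ := hF
    filter_upwards [hsurf.eventually_nhds, hnondeg, hlie, hfield] with z h1 h2 h3 h4 hx hy
    refine ⟨h1.self_of_nhds hx hy, ?_⟩
    have hder : ∀ r : F, fderiv ℝ (pullField c η) z (0, 0, r) = 0 := by
      intro r
      have hline : HasDerivAt (fun t : ℝ => z + t • ((0 : ℝ), (0 : ℝ), r)) (0, 0, r) 0 := by
        simpa using ((hasDerivAt_id (0 : ℝ)).smul_const ((0 : ℝ), (0 : ℝ), r)).const_add z
      have hlt : Tendsto (fun t : ℝ => z + t • ((0 : ℝ), (0 : ℝ), r)) (𝓝 0) (𝓝 z) := by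
        have := hline.continuousAt.tendsto
        rwa [zero_smul, add_zero] at this
      have h5 : HasFDerivAt (pullField c η) (fderiv ℝ (pullField c η) z)
          (z + (0 : ℝ) • ((0 : ℝ), (0 : ℝ), r)) := by
        rw [zero_smul, add_zero]
        exact (differentiableAt_of_contDiffAt h4).hasFDerivAt
      have h6 := h5.comp_hasDerivAt (0 : ℝ) hline
      refine h6.unique ((hasDerivAt_const (0 : ℝ) (0 : ℝ × ℝ × F)).congr_of_eventuallyEq ?_)
      filter_upwards [hlt.eventually h1] with t ht
      exact ht (by simp [hx]) (by simp [hy])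
    by_contra hψ
    have h7 := h2 hx hy (0, 0, s) rfl rfl (by
      rintro ⟨x, y, r⟩ hx' hy'
      change x = 0 at hx'
      change y = 0 at hy'
      subst hx' hy'
      have h8 := h3 (0, 0, s) (0, 0, r)
      rw [h1.self_of_nhds hx hy, hder, hder] at h8
      exact eq_zero_of_mul_eq_apply_zero (mul_ne_zero two_ne_zero hψ) h8)
    exact hs (congrArg (fun z : ℝ × ℝ × F => z.2.2) h7)
  -- If ⟨dx, dy⟩ = 0, then ∇y, which also satisfies dy(∇y) = 0, is tangent to 𝓢 and orthogonal to
  -- it, hence zero.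
  · intro h1
    have h2 := hnondeg.self_of_nhds rfl rfl _ h1 (hnull.self_of_nhds rfl) (by
      intro w _ hw
      have := hmet.invertible.self_apply_inverse (dY F)
      rw [this, hw])
    have h3 := hmet.invertible.self_apply_inverse (dY F)
    rw [h2, map_zero] at h3
    exact dY_ne_zero h3.symm

end Horizon

end ConformalGauge

namespace ConformalGauge

variable {d : ℕ} {M : Type*} [TopologicalSpace M]
  [ChartedSpace (EuclideanSpace ℝ (Fin d)) M] [IsManifold (𝓡 d) ∞ M]

/-! ### The gauge conditions: locality, composition, coordinate form -/

section Gauge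

/-- `φ` is a smooth function near `x` that puts `(g, Ω)` in a geodesic Killing gauge at `x`. -/
structure IsGaugeAt (g : FormField d M) (Ω : M → ℝ) (η : VField d M) (φ : M → ℝ) (x : M) :
    Prop where
  smooth : ContMDiffAt (𝓡 d) 𝓘(ℝ, ℝ) ∞ φ x
  ne_zero : φ x ≠ 0
  geodesic : gradSq (rescale φ g) (fun y => φ y * Ω y) x = 0
  killing : LieDerivEqAt η (rescale φ g) (fun _ => 0) x

lemma isGeodesicKillingGauge_iff {g : FormField d M} {Ω : M → ℝ} {η : VField d M} {φ : M → ℝ}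
    {V : Set M} (hV : IsOpen V) :
    IsGeodesicKillingGauge g Ω η φ V ↔ ∀ x ∈ V, IsGaugeAt g Ω η φ x := by
  constructor
  · intro h x hx
    exact ⟨h.smooth.contMDiffAt (hV.mem_nhds hx), h.ne_zero x hx, h.geodesic x hx, h.killing x hx⟩
  · intro h
    exact ⟨fun x hx => (h x hx).smooth.contMDiffWithinAt, fun x hx => (h x hx).ne_zero,
      fun x hx => (h x hx).geodesic, fun x hx => (h x hx).killing⟩

omit [IsManifold (𝓡 d) ∞ M] in
lemma lieDerivForm_rescale_congr {g : FormField d M} {η : VField d M} {φ φ' : M → ℝ} {x : M}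
    (h : φ =ᶠ[𝓝 x] φ') (X Y : VField d M) :
    lieDerivForm η (rescale φ g) X Y x = lieDerivForm η (rescale φ' g) X Y x := by
  have h1 : (fun y => rescale φ g y (X y) (Y y)) =ᶠ[𝓝 x] fun y => rescale φ' g y (X y) (Y y) := by
    filter_upwards [h] with y hy
    simp only [rescale, hy]
  have h2 : mvfderiv (𝓡 d) (fun y => rescale φ g y (X y) (Y y)) x =
      mvfderiv (𝓡 d) (fun y => rescale φ' g y (X y) (Y y)) x := by
    rw [mvfderiv, mvfderiv, h1.mfderiv_eq]
    rw [h1.eq_of_nhds]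
  have h3 : rescale φ g x = rescale φ' g x := by simp only [rescale, h.eq_of_nhds]
  rw [lieDerivForm, lieDerivForm, h2, h3]

lemma IsGaugeAt.congr {g : FormField d M} {Ω : M → ℝ} {η : VField d M} {φ φ' : M → ℝ} {x : M}
    (h : IsGaugeAt g Ω η φ x) (he : φ' =ᶠ[𝓝 x] φ) : IsGaugeAt g Ω η φ' x where
  smooth := h.smooth.congr_of_eventuallyEq he
  ne_zero := by rw [he.eq_of_nhds]; exact h.ne_zero
  geodesic := by
    have h1 : (fun y => φ' y * Ω y) =ᶠ[𝓝 x] fun y => φ y * Ω y := by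
      filter_upwards [he] with y hy
      rw [hy]
    have h2 : mvfderiv (𝓡 d) (fun y => φ' y * Ω y) x = mvfderiv (𝓡 d) (fun y => φ y * Ω y) x := by
      rw [mvfderiv, mvfderiv, h1.mfderiv_eq]
      rw [h1.eq_of_nhds]
    have h3 : rescale φ' g x = rescale φ g x := by simp only [rescale, he.eq_of_nhds]
    have h4 := h.geodesic
    rw [gradSq, gradient] at h4 ⊢
    rw [h2, h3]
    exact h4
  killing X Y hX hY := by
    rw [lieDerivForm_rescale_congr he]
    exact h.killing X Y hX hY

omit [IsManifold (𝓡 d) ∞ M] in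
lemma rescale_rescale (χ φ : M → ℝ) (g : FormField d M) :
    rescale χ (rescale φ g) = rescale (fun x => χ x * φ x) g := by
  funext x
  simp only [rescale, smul_smul, mul_pow]

/-- Rescalings compose by multiplication of the factors. This reduces the freedom left in a given
gauge to statements about gauges of the original pair. -/
lemma isGaugeAt_rescale_iff {g : FormField d M} {Ω : M → ℝ} {η : VField d M} {φ χ : M → ℝ} {x : M}
    (hs : ContMDiffAt (𝓡 d) 𝓘(ℝ, ℝ) ∞ φ x) (h0 : φ x ≠ 0) :
    IsGaugeAt (rescale φ g) (fun y => φ y * Ω y) η χ x ↔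
      IsGaugeAt g Ω η (fun y => χ y * φ y) x := by
  constructor
  · rintro ⟨h1, h2, h3, h4⟩
    rw [rescale_rescale] at h3 h4
    simp only [← mul_assoc] at h3
    exact ⟨h1.mul hs, mul_ne_zero h2 h0, h3, h4⟩
  · rintro ⟨h1, h2, h3, h4⟩
    refine ⟨?_, left_ne_zero_of_mul h2, ?_, ?_⟩
    · refine (h1.mul (hs.inv₀ h0)).congr_of_eventuallyEq ?_
      filter_upwards [hs.continuousAt.eventually_ne h0] with y hy
      simp [hy]
    · rw [rescale_rescale]
      simpa only [← mul_assoc] using h3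
    · rw [rescale_rescale]
      exact h4

/-- Smooth vector fields through given vectors. -/
lemma exists_smoothAt_eq (x : M) (v : TangentSpace (𝓡 d) x) :
    ∃ X : VField d M, X.SmoothAt x ∧ X x = v := by
  have h := isParam_extChartAt (d := d) x
  obtain ⟨u, hu⟩ := h.exists_frame_eq v
  exact ⟨_, h.smoothAt_constField u, (h.constField_apply u).trans hu⟩

omit [IsManifold (𝓡 d) ∞ M] in
lemma lieDerivForm_rescale {g : FormField d M} {η : VField d M} {φ : M → ℝ} {x : M}
    {X Y : VField d M}
    (hφ : MDifferentiableAt (𝓡 d) 𝓘(ℝ, ℝ) φ x)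
    (hg : MDifferentiableAt (𝓡 d) 𝓘(ℝ, ℝ) (fun y => g y (X y) (Y y)) x) :
    lieDerivForm η (rescale φ g) X Y x =
      2 * φ x * mvfderiv (𝓡 d) φ x (η x) * g x (X x) (Y x) +
        φ x ^ 2 * lieDerivForm η g X Y x := by
  have h1 : (fun y => rescale φ g y (X y) (Y y)) =
      fun y => φ y * (φ y * g y (X y) (Y y)) := by
    funext y
    change φ y ^ 2 * g y (X y) (Y y) = _
    ring
  have h2 : ∀ v w : TangentSpace (𝓡 d) x, rescale φ g x v w = φ x ^ 2 * g x v w := fun _ _ => rfl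
  rw [lieDerivForm, h1, mvfderiv_fun_mul hφ (show MDifferentiableAt (𝓡 d) 𝓘(ℝ, ℝ)
    (fun y => φ y * g y (X y) (Y y)) x from hφ.mul hg), mvfderiv_fun_mul hφ hg, h2, h2,
    lieDerivForm]
  simp only [add_apply, smul_apply, smul_eq_mul]
  ring

/-- By the Leibniz rule, L_η(φ²g) = 2φ(η(φ) + ψφ) g, and g is not the zero form because d > 0. -/
lemma IsConformalKilling.lieDerivEqAt_rescale_iff {g : FormField d M} {η : VField d M} {ψ : M → ℝ}
    (hη : IsConformalKilling g η ψ) (hg : IsSemiRiemannianMetric g) (hd : 0 < d) {φ : M → ℝ} {x : M}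
    (hφ : MDifferentiableAt (𝓡 d) 𝓘(ℝ, ℝ) φ x) (h0 : φ x ≠ 0) :
    LieDerivEqAt η (rescale φ g) (fun _ => 0) x ↔
      mvfderiv (𝓡 d) φ x (η x) = -ψ x * φ x := by
  have key : ∀ X Y : VField d M, X.SmoothAt x → Y.SmoothAt x →
      lieDerivForm η (rescale φ g) X Y x =
        2 * φ x * (mvfderiv (𝓡 d) φ x (η x) + ψ x * φ x) * g x (X x) (Y x) := by
    intro X Y hX hY
    have h1 : lieDerivForm η g X Y x = 2 * ψ x * g x (X x) (Y x) := hη.lie_eq x X Y hX hY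
    rw [lieDerivForm_rescale hφ ((hg.contMDiffAt_apply hX hY).mdifferentiableAt (by simp)), h1]
    ring
  constructor
  · intro h
    obtain ⟨v, hv⟩ : ∃ v : TangentSpace (𝓡 d) x, v ≠ 0 := by
      have : Nonempty (Fin d) := ⟨⟨0, hd⟩⟩
      exact exists_ne (0 : EuclideanSpace ℝ (Fin d))
    obtain ⟨w, hw⟩ : ∃ w, g x v w ≠ 0 := by
      by_contra! h
      exact hv (hg.nondegenerate x v h)
    obtain ⟨X, hX, rfl⟩ := exists_smoothAt_eq x v
    obtain ⟨Y, hY, rfl⟩ := exists_smoothAt_eq x w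
    have h1 := (key X Y hX hY).symm.trans (h X Y hX hY)
    have h2 : 2 * φ x * (mvfderiv (𝓡 d) φ x (η x) + ψ x * φ x) * g x (X x) (Y x) = 0 := h1
    have h3 := (mul_eq_zero.1 ((mul_eq_zero.1 h2).resolve_right hw)).resolve_left
      (mul_ne_zero two_ne_zero h0)
    linarith
  · intro h X Y hX hY
    rw [key X Y hX hY, h]
    change _ = (0 : ℝ)
    ring

/-- The norm of a gradient, in terms of the inverse metric in coordinates. -/
lemma IsParam.gradSq_rescale {W : Type} [NormedAddCommGroup W] [NormedSpace ℝ W]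
    [FiniteDimensional ℝ W] {c : W → M} {a : M → W} {z : W} {q : M}
    (h : IsParam (d := d) c a z q) {g : FormField d M} (hg : IsSemiRiemannianMetric g)
    {φ f : M → ℝ} (hf : MDifferentiableAt (𝓡 d) 𝓘(ℝ, ℝ) f q) (h0 : φ q ≠ 0) :
    gradSq (rescale φ g) f q = (φ q ^ 2)⁻¹ *
      fderiv ℝ (fun w => f (c w)) z ((pullForm c g z).inverse (fderiv ℝ (fun w => f (c w)) z)) := by
  have hp := h.map_eq
  subst hp
  have hi := (h.flatMetric hg).invertible
  set α := fderiv ℝ (fun w => f (c w)) z with hα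
  have hα' : α = (diffl (d := d) f (c z)).comp (frame (d := d) c z) := h.fderiv_comp hf
  set u := (pullForm c g z).inverse α with hu
  have hgu : pullForm c g z u = α := hi.self_apply_inverse α
  let G : EuclideanSpace ℝ (Fin d) →L[ℝ] EuclideanSpace ℝ (Fin d) →L[ℝ] ℝ := rescale φ g (c z)
  have h1 : ∀ v w, pullForm c g z v w = (φ (c z) ^ 2)⁻¹ *
      G (frame (d := d) c z v) (frame (d := d) c z w) := by
    intro v w
    change g (c z) _ _ = (φ (c z) ^ 2)⁻¹ * (φ (c z) ^ 2 * g (c z) _ _)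
    rw [inv_mul_cancel_left₀ (pow_ne_zero 2 h0)]
    rfl
  have h2 : G ((φ (c z) ^ 2)⁻¹ • frame (d := d) c z u) = diffl (d := d) f (c z) := by
    refine ContinuousLinearMap.ext fun w => ?_
    obtain ⟨w, rfl⟩ := h.exists_frame_eq w
    rw [map_smul, smul_apply, smul_eq_mul, ← h1, hgu, hα']
    rfl
  have hGi : G.IsInvertible := by
    have hinj : Function.Injective G := by
      refine (injective_iff_map_eq_zero _).2 fun v hv => ?_
      refine hg.nondegenerate (c z) v fun w => ?_
      have h3 : φ (c z) ^ 2 * g (c z) v w = 0 := congrArg (fun L => L w) hv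
      exact (mul_eq_zero.1 h3).resolve_left (pow_ne_zero 2 h0)
    have hdim : Module.finrank ℝ (EuclideanSpace ℝ (Fin d)) =
        Module.finrank ℝ (EuclideanSpace ℝ (Fin d) →L[ℝ] ℝ) := by
      rw [← (LinearMap.toContinuousLinearMap (𝕜 := ℝ) (E := EuclideanSpace ℝ (Fin d))
        (F' := ℝ)).finrank_eq]
      exact (Subspace.dual_finrank_eq).symm
    exact ⟨(LinearEquiv.ofInjectiveOfFinrankEq G.toLinearMap hinj hdim).toContinuousLinearEquiv,
      by ext; rfl⟩
  have h3 : G.inverse (diffl (d := d) f (c z)) = (φ (c z) ^ 2)⁻¹ • frame (d := d) c z u :=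
    hGi.inverse_apply_eq.2 h2.symm
  have h4 : gradSq (rescale φ g) f (c z) = G (G.inverse (diffl (d := d) f (c z)))
    (G.inverse (diffl (d := d) f (c z))) := rfl
  rw [h4, h3, h2, map_smul, smul_eq_mul, hα']
  rfl

/-- The gauge conditions in adapted coordinates. -/
lemma IsParam.isGaugeAt_iff {F : Type} [NormedAddCommGroup F] [NormedSpace ℝ F]
    [FiniteDimensional ℝ F] {c : ℝ × ℝ × F → M} {a : M → ℝ × ℝ × F} {z : ℝ × ℝ × F} {q : M}
    (h : IsParam (d := d) c a z q) (hd : 0 < d) {g : FormField d M} {Ω : M → ℝ}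
    (hM : IsConformalManifold g Ω) {η : VField d M} {ψ : M → ℝ} (hη : IsConformalKilling g η ψ)
    (hcΩ : ∀ᶠ w in 𝓝 z, Ω (c w) = w.2.1) {φ : M → ℝ} {σ : ℝ × ℝ × F → ℝ} {ε : ℝ} (hε : ε ≠ 0)
    (hσ : ContDiffAt ℝ ∞ σ z) (hφ : ∀ᶠ w in 𝓝 z, φ (c w) = ε * Real.exp (σ w)) :
    IsGaugeAt g Ω η φ q ↔
      FlatGauge (pullForm c g) (pullField c η) (fun w => ψ (c w)) σ z := by
  have hσd := (differentiableAt_of_contDiffAt hσ).hasFDerivAt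
  have hφs : ContMDiffAt (𝓡 d) 𝓘(ℝ, ℝ) ∞ φ q := by
    refine (h.contMDiffAt_comp_inv (contDiffAt_const.mul hσ.exp)).congr_of_eventuallyEq
      (f := fun x => ε * Real.exp (σ (a x))) ?_
    filter_upwards [h.tendsto_inv.eventually hφ, h.right_inv] with x h1 h2
    rw [← h1, h2]
  have hφm : MDifferentiableAt (𝓡 d) 𝓘(ℝ, ℝ) φ q := hφs.mdifferentiableAt (by simp)
  have hφz : φ q = ε * Real.exp (σ z) := by
    rw [← hφ.self_of_nhds, h.map_eq]
  have h0 : φ q ≠ 0 := by rw [hφz]; exact mul_ne_zero hε (Real.exp_pos _).ne'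
  have hdφ : HasFDerivAt (fun w => φ (c w)) (φ q • fderiv ℝ σ z) z := by
    refine HasFDerivAt.congr_of_eventuallyEq ?_ hφ
    rw [hφz, ← smul_smul]
    exact hσd.exp.const_mul ε
  have hdf : HasFDerivAt (fun w => φ (c w) * Ω (c w)) (φ q • gaugeForm σ z) z := by
    have h1 : HasFDerivAt (fun w => Ω (c w)) (dY F) z :=
      (dY F).hasFDerivAt.congr_of_eventuallyEq hcΩ
    have h2 := hdφ.mul h1
    rw [hcΩ.self_of_nhds, h.map_eq] at h2
    rw [gaugeForm, smul_add, smul_comm]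
    exact h2
  have e1 : gradSq (rescale φ g) (fun y => φ y * Ω y) q = 0 ↔
      gaugeForm σ z ((pullForm c g z).inverse (gaugeForm σ z)) = 0 := by
    rw [h.gradSq_rescale (f := fun y => φ y * Ω y) hM.metric
      (hφm.mul (hM.smooth.contMDiffAt.mdifferentiableAt (by simp))) h0, hdf.fderiv]
    rw [map_smul, map_smul, smul_apply, smul_eq_mul, smul_eq_mul, mul_eq_zero, mul_eq_zero,
      mul_eq_zero]
    simp [h0]
  have e2 : LieDerivEqAt η (rescale φ g) (fun _ => 0) q ↔
      fderiv ℝ σ z (pullField c η z) = -ψ (c z) := by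
    rw [hη.lieDerivEqAt_rescale_iff hM.metric hd hφm h0]
    have h1 := congrArg (fun L : ℝ × ℝ × F →L[ℝ] ℝ => L (pullField c η z)) (h.fderiv_comp hφm)
    rw [hdφ.fderiv] at h1
    simp only [ContinuousLinearMap.comp_apply, h.frame_pullField] at h1
    have h2 : mvfderiv (𝓡 d) φ q (η q) = φ q * fderiv ℝ σ z (pullField c η z) := h1.symm
    rw [h2, h.map_eq, mul_comm]
    exact mul_left_inj' h0
  constructor
  · intro hG
    exact ⟨e2.1 hG.killing, e1.1 hG.geodesic⟩
  · intro hG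
    exact ⟨hφs, h0, e1.2 hG.2, e2.2 hG.1⟩

end Gauge

end ConformalGauge

namespace ConformalGauge

variable {d : ℕ} {M : Type*} [TopologicalSpace M]
  [ChartedSpace (EuclideanSpace ℝ (Fin d)) M] [IsManifold (𝓡 d) ∞ M]

/-! ### Local and global existence and uniqueness of gauges on the manifold -/

section Bifurcate

/-- `Real.log` is log |·|, so only the sign has to be restored, and it is locally constant where f
has no zeros. -/
lemma eventually_eq_sign_mul_exp_log {X : Type*} [TopologicalSpace X] {f : X → ℝ} {x : X}
    (hf : ContinuousAt f x) (h0 : f x ≠ 0) :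
    ∀ᶠ y in 𝓝 x, f y = (f x / |f x|) * Real.exp (Real.log (f y)) := by
  have h1 : ∀ᶠ y in 𝓝 x, 0 < f x * f y :=
    (continuousAt_const.mul hf).eventually (lt_mem_nhds (mul_self_pos.2 h0))
  filter_upwards [h1] with y hy
  rw [Real.exp_log_eq_abs (right_ne_zero_of_mul hy.ne'), div_mul_eq_mul_div,
    eq_div_iff (abs_ne_zero.2 h0)]
  rcases lt_or_gt_of_ne h0 with h | h
  · rw [abs_of_neg h, abs_of_neg (neg_of_mul_pos_right hy h.le)]
    ring
  · rw [abs_of_pos h, abs_of_pos (pos_of_mul_pos_right hy h.le)]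
    ring

variable {g : FormField d M} {Ω : M → ℝ} {η : VField d M} {ψ : M → ℝ} {N : Set M}

/-- Two gauges that agree on the bifurcation surface agree near it. -/
lemma IsGaugeAt.eventuallyEq (hd : 3 ≤ d) (hM : IsConformalManifold g Ω)
    (hη : IsConformalKilling g η ψ) (hN : IsBifurcateHorizon g η (scri Ω) N)
    (hΩ : ∀ x, mvfderiv (𝓡 d) Ω x (η x) = (ψ x - 1) * Ω x) {p : M} (hp : p ∈ scri Ω ∩ N)
    {φ₁ φ₂ : M → ℝ} (h₁ : ∀ᶠ x in 𝓝 p, IsGaugeAt g Ω η φ₁ x)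
    (h₂ : ∀ᶠ x in 𝓝 p, IsGaugeAt g Ω η φ₂ x)
    (heq : ∀ᶠ x in 𝓝 p, x ∈ scri Ω ∩ N → φ₁ x = φ₂ x) : φ₁ =ᶠ[𝓝 p] φ₂ := by
  obtain ⟨F, c, a, h, hcΩ, hcN⟩ := exists_adaptedParam hM.smooth hN.null_snd.hypersurface hp
    (hM.regular p hp.1) (hN.transverse p hp)
  have hflat := h.flatHorizon hd hM hη hN hΩ hcΩ hcN
  have hlog : ∀ φ : M → ℝ, (∀ᶠ x in 𝓝 p, IsGaugeAt g Ω η φ x) →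
      SmoothNear (fun z => Real.log (φ (c z))) 0 ∧
      (∀ᶠ z in 𝓝 0, φ (c z) = (φ p / |φ p|) * Real.exp (Real.log (φ (c z)))) ∧
      ∀ᶠ z in 𝓝 0, FlatGauge (pullForm c g) (pullField c η) (fun z => ψ (c z))
        (fun z => Real.log (φ (c z))) z := by
    intro φ hφ
    have hs : SmoothNear (fun z => Real.log (φ (c z))) 0 := by
      filter_upwards [h.eventually, h.tendsto.eventually hφ] with z h1 h2
      exact (h1.contDiffAt_comp h2.smooth).log h2.ne_zero
    have he : ∀ᶠ z in 𝓝 0, φ (c z) = (φ p / |φ p|) * Real.exp (Real.log (φ (c z))) :=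
      h.tendsto.eventually (eventually_eq_sign_mul_exp_log
        hφ.self_of_nhds.smooth.continuousAt hφ.self_of_nhds.ne_zero)
    refine ⟨hs, he, ?_⟩
    filter_upwards [h.eventually, h.tendsto.eventually hφ, hs, he.eventually_nhds,
      hcΩ.eventually_nhds] with z h1 h2 h3 h4 h5
    exact (h1.isGaugeAt_iff (by omega) hM hη h5
      (div_ne_zero hφ.self_of_nhds.ne_zero (abs_ne_zero.2 hφ.self_of_nhds.ne_zero)) h3 h4).1 h2
  obtain ⟨hs₁, he₁, hg₁⟩ := hlog φ₁ h₁
  obtain ⟨hs₂, he₂, hg₂⟩ := hlog φ₂ h₂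
  have hslice : Tendsto (fun s : F => ((0 : ℝ), (0 : ℝ), s)) (𝓝 0) (𝓝 0) := by
    have : Continuous (fun s : F => ((0 : ℝ), (0 : ℝ), s)) := by fun_prop
    exact this.tendsto 0
  have h0 := hflat.gauge_unique hs₁ hs₂ hg₁ hg₂ (by
    filter_upwards [hslice.eventually hcΩ, hslice.eventually hcN,
      hslice.eventually (h.tendsto.eventually heq)] with s h1 h2 h3
    simp only [h3 ⟨h1, h2.2 rfl⟩])
  filter_upwards [h.tendsto_inv.eventually h0, h.tendsto_inv.eventually he₁,
    h.tendsto_inv.eventually he₂, h.right_inv] with x h3 h4 h5 h6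
  rw [h6] at h3 h4 h5
  -- The logarithms determine the gauges up to sign; equality at p makes the signs agree.
  rw [h4, h5, h3, heq.self_of_nhds hp]

/-- Gauges with given values on the bifurcation surface exist locally. -/
lemma exists_local_gauge (hd : 3 ≤ d) (hM : IsConformalManifold g Ω)
    (hη : IsConformalKilling g η ψ) (hN : IsBifurcateHorizon g η (scri Ω) N)
    (hΩ : ∀ x, mvfderiv (𝓡 d) Ω x (η x) = (ψ x - 1) * Ω x) {θ : ↥(scri Ω ∩ N) → ℝ}
    (hθ : IsSmoothOn d θ) (hθ0 : ∀ p, θ p ≠ 0) (p : ↥(scri Ω ∩ N)) :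
    ∃ (V : Set M) (φ : M → ℝ), IsOpen V ∧ ↑p ∈ V ∧ (∀ x ∈ V, IsGaugeAt g Ω η φ x) ∧
      ∀ q : ↥(scri Ω ∩ N), ↑q ∈ V → φ q = θ q := by
  classical
  let θ' : M → ℝ := fun x => if hx : x ∈ scri Ω ∩ N then θ ⟨x, hx⟩ else 0
  have hθ' : ∀ q : ↥(scri Ω ∩ N), θ' q = θ q := fun q => dif_pos q.2
  obtain ⟨F, c, a, h, hcΩ, hcN⟩ := exists_adaptedParam hM.smooth hN.null_snd.hypersurface p.2
    (hM.regular p p.2.1) (hN.transverse p p.2)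
  have hflat := h.flatHorizon hd hM hη hN hΩ hcΩ hcN
  let ι : F → ℝ × ℝ × F := fun s => (0, 0, s)
  have hι : Continuous ι := by fun_prop
  have hι0 : Tendsto ι (𝓝 0) (𝓝 0) := hι.tendsto 0
  have hS : ∀ᶠ s in 𝓝 (0 : F), c (ι s) ∈ scri Ω ∩ N := by
    filter_upwards [hι0.eventually hcΩ, hι0.eventually hcN] with s h1 h2
    exact ⟨h1, h2.2 rfl⟩
  -- In the coordinate s along 𝓢, θ is locally the restriction of a smooth function on M; the values
  -- of the extension off 𝓢 play no role.
  have hsm : SmoothNear (fun s : F => θ' (c (ι s))) 0 := by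
    filter_upwards [hS.eventually_nhds, hι0.eventually h.eventually] with s h1 h2
    obtain ⟨f, hf, hfθ⟩ := hθ ⟨c (ι s), h1.self_of_nhds⟩
    have h3 : ContDiffAt ℝ ∞ (fun s : F => f (c (ι s))) s :=
      (h2.contDiffAt_comp hf).comp s (f := ι)
        (contDiff_const.prodMk (contDiff_const.prodMk contDiff_id)).contDiffAt
    refine h3.congr_of_eventuallyEq ?_
    rw [nhds_subtype, eventually_comap] at hfθ
    filter_upwards [h1, ((h2.tendsto.comp hι.continuousAt).eventually hfθ)] with s' h4 h5
    rw [h5 ⟨_, h4⟩ rfl]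
    exact hθ' ⟨_, h4⟩
  have hcp : c (ι 0) = p := h.map_eq
  have hθp : θ' (c (ι 0)) ≠ 0 := by
    rw [hcp, hθ' p]
    exact hθ0 p
  have hv : SmoothNear (fun s : F => Real.log (θ' (c (ι s)))) 0 := by
    filter_upwards [hsm, hsm.continuousAt.eventually_ne hθp] with s h1 h2
    exact h1.log h2
  have hsign := eventually_eq_sign_mul_exp_log hsm.continuousAt hθp
  set ε := θ' (c (ι 0)) / |θ' (c (ι 0))| with hε
  have hε0 : ε ≠ 0 := div_ne_zero hθp (abs_ne_zero.2 hθp)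
  obtain ⟨σ, hσ, hσ0, hσg⟩ := hflat.exists_gauge hv
  let φ : M → ℝ := fun x => ε * Real.exp (σ (a x))
  have hgauge : ∀ᶠ z in 𝓝 0, IsGaugeAt g Ω η φ (c z) := by
    filter_upwards [h.eventually, hσ, hσg, hcΩ.eventually_nhds, h.left_inv.eventually_nhds]
      with z h1 h2 h3 h4 h5
    refine (h1.isGaugeAt_iff (by omega) hM hη h4 hε0 h2 ?_).2 h3
    filter_upwards [h5] with w hw
    simp only [φ, hw]
  have hsnd : Tendsto (fun z : ℝ × ℝ × F => z.2.2) (𝓝 0) (𝓝 0) :=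
    (continuous_snd.comp continuous_snd).tendsto 0
  have hval : ∀ᶠ z in 𝓝 0, c z ∈ scri Ω ∩ N → φ (c z) = θ' (c z) := by
    filter_upwards [hcΩ, hcN, h.left_inv, hsnd.eventually hσ0, hsnd.eventually hsign]
      with z h1 h2 h3 h4 h5 hz
    -- A point of 𝓢 has x = y = 0, so it is recovered from its coordinate s.
    have h6 : ι z.2.2 = z := Prod.ext (h2.1 hz.2).symm (Prod.ext (h1.symm.trans hz.1).symm rfl)
    have h7 : σ z = Real.log (θ' (c z)) := by
      have : σ (ι z.2.2) = Real.log (θ' (c (ι z.2.2))) := h4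
      rwa [h6] at this
    rw [h6] at h5
    simp only [φ, h3]
    rw [h7]
    exact h5.symm
  have hall : ∀ᶠ x in 𝓝 (p : M), IsGaugeAt g Ω η φ x ∧ (x ∈ scri Ω ∩ N → φ x = θ' x) := by
    filter_upwards [h.tendsto_inv.eventually hgauge, h.tendsto_inv.eventually hval, h.right_inv]
      with x h1 h2 h3
    rw [h3] at h1 h2
    exact ⟨h1, h2⟩
  obtain ⟨V, hV, hVo, hpV⟩ := eventually_nhds_iff.1 hall
  exact ⟨V, φ, hVo, hpV, fun x hx => (hV x hx).1, fun q hq =>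
    ((hV q hq).2 q.2).trans (hθ' q)⟩

/-- Gauges with given values on the bifurcation surface exist. -/
lemma exists_gauge [T2Space M] [SecondCountableTopology M] (hd : 3 ≤ d)
    (hM : IsConformalManifold g Ω)
    (hη : IsConformalKilling g η ψ) (hN : IsBifurcateHorizon g η (scri Ω) N)
    (hΩ : ∀ x, mvfderiv (𝓡 d) Ω x (η x) = (ψ x - 1) * Ω x) {θ : ↥(scri Ω ∩ N) → ℝ}
    (hθ : IsSmoothOn d θ) (hθ0 : ∀ p, θ p ≠ 0) :
    ∃ (V : Set M) (φ : M → ℝ), IsOpen V ∧ scri Ω ∩ N ⊆ V ∧ (∀ x ∈ V, IsGaugeAt g Ω η φ x) ∧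
      ∀ q : ↥(scri Ω ∩ N), φ q = θ q := by
  choose V f hVo hpV hf hfθ using exists_local_gauge hd hM hη hN hΩ hθ hθ0
  have : LocallyCompactSpace M := ChartedSpace.locallyCompactSpace (EuclideanSpace ℝ (Fin d)) M
  have : TopologicalSpace.MetrizableSpace M := Manifold.metrizableSpace (𝓡 d) M
  obtain ⟨U, φ, hU, hSU, hφ⟩ := exists_glue V f hVo hpV (fun p q s hs hp hq => by
    refine IsGaugeAt.eventuallyEq hd hM hη hN hΩ hs ?_ ?_ ?_
    · filter_upwards [(hVo p).mem_nhds hp] with x hx using hf p x hx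
    · filter_upwards [(hVo q).mem_nhds hq] with x hx using hf q x hx
    · filter_upwards [(hVo p).mem_nhds hp, (hVo q).mem_nhds hq] with x h1 h2 hx
      exact (hfθ p ⟨x, hx⟩ h1).trans (hfθ q ⟨x, hx⟩ h2).symm)
  refine ⟨U, φ, hU, hSU, fun x hx => ?_, fun q => ?_⟩
  · obtain ⟨p, hp, he⟩ := hφ x hx
    exact (hf p x hp).congr he
  · obtain ⟨p, hp, he⟩ := hφ q (hSU q.2)
    rw [he.eq_of_nhds]
    exact hfθ p q hp

end Bifurcate

end ConformalGauge
-- The theorem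
theorem mainTheorem5 {d : ℕ} (hd : 3 ≤ d) {M : Type*} [TopologicalSpace M] [T2Space M]
    [SecondCountableTopology M] [ChartedSpace (EuclideanSpace ℝ (Fin d)) M]
    [IsManifold (𝓡 d) ∞ M]
    (g : ConformalGauge.FormField d M) (Ω : M → ℝ)
    (hM : ConformalGauge.IsConformalManifold g Ω)
    (η : ConformalGauge.VField d M) (ψ : M → ℝ)
    (hη : ConformalGauge.IsConformalKilling g η ψ)
    (N : Set M)
    (hN : ConformalGauge.IsBifurcateHorizon g η (ConformalGauge.scri Ω) N)
    (hΩ : ∀ x, mvfderiv (𝓡 d) Ω x (η x) = (ψ x - 1) * Ω x) :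
    -- existence of a geodesic Killing gauge near the bifurcation surface
    (∃ (U : Set M) (φ : M → ℝ), IsOpen U ∧ ConformalGauge.scri Ω ∩ N ⊆ U ∧
      ConformalGauge.IsGeodesicKillingGauge g Ω η φ U) ∧
    -- the remaining freedom is a nowhere vanishing function on the bifurcation surface
    (∀ (U : Set M) (φ : M → ℝ), IsOpen U → ConformalGauge.scri Ω ∩ N ⊆ U →
      ConformalGauge.IsGeodesicKillingGauge g Ω η φ U →
      (∀ θ : ↥(ConformalGauge.scri Ω ∩ N) → ℝ, ConformalGauge.IsSmoothOn d θ →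
        (∀ p, θ p ≠ 0) →
        ∃ (V : Set M) (χ : M → ℝ), IsOpen V ∧ ConformalGauge.scri Ω ∩ N ⊆ V ∧ V ⊆ U ∧
          ConformalGauge.IsGeodesicKillingGauge (ConformalGauge.rescale φ g)
            (fun x => φ x * Ω x) η χ V ∧
          ∀ p : ↥(ConformalGauge.scri Ω ∩ N), χ p = θ p) ∧
      (∀ (V₁ V₂ : Set M) (χ₁ χ₂ : M → ℝ), IsOpen V₁ → IsOpen V₂ →
        ConformalGauge.scri Ω ∩ N ⊆ V₁ → V₁ ⊆ U → ConformalGauge.scri Ω ∩ N ⊆ V₂ → V₂ ⊆ U →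
        ConformalGauge.IsGeodesicKillingGauge (ConformalGauge.rescale φ g)
          (fun x => φ x * Ω x) η χ₁ V₁ →
        ConformalGauge.IsGeodesicKillingGauge (ConformalGauge.rescale φ g)
          (fun x => φ x * Ω x) η χ₂ V₂ →
        (∀ p ∈ ConformalGauge.scri Ω ∩ N, χ₁ p = χ₂ p) →
        ∃ W : Set M, IsOpen W ∧ ConformalGauge.scri Ω ∩ N ⊆ W ∧ W ⊆ V₁ ∩ V₂ ∧
          ∀ x ∈ W, χ₁ x = χ₂ x)) := by
  refine ⟨?_, fun U φ hU hSU hφ => ⟨?_, ?_⟩⟩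
  · obtain ⟨V, φ, hV, hSV, hφ, -⟩ := ConformalGauge.exists_gauge hd hM hη hN hΩ
      (θ := fun _ => 1) (fun p => ⟨fun _ => 1, contMDiffAt_const, Eventually.of_forall fun _ => rfl⟩)
      (fun _ => one_ne_zero)
    exact ⟨V, φ, hV, hSV, (ConformalGauge.isGeodesicKillingGauge_iff hV).2 hφ⟩
  · intro θ hθ hθ0
    -- A gauge of (g, Ω) with values θφ on 𝓢, divided by φ, is a gauge of the rescaled pair with
    -- values θ.
    obtain ⟨V, ρ, hV, hSV, hρ, hρθ⟩ := ConformalGauge.exists_gauge hd hM hη hN hΩ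
      (θ := fun q => θ q * φ q) (fun p => by
        obtain ⟨f, hf, hfθ⟩ := hθ p
        refine ⟨fun x => f x * φ x, hf.mul (hφ.smooth.contMDiffAt (hU.mem_nhds (hSU p.2))), ?_⟩
        filter_upwards [hfθ] with q hq
        rw [hq]) (fun p => mul_ne_zero (hθ0 p) (hφ.ne_zero p (hSU p.2)))
    refine ⟨V ∩ U, fun x => ρ x / φ x, hV.inter hU, subset_inter hSV hSU, inter_subset_right,
      (ConformalGauge.isGeodesicKillingGauge_iff (hV.inter hU)).2 fun x hx => ?_, fun p => ?_⟩
    · refine (ConformalGauge.isGaugeAt_rescale_iff (hφ.smooth.contMDiffAt (hU.mem_nhds hx.2))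
        (hφ.ne_zero x hx.2)).2 ((hρ x hx.1).congr ?_)
      filter_upwards [hU.mem_nhds hx.2] with y hy
      exact div_mul_cancel₀ _ (hφ.ne_zero y hy)
    · change ρ p / φ p = θ p
      rw [hρθ p]
      exact mul_div_cancel_right₀ _ (hφ.ne_zero p (hSU p.2))
  · intro V₁ V₂ χ₁ χ₂ hV₁ hV₂ hS₁ h₁U hS₂ h₂U hχ₁ hχ₂ heq
    have hg : ∀ (V : Set M) (χ : M → ℝ), IsOpen V → V ⊆ U →
        ConformalGauge.IsGeodesicKillingGauge (ConformalGauge.rescale φ g)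
          (fun x => φ x * Ω x) η χ V → ∀ p ∈ V,
          ∀ᶠ x in 𝓝 p, ConformalGauge.IsGaugeAt g Ω η (fun y => χ y * φ y) x := by
      intro V χ hV hVU hχ p hp
      filter_upwards [hV.mem_nhds hp] with x hx
      exact (ConformalGauge.isGaugeAt_rescale_iff
        (hφ.smooth.contMDiffAt (hU.mem_nhds (hVU hx))) (hφ.ne_zero x (hVU hx))).1
        ((ConformalGauge.isGeodesicKillingGauge_iff hV).1 hχ x hx)
    refine ⟨interior {x | χ₁ x = χ₂ x} ∩ (V₁ ∩ V₂), isOpen_interior.inter (hV₁.inter hV₂),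
      fun p hp => ⟨?_, hS₁ hp, hS₂ hp⟩, inter_subset_right, fun x hx => ?_⟩
    swap
    · have h1 : x ∈ {x | χ₁ x = χ₂ x} := interior_subset hx.1
      exact h1
    -- Uniqueness is applied to χ₁φ and χ₂φ, both gauges of (g, Ω); φ is then cancelled.
    have h1 := ConformalGauge.IsGaugeAt.eventuallyEq hd hM hη hN hΩ hp
      (hg V₁ χ₁ hV₁ h₁U hχ₁ p (hS₁ hp)) (hg V₂ χ₂ hV₂ h₂U hχ₂ p (hS₂ hp))
      (Eventually.of_forall fun x hx => by rw [heq x hx])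
    refine mem_interior_iff_mem_nhds.2 ?_
    filter_upwards [h1, hU.mem_nhds (hSU hp)] with x hx hxU
    exact mul_right_cancel₀ (hφ.ne_zero x hxU) hx
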